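/- \textbf{Setting.} An instance of busy-time scheduling on heterogeneous machines (BSHM) has finitely many machine types $1,\dots,m$, type $z$ with capacity $g_z>0$ and cost rate $r_z>0$ and with arbitrarily many machines, and a finite set $\mathcal J$ of jobs; job $J$ has size $s(J)>0$ and a nonempty active interval $I(J)=[I(J)^-,I(J)^+)$, and fits on some type. A schedule puts every job on one machine so that at each time the total size of the jobs running on a machine is at most its capacity; every machine used pays its cost rate times the measure of the time during which it runs a job. $OPT_{BSHM}$ is the least total cost. For $X\subseteq\mathcal J$ let $X(t)$ be the jobs of $X$ active at $t$, $S(X)$ their total size, $S(X,t)=S(X(t))$, and $\mathrm{span}(X)=\bigcup_{J\in X}I(J)$. The instance is \emph{standard} if $g_1<\dots<g_m$, $r_1<\dots<r_m$ and every $r_z$ is an integral power of $8$. The exact type $m(J)$ is the least $z$ with $s(J)\le g_z$. \textbf{One-shot optimum.} $OPT_{one\text{-}shot}(X)$ is the minimum of $\sum_z w(z)r_z$ over $w\in\mathbb Z_{\ge0}^m$ with $S(\{J\in X:m(J)\ge i\})\le\sum_{z\ge i}w(z)g_z$ for all $i$. \textbf{Algorithm.} The parent of type $i$ is the least $k>i$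 with $r_k/g_k<r_i/g_i$, if there is one; $A_z$ is the set consisting of $z$ and its descendants, $f(z)$ the set of children of $z$. For $z=m,m-1,\dots,1$, $ALG_{offline}$ takes the set $\mathcal R_z$ of jobs $J$ with $m(J)\in A_z$ that are not in $K_{z+1}\cup\dots\cup K_m$, puts $\mathcal R_z^h=\{J\in\mathcal R_z:m(J)=z\}$, $$c_{z,t}=\sum_{x\in f(z)}\left\lceil \frac{S(\{J\in\mathcal R_z(t):m(J)\in A_x\})}{g_x}\right\rceil r_x,\qquad \mathcal T_z=\mathrm{span}(\mathcal R^h_z)\cup\{t:c_{z,t}\ge\tfrac13r_z\},$$ and lets $K_z$ consist of $\mathcal R^h_z$ and of all $J\in\mathcal R_z\setminus\mathcal R^h_z$ with $I(J)\subseteq\mathcal T_z$. The jobs of each $K_z$ are then scheduled on machines of type $z$ by a subroutine for identical machines with the performance of dual coloring: at every time $t$ at most $4\lceil S(K_z,t)/g_z\rceil$ machines of type $z$ are busy. In the theorem, ``a schedule of $ALG_{offline}$'' means any schedule of this kind. \textbf{Theorem.} (1) For every standard instance (with real data), schedules of $ALG_{offline}$ exist; at every time $t$ $$\sum_{z}\lceil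 S(K_z,t)/g_z\rceil\, r_z\le 45\cdot OPT_{one\text{-}shot}(\mathcal J(t));$$ both sides are integrable over $\mathrm{span}(\mathcal J)$; and the cost $ALG_{offline}(\mathcal J)$ of every schedule of $ALG_{offline}$ satisfies $$ALG_{offline}(\mathcal J)\le\int_{\mathrm{span}(\mathcal J)}\sum_z4\lceil S(K_z,t)/g_z\rceil r_z\,dt\le180\int_{\mathrm{span}(\mathcal J)}OPT_{one\text{-}shot}(\mathcal J(t))\,dt\le180\cdot OPT_{BSHM}(\mathcal J).$$ (2) Let the machine types be arbitrary (any $g_z>0$, any cost rates $c_z>0$, in any order). Round every cost rate up to the least power of $8$ that is at least $c_z$, delete types that are then dominated (another type kept has at least the capacity and at most the rate) so that a standard instance remains, and run $ALG_{offline}$ on it. Such a standard instance exists, and for every such standard instance every resulting schedule is feasible and costs, at the original rates, at most $8\cdot180=1440$ times the optimal cost of the original instance. (3) There is one algorithm that, on every instance with rational data and arbitrary machine types, outputs in time polynomial in the bit length of the instance a schedule as in (2); on standard instances its output is a schedule of $ALG_{offline}$, so it is a polynomial-time $180$-approximation there, and a polynomial-time $1440$-approximation for arbitrary machine types. Here time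 is the number of steps of a program in a first-order functional language with rational numbers, truth values, pairs and lists, whose only iteration is structural recursion over a list; evaluating a program node is one step, and an arithmetical operation or comparison costs in addition the square of the bit length of its operands. -/

import Mathlib

open MeasureTheory

namespace BSHM

/-! ## Instances, schedules and the optimal cost -/

/-- A busy-time scheduling instance with `n` jobs and `m` machine types, with data in `F`.
Type `z` has capacity `g z` and cost rate `r z`; job `j` has size `s j` and is active on the
half-open interval `[arr j, dep j)`. There are arbitrarily many machines of each type. -/
structure Inst (F : Type) (n m : ℕ) where
  g : Fin m → F
  r : Fin m → F
  s : Fin n → F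
  arr : Fin n → F
  dep : Fin n → F

namespace Inst

/-- A rational instance regarded as a real one. -/
noncomputable def toReal {n m : ℕ} (I : Inst ℚ n m) : Inst ℝ n m where
  g z := (I.g z : ℝ)
  r z := (I.r z : ℝ)
  s j := (I.s j : ℝ)
  arr j := (I.arr j : ℝ)
  dep j := (I.dep j : ℝ)

variable {n m : ℕ}

/-- Arbitrary machine types: positive data, nonempty active intervals, and every job fits on
some machine type. -/
structure Valid (I : Inst ℝ n m) : Prop where
  g_pos : ∀ z, 0 < I.g z
  r_pos : ∀ z, 0 < I.r z
  s_pos : ∀ j, 0 < I.s j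
  arr_lt_dep : ∀ j, I.arr j < I.dep j
  fits : ∀ j, ∃ z, I.s j ≤ I.g z

/-- Normalised machine types: capacities and cost rates are strictly increasing in the index,
and every cost rate is an integral power of `8`. -/
structure Standard (I : Inst ℝ n m) : Prop extends I.Valid where
  g_mono : StrictMono I.g
  r_mono : StrictMono I.r
  r_pow : ∀ z, ∃ k : ℤ, I.r z = (8 : ℝ) ^ k

/-- The active interval of a job. -/
def interval (I : Inst ℝ n m) (j : Fin n) : Set ℝ := Set.Ico (I.arr j) (I.dep j)

/-- The set of times at which some job of `X` is active. -/
def span (I : Inst ℝ n m) (X : Finset (Fin n)) : Set ℝ := ⋃ j ∈ X, I.interval j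

open Classical in
/-- The jobs of `X` that are active at time `t`. -/
noncomputable def activeIn (I : Inst ℝ n m) (X : Finset (Fin n)) (t : ℝ) : Finset (Fin n) :=
  X.filter fun j => t ∈ I.interval j

/-- The total size of a set of jobs. -/
noncomputable def size (I : Inst ℝ n m) (X : Finset (Fin n)) : ℝ := ∑ j ∈ X, I.s j

/-- The total size of the jobs of `X` that are active at time `t`. -/
noncomputable def load (I : Inst ℝ n m) (X : Finset (Fin n)) (t : ℝ) : ℝ :=
  I.size (I.activeIn X t)

/-- A schedule puts each job on one machine; machines are named by their type and a number. -/
abbrev Sched (n m : ℕ) : Type := Fin n → Fin m × ℕ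

/-- The jobs on machine `M`. -/
def jobsOn (σ : Sched n m) (M : Fin m × ℕ) : Finset (Fin n) :=
  Finset.univ.filter fun j => σ j = M

/-- At every time the jobs running on a machine fit into its capacity. -/
def Feasible (I : Inst ℝ n m) (σ : Sched n m) : Prop :=
  ∀ (M : Fin m × ℕ) (t : ℝ), I.load (jobsOn σ M) t ≤ I.g M.1

/-- The total cost of a schedule: every machine used pays its rate for its busy time. -/
noncomputable def cost (I : Inst ℝ n m) (σ : Sched n m) : ℝ :=
  ∑ M ∈ Finset.univ.image σ, I.r M.1 * volume.real (I.span (jobsOn σ M))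

/-- The optimal cost of the instance. -/
noncomputable def opt (I : Inst ℝ n m) : ℝ :=
  sInf {c : ℝ | ∃ σ : Sched n m, I.Feasible σ ∧ c = I.cost σ}

/-- The number of machines of type `z` that are busy at time `t`. -/
noncomputable def busy (I : Inst ℝ n m) (σ : Sched n m) (z : Fin m) (t : ℝ) : ℕ :=
  (((I.activeIn Finset.univ t).image σ).filter fun M => M.1 = z).card

/-! ## One-shot scheduling -/

open Classical in
/-- The exact machine type of a job: the lowest-indexed type that can hold it
(`⊤` if there is none). -/
noncomputable def exactType (I : Inst ℝ n m) (j : Fin n) : WithTop (Fin m) :=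
  (Finset.univ.filter fun z => I.s j ≤ I.g z).min

open Classical in
/-- The machine configuration `w` is feasible for the jobs `X`: for every type `i`, the machines
of type at least `i` have room for the jobs of exact type at least `i`. -/
def OneShotFeasible (I : Inst ℝ n m) (X : Finset (Fin n)) (w : Fin m → ℕ) : Prop :=
  ∀ i : Fin m, I.size (X.filter fun j => (i : WithTop (Fin m)) ≤ I.exactType j) ≤
    ∑ z ∈ Finset.Ici i, (w z : ℝ) * I.g z

/-- The optimal cost rate of one-shot scheduling. -/
noncomputable def optOneShot (I : Inst ℝ n m) (X : Finset (Fin n)) : ℝ :=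
  sInf {c : ℝ | ∃ w : Fin m → ℕ, I.OneShotFeasible X w ∧ c = ∑ z, (w z : ℝ) * I.r z}

/-! ## The cost-per-capacity graph -/

open Classical in
/-- The parent of `i`: the lowest-indexed type above `i` with a smaller cost rate per unit of
capacity (`⊤` if there is none). -/
noncomputable def parent (I : Inst ℝ n m) (i : Fin m) : WithTop (Fin m) :=
  (Finset.univ.filter fun k => i < k ∧ I.r k / I.g k < I.r i / I.g i).min

open Classical in
/-- The children of `z`. -/
noncomputable def children (I : Inst ℝ n m) (z : Fin m) : Finset (Fin m) :=
  Finset.univ.filter fun x => I.parent x = z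

/-- `x` lies in the tree rooted at `z`: it is `z` or a descendant of `z`. -/
def InTree (I : Inst ℝ n m) (x z : Fin m) : Prop :=
  Relation.ReflTransGen (fun a b : Fin m => I.parent a = b) x z

open Classical in
/-- The jobs of `X` whose exact machine type lies in the tree rooted at `z`. -/
noncomputable def restrict (I : Inst ℝ n m) (X : Finset (Fin n)) (z : Fin m) : Finset (Fin n) :=
  X.filter fun j => ∃ x : Fin m, I.exactType j = x ∧ I.InTree x z

open Classical in
/-- The jobs of `X` whose exact machine type is `z`. -/
noncomputable def exactJobs (I : Inst ℝ n m) (X : Finset (Fin n)) (z : Fin m) : Finset (Fin n) :=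
  X.filter fun j => I.exactType j = z

/-! ## The offline algorithm -/

/-- The cost rate at time `t` of the machines of the children types `x` of `z` that are needed
for the jobs of `X` with exact types in the trees rooted at the `x`. -/
noncomputable def childCost (I : Inst ℝ n m) (X : Finset (Fin n)) (z : Fin m) (t : ℝ) : ℝ :=
  ∑ x ∈ I.children z, (⌈I.load (I.restrict X x) t / I.g x⌉ : ℝ) * I.r x

/-- The times at which it is cost-effective to open a machine of type `z` for the jobs `X`. -/
def effective (I : Inst ℝ n m) (X : Finset (Fin n)) (z : Fin m) : Set ℝ :=
  I.span (I.exactJobs X z) ∪ {t | 1 / 3 * I.r z ≤ I.childCost X z t}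

open Classical in
/-- One iteration of the algorithm: the jobs given to type `z` when the candidates are `X`. -/
noncomputable def pick (I : Inst ℝ n m) (X : Finset (Fin n)) (z : Fin m) : Finset (Fin n) :=
  I.exactJobs X z ∪ (X \ I.exactJobs X z).filter fun j => I.interval j ⊆ I.effective X z

/-- The jobs not yet assigned after the `i` highest-indexed types have been processed. -/
noncomputable def remaining (I : Inst ℝ n m) : ℕ → Finset (Fin n)
  | 0 => Finset.univ
  | i + 1 =>
    if h : i < m then
      remaining I i \ I.pick (I.restrict (remaining I i) (Fin.rev ⟨i, h⟩)) (Fin.rev ⟨i, h⟩)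
    else remaining I i

/-- The set of jobs that the offline algorithm assigns to type `z`; types are processed in
descending order, and `Fin.rev z` types precede `z`. -/
noncomputable def K (I : Inst ℝ n m) (z : Fin m) : Finset (Fin n) :=
  I.pick (I.restrict (I.remaining (Fin.rev z)) z) z

/-- The total cost rate of `⌈S(K_z, t) / g_z⌉` machines of every type `z`. -/
noncomputable def neededRate (I : Inst ℝ n m) (t : ℝ) : ℝ :=
  ∑ z, (⌈I.load (I.K z) t / I.g z⌉ : ℝ) * I.r z

/-- A schedule of the offline algorithm: the jobs assigned to type `z` run on machines of
type `z`. -/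
def IsOffline (I : Inst ℝ n m) (σ : Sched n m) : Prop :=
  I.Feasible σ ∧ ∀ z j, (σ j).1 = z ↔ j ∈ I.K z

/-- The performance of dual coloring on each single type: at every time at most
`4 ⌈S(K_z, t) / g_z⌉` machines of type `z` are busy. -/
def DualColoringBound (I : Inst ℝ n m) (σ : Sched n m) : Prop :=
  ∀ z t, (I.busy σ z t : ℤ) ≤ 4 * ⌈I.load (I.K z) t / I.g z⌉

/-! ## Arbitrary machine types -/

/-- The smallest integral power of `8` that is at least `c`, for `c > 0`. -/
noncomputable def round8 (c : ℝ) : ℝ := (8 : ℝ) ^ Int.clog 8 c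

/-- `I` arises from `A` by rounding the cost rates up to powers of `8`, deleting types that are
then dominated, and sorting; `e` tells which type of `A` each remaining type is. -/
structure IsNormalization {k : ℕ} (A : Inst ℝ n k) (I : Inst ℝ n m) (e : Fin m → Fin k) :
    Prop where
  standard : I.Standard
  s_eq : I.s = A.s
  arr_eq : I.arr = A.arr
  dep_eq : I.dep = A.dep
  g_eq : ∀ z, I.g z = A.g (e z)
  r_eq : ∀ z, I.r z = round8 (A.r (e z))
  dominated : ∀ y, ∃ z, A.g y ≤ I.g z ∧ I.r z ≤ round8 (A.r y)

/-- A schedule for the remaining types as a schedule for the original ones. -/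
def liftSched {k : ℕ} (e : Fin m → Fin k) (σ : Sched n m) : Sched n k :=
  fun j => (e (σ j).1, (σ j).2)

end Inst

/-! ## Programs with a step count

A first-order functional language on rational numbers, truth values, pairs and lists. Its only
iteration is structural recursion over a list. Evaluating a node of the program costs one step
besides the cost of what is evaluated inside it; an arithmetical operation costs in addition the
square of the bit length of its operands. So the step count is, up to a polynomial, the running
time on a Turing machine. -/

inductive Ty : Type
  | num
  | bool
  | prod (a b : Ty)
  | list (a : Ty)

/-- The values of a type. -/
@[reducible] def Ty.Val : Ty → Type
  | .num => ℚ
  | .bool => Bool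
  | .prod a b => a.Val × b.Val
  | .list a => List a.Val

/-- Variables, as positions in a context. -/
inductive Var : List Ty → Ty → Type
  | zero {Γ : List Ty} {a : Ty} : Var (a :: Γ) a
  | succ {Γ : List Ty} {a b : Ty} : Var Γ a → Var (b :: Γ) a

/-- Values for the variables of a context. -/
@[reducible] def Env : List Ty → Type
  | [] => Unit
  | a :: Γ => a.Val × Env Γ

def Var.get : {Γ : List Ty} → {a : Ty} → Var Γ a → Env Γ → a.Val
  | _, _, .zero, ρ => ρ.1
  | _, _, .succ x, ρ => x.get ρ.2

/-- Binary arithmetical operations. -/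
inductive Op : Type
  | add
  | sub
  | mul
  | div

def Op.apply : Op → ℚ → ℚ → ℚ
  | .add, x, y => x + y
  | .sub, x, y => x - y
  | .mul, x, y => x * y
  | .div, x, y => x / y

/-- Program terms with free variables in a context. -/
inductive Tm : List Ty → Ty → Type
  | var {Γ : List Ty} {a : Ty} : Var Γ a → Tm Γ a
  | letIn {Γ : List Ty} {a b : Ty} : Tm Γ a → Tm (a :: Γ) b → Tm Γ b
  | lit {Γ : List Ty} : ℚ → Tm Γ .num
  | op {Γ : List Ty} : Op → Tm Γ .num → Tm Γ .num → Tm Γ .num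
  | floor {Γ : List Ty} : Tm Γ .num → Tm Γ .num
  | bits {Γ : List Ty} : Tm Γ .num → Tm Γ (.list .bool)
  | le {Γ : List Ty} : Tm Γ .num → Tm Γ .num → Tm Γ .bool
  | ite {Γ : List Ty} {a : Ty} : Tm Γ .bool → Tm Γ a → Tm Γ a → Tm Γ a
  | pair {Γ : List Ty} {a b : Ty} : Tm Γ a → Tm Γ b → Tm Γ (.prod a b)
  | fst {Γ : List Ty} {a b : Ty} : Tm Γ (.prod a b) → Tm Γ a
  | snd {Γ : List Ty} {a b : Ty} : Tm Γ (.prod a b) → Tm Γ b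
  | nil {Γ : List Ty} {a : Ty} : Tm Γ (.list a)
  | cons {Γ : List Ty} {a : Ty} : Tm Γ a → Tm Γ (.list a) → Tm Γ (.list a)
  | cases {Γ : List Ty} {a b : Ty} :
      Tm Γ (.list a) → Tm Γ b → Tm (a :: .list a :: Γ) b → Tm Γ b
  | fold {Γ : List Ty} {a b : Ty} :
      Tm Γ (.list a) → Tm Γ b → Tm (a :: b :: Γ) b → Tm Γ b

/-- The bit length of a rational number. -/
def numSize (q : ℚ) : ℕ := q.num.natAbs.size + q.den.size

/-- The value of a term together with the number of steps of its evaluation. `bits` gives the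
binary digits of the integral part of the absolute value. -/
def Tm.eval : {Γ : List Ty} → {a : Ty} → Tm Γ a → Env Γ → a.Val × ℕ
  | _, _, .var x, ρ => (x.get ρ, 1)
  | _, _, .letIn u v, ρ =>
    let x := u.eval ρ
    let y := v.eval (x.1, ρ)
    (y.1, x.2 + y.2 + 1)
  | _, _, .lit q, _ => (q, numSize q + 1)
  | _, _, .op o u v, ρ =>
    let x := u.eval ρ
    let y := v.eval ρ
    (o.apply x.1 y.1, x.2 + y.2 + (numSize x.1 + numSize y.1) ^ 2 + 1)
  | _, _, .floor u, ρ =>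
    let x := u.eval ρ
    ((⌊(x.1 : ℚ)⌋ : ℚ), x.2 + numSize x.1 ^ 2 + 1)
  | _, _, .bits u, ρ =>
    let x := u.eval ρ
    (Nat.bits ⌊|(x.1 : ℚ)|⌋₊, x.2 + numSize x.1 ^ 2 + 1)
  | _, _, .le u v, ρ =>
    let x := u.eval ρ
    let y := v.eval ρ
    (decide ((x.1 : ℚ) ≤ y.1), x.2 + y.2 + (numSize x.1 + numSize y.1) ^ 2 + 1)
  | _, _, .ite c u v, ρ =>
    let b := c.eval ρ
    let y := bif b.1 then u.eval ρ else v.eval ρ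
    (y.1, b.2 + y.2 + 1)
  | _, _, .pair u v, ρ =>
    let x := u.eval ρ
    let y := v.eval ρ
    ((x.1, y.1), x.2 + y.2 + 1)
  | _, _, .fst u, ρ =>
    let x := u.eval ρ
    (x.1.1, x.2 + 1)
  | _, _, .snd u, ρ =>
    let x := u.eval ρ
    (x.1.2, x.2 + 1)
  | _, _, .nil, _ => ([], 1)
  | _, _, .cons u v, ρ =>
    let x := u.eval ρ
    let y := v.eval ρ
    (x.1 :: y.1, x.2 + y.2 + 1)
  | _, _, .cases l u v, ρ =>
    let x := l.eval ρ
    let y := match x.1 with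
      | [] => u.eval ρ
      | h :: t => v.eval (h, t, ρ)
    (y.1, x.2 + y.2 + 1)
  | _, _, .fold l u v, ρ =>
    let x := l.eval ρ
    let y := u.eval ρ
    x.1.foldr (fun h p =>
      let w := v.eval (h, p.1, ρ)
      (w.1, p.2 + w.2 + 1)) (y.1, x.2 + y.2 + 1)

/-- Inputs: the list of pairs (capacity, rate) of the types, and the list of triples
(size, arrival, departure) of the jobs. -/
abbrev inputTy : Ty := .prod (.list (.prod .num .num)) (.list (.prod .num (.prod .num .num)))

/-- Outputs: the list, over the jobs, of pairs (index of the type, number of the machine). -/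
abbrev outputTy : Ty := .list (.prod .num .num)

/-- A scheduling program. -/
abbrev Prog : Type := Tm [inputTy] outputTy

def Inst.encode {n m : ℕ} (I : Inst ℚ n m) : inputTy.Val :=
  (List.ofFn fun z => (I.g z, I.r z), List.ofFn fun j => (I.s j, I.arr j, I.dep j))

/-- The bit length of an instance. -/
def Inst.bitSize {n m : ℕ} (I : Inst ℚ n m) : ℕ :=
  ∑ z, (numSize (I.g z) + numSize (I.r z)) +
    ∑ j, (numSize (I.s j) + numSize (I.arr j) + numSize (I.dep j))

def encodeSched {n m : ℕ} (σ : Inst.Sched n m) : outputTy.Val :=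
  List.ofFn fun j => (((σ j).1 : ℕ), ((σ j).2 : ℕ))

def Prog.output {n m : ℕ} (P : Prog) (I : Inst ℚ n m) : outputTy.Val :=
  (Tm.eval P (I.encode, ())).1

def Prog.steps {n m : ℕ} (P : Prog) (I : Inst ℚ n m) : ℕ :=
  (Tm.eval P (I.encode, ())).2

end BSHM

/-! The estimate is made at one time `t` against one configuration `w` feasible for the active jobs,
of cost rate `W`; integration comes afterwards.

Upper side. Inside one tree of the cost-per-capacity forest, all machines needed together cost at
most three times what the root would need for its candidates (`sum_tree_le`). A job left over by
type `z` has a time in its interval at which `z` is not effective. Among the leftover jobs active at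
`t`, those whose bad time is at most `t` all run at the latest of these times, the others all run at
the earliest of theirs. Hence the children together need at most twice `r z / 3`
(`sum_ceil_unpicked_le`), and 3 solves `c = 1 + 2c/3`.

Lower side. This is weak linear programming duality: a nonnegative nondecreasing price on types is a
nonnegative combination of the capacity constraints (`sum_weighted_size_le`). With the price "least
rate per capacity among the available types from here upwards", the volume in disjoint trees,
charged at the ratios of their roots, costs at most `W` (`sum_size_mul_ratio_le`). What remains is
one machine per root for rounding up. Since rates grow by factors of 8, these machines cost at most
`8/7` of the rate of the highest relevant type `u`, and `r u ≤ 21/4 * W` (`r_le_of_active`).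
Together this gives `3 * (1 + 8/7 * 21/4) = 21`, well within 45 (`neededRate_le_of_feasible`).

Integration. The active set takes finitely many values, the cost of a schedule is the integral of
its busy rate, and the busy machines of a feasible schedule form a feasible configuration. The
factor 4 of the subroutine turns 45 into 180, and rounding rates to powers of 8 costs another factor
8. A subroutine with factor 4 is built from greedy layers of small jobs, each layer fitting on one
machine (`load_layer_lt`).

Polynomial time. The functions computed by polynomial-time programs (`PT`) are closed under
composition and under list recursion with controlled sizes. The algorithm is written as a function
on lists, `Alg.run`, which lies in this class. It agrees with the real-valued definition because
every condition on a whole interval can be tested at arrival and departure times alone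
(`forall_interval_iff`). -/

namespace BSHM
namespace Inst
-- The forest of types and the cost of the algorithm inside one tree
variable {n m : ℕ}

/-! ## Sums over unions -/

lemma sum_union_le {α : Type*} [DecidableEq α] {f : α → ℝ} (hf : ∀ a, 0 ≤ f a)
    (s t : Finset α) : ∑ a ∈ s ∪ t, f a ≤ ∑ a ∈ s, f a + ∑ a ∈ t, f a := by
  rw [← Finset.sum_union_inter]
  exact le_add_of_nonneg_right (Finset.sum_nonneg fun a _ => hf a)

lemma sum_biUnion_le {α β : Type*} [DecidableEq α] {f : α → ℝ} (hf : ∀ a, 0 ≤ f a)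
    (s : Finset β) (t : β → Finset α) : ∑ a ∈ s.biUnion t, f a ≤ ∑ b ∈ s, ∑ a ∈ t b, f a := by
  classical
  induction s using Finset.induction_on with
  | empty => simp
  | insert b s hb ih =>
    rw [Finset.biUnion_insert, Finset.sum_insert hb]
    exact (sum_union_le hf _ _).trans (by gcongr)

/-! ## The cost-per-capacity forest -/

/-- The cost rate per unit of capacity. -/
noncomputable def ratio (I : Inst ℝ n m) (z : Fin m) : ℝ := I.r z / I.g z

lemma min_eq_coe_iff {s : Finset (Fin m)} {z : Fin m} :
    s.min = (z : WithTop (Fin m)) ↔ z ∈ s ∧ ∀ y ∈ s, z ≤ y := by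
  constructor
  · intro h
    exact ⟨Finset.mem_of_min h, fun y hy => Finset.min_le_of_eq hy h⟩
  · rintro ⟨h, h'⟩
    exact le_antisymm (Finset.min_le h)
      (Finset.le_min fun y hy => WithTop.coe_le_coe.2 (h' y hy))

lemma exactType_eq_iff (I : Inst ℝ n m) {j : Fin n} {z : Fin m} :
    I.exactType j = (z : WithTop (Fin m)) ↔
      I.s j ≤ I.g z ∧ ∀ y, I.s j ≤ I.g y → z ≤ y := by
  unfold exactType
  rw [min_eq_coe_iff]
  simp

lemma exists_exactType {I : Inst ℝ n m} (hI : I.Valid) (j : Fin n) :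
    ∃ z : Fin m, I.exactType j = (z : WithTop (Fin m)) := by
  obtain ⟨z, hz⟩ := hI.fits j
  have : (Finset.univ.filter fun z => I.s j ≤ I.g z).Nonempty := ⟨z, by simpa using hz⟩
  obtain ⟨y, hy⟩ := Finset.min_of_nonempty this
  refine ⟨y, ?_⟩
  unfold exactType
  convert hy

lemma parent_eq_iff (I : Inst ℝ n m) {x z : Fin m} :
    I.parent x = (z : WithTop (Fin m)) ↔
      (x < z ∧ I.ratio z < I.ratio x) ∧ ∀ y, x < y → I.ratio y < I.ratio x → z ≤ y := by
  unfold parent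
  rw [min_eq_coe_iff]
  simp [ratio]

lemma exists_parent (I : Inst ℝ n m) {x y : Fin m} (h : x < y) (h' : I.ratio y < I.ratio x) :
    ∃ z : Fin m, I.parent x = (z : WithTop (Fin m)) := by
  classical
  have : (Finset.univ.filter fun k => x < k ∧ I.r k / I.g k < I.r x / I.g x).Nonempty :=
    ⟨y, by simpa using ⟨h, h'⟩⟩
  obtain ⟨z, hz⟩ := Finset.min_of_nonempty this
  refine ⟨z, ?_⟩
  unfold parent
  convert hz

/-- The chain of parents of `x` runs through the successive strict minima of the ratio from `x`
upwards, so `z` lies on it exactly when it beats every type in between. The estimates and the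
program both use this pointwise form instead of chains. -/
lemma inTree_iff (I : Inst ℝ n m) {x z : Fin m} :
    I.InTree x z ↔ x ≤ z ∧ ∀ y, x ≤ y → y < z → I.ratio z < I.ratio y := by
  constructor
  · intro h
    induction h with
    | refl => exact ⟨le_rfl, fun y h h' => absurd h' (not_lt.2 h)⟩
    | tail _ hbc ih =>
      rename_i b c _
      obtain ⟨⟨hbc, hr⟩, hmin⟩ := I.parent_eq_iff.1 hbc
      refine ⟨ih.1.trans hbc.le, fun y hxy hyc => ?_⟩
      rcases lt_trichotomy y b with hyb | rfl | hyb
      · exact hr.trans (ih.2 y hxy hyb)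
      · exact hr
      · by_contra hcon
        exact absurd (hmin y hyb (lt_of_le_of_lt (not_lt.1 hcon) hr)) (not_le.2 hyc)
  · intro h
    induction hd : (z : ℕ) - x using Nat.strong_induction_on generalizing x with
    | _ d ih =>
      rcases h.1.eq_or_lt with rfl | hlt
      · exact Relation.ReflTransGen.refl
      · have hr := h.2 x le_rfl hlt
        obtain ⟨p, hp⟩ := I.exists_parent hlt hr
        have hp' := I.parent_eq_iff.1 hp
        have hpz : p ≤ z := hp'.2 z hlt hr
        refine Relation.ReflTransGen.head hp (ih ((z : ℕ) - p) ?_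
          ⟨hpz, fun y hy hyz => h.2 y (hp'.1.1.le.trans hy) hyz⟩ rfl)
        have h1 : (x : ℕ) < p := hp'.1.1
        have h2 : (p : ℕ) ≤ z := hpz
        omega

lemma mem_children (I : Inst ℝ n m) {x z : Fin m} :
    x ∈ I.children z ↔ I.parent x = (z : WithTop (Fin m)) := by
  simp [children]

lemma lt_of_mem_children (I : Inst ℝ n m) {x z : Fin m} (h : x ∈ I.children z) : x < z :=
  (I.parent_eq_iff.1 (I.mem_children.1 h)).1.1

lemma InTree.trans_child {I : Inst ℝ n m} {i x z : Fin m} (h : I.InTree i x)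
    (hx : x ∈ I.children z) : I.InTree i z :=
  Relation.ReflTransGen.tail h (I.mem_children.1 hx)

lemma InTree.eq_or_child {I : Inst ℝ n m} {i z : Fin m} (h : I.InTree i z) :
    i = z ∨ ∃ x ∈ I.children z, I.InTree i x := by
  rcases Relation.ReflTransGen.cases_tail h with h | ⟨x, hx, hxz⟩
  · exact Or.inl h.symm
  · exact Or.inr ⟨x, I.mem_children.2 hxz, hx⟩

/-! ## Sizes and loads -/

lemma mem_activeIn (I : Inst ℝ n m) {X : Finset (Fin n)} {t : ℝ} {j : Fin n} :
    j ∈ I.activeIn X t ↔ j ∈ X ∧ t ∈ I.interval j := by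
  simp [activeIn]

lemma size_nonneg {I : Inst ℝ n m} (hI : I.Valid) (X : Finset (Fin n)) : 0 ≤ I.size X :=
  Finset.sum_nonneg fun j _ => (hI.s_pos j).le

lemma size_mono {I : Inst ℝ n m} (hI : I.Valid) {X Y : Finset (Fin n)} (h : X ⊆ Y) :
    I.size X ≤ I.size Y :=
  Finset.sum_le_sum_of_subset_of_nonneg h fun j _ _ => (hI.s_pos j).le

lemma size_pos {I : Inst ℝ n m} (hI : I.Valid) {X : Finset (Fin n)} {j : Fin n} (h : j ∈ X) :
    0 < I.size X :=
  Finset.sum_pos (fun j _ => hI.s_pos j) ⟨j, h⟩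

lemma le_size {I : Inst ℝ n m} (hI : I.Valid) {X : Finset (Fin n)} {j : Fin n} (h : j ∈ X) :
    I.s j ≤ I.size X :=
  Finset.single_le_sum (f := I.s) (fun j _ => (hI.s_pos j).le) h

lemma size_union_le {I : Inst ℝ n m} (hI : I.Valid) (X Y : Finset (Fin n)) :
    I.size (X ∪ Y) ≤ I.size X + I.size Y := by
  exact sum_union_le (fun j => (hI.s_pos j).le) X Y

lemma activeIn_mono (I : Inst ℝ n m) {X Y : Finset (Fin n)} (h : X ⊆ Y) (t : ℝ) :
    I.activeIn X t ⊆ I.activeIn Y t := by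
  intro j hj
  rw [mem_activeIn] at hj ⊢
  exact ⟨h hj.1, hj.2⟩

lemma load_nonneg {I : Inst ℝ n m} (hI : I.Valid) (X : Finset (Fin n)) (t : ℝ) : 0 ≤ I.load X t :=
  size_nonneg hI _

lemma load_mono {I : Inst ℝ n m} (hI : I.Valid) {X Y : Finset (Fin n)} (h : X ⊆ Y) (t : ℝ) :
    I.load X t ≤ I.load Y t :=
  size_mono hI (I.activeIn_mono h t)

lemma mem_restrict (I : Inst ℝ n m) {X : Finset (Fin n)} {z : Fin m} {j : Fin n} :
    j ∈ I.restrict X z ↔ j ∈ X ∧ ∃ x : Fin m, I.exactType j = x ∧ I.InTree x z := by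
  simp [restrict]

lemma mem_exactJobs (I : Inst ℝ n m) {X : Finset (Fin n)} {z : Fin m} {j : Fin n} :
    j ∈ I.exactJobs X z ↔ j ∈ X ∧ I.exactType j = z := by
  simp [exactJobs]

lemma mem_pick (I : Inst ℝ n m) {X : Finset (Fin n)} {z : Fin m} {j : Fin n} :
    j ∈ I.pick X z ↔ j ∈ X ∧ (I.exactType j = z ∨ I.interval j ⊆ I.effective X z) := by
  simp only [pick, Finset.mem_union, Finset.mem_filter, Finset.mem_sdiff, mem_exactJobs]
  tauto

lemma mem_span (I : Inst ℝ n m) {X : Finset (Fin n)} {t : ℝ} :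
    t ∈ I.span X ↔ ∃ j ∈ X, t ∈ I.interval j := by
  simp [span]

/-! ## The jobs of each type -/

/-- The candidates for type `z`. -/
noncomputable def cand (I : Inst ℝ n m) (z : Fin m) : Finset (Fin n) :=
  I.restrict (I.remaining (Fin.rev z)) z

lemma K_eq (I : Inst ℝ n m) (z : Fin m) : I.K z = I.pick (I.cand z) z := rfl

lemma K_subset_cand (I : Inst ℝ n m) (z : Fin m) : I.K z ⊆ I.cand z := by
  intro j hj
  rw [K_eq, mem_pick] at hj
  exact hj.1

/-- Types are processed from the top, so after `i` rounds exactly the types `z` with `Fin.rev z < i`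
have made their choice. -/
lemma mem_remaining (I : Inst ℝ n m) {i : ℕ} {j : Fin n} :
    j ∈ I.remaining i ↔ ∀ z : Fin m, (Fin.rev z : ℕ) < i → j ∉ I.K z := by
  induction i with
  | zero => simp [remaining]
  | succ i ih =>
    rw [remaining]
    split_ifs with h
    · have hK : I.pick (I.restrict (I.remaining i) (Fin.rev ⟨i, h⟩)) (Fin.rev ⟨i, h⟩) =
          I.K (Fin.rev ⟨i, h⟩) := by
        simp [K, Fin.rev_rev]
      rw [hK, Finset.mem_sdiff, ih]
      constructor
      · rintro ⟨h1, h2⟩ z hz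
        rcases Nat.lt_succ_iff_lt_or_eq.1 hz with hz | hz
        · exact h1 z hz
        · have : z = Fin.rev ⟨i, h⟩ := by
            rw [← Fin.rev_rev z]
            congr 1
            exact Fin.ext hz
          rwa [this]
      · intro h1
        exact ⟨fun z hz => h1 z (by omega), h1 _ (by simp [Fin.rev_rev])⟩
    · rw [ih]
      constructor
      · intro h1 z hz
        refine h1 z ?_
        have := (Fin.rev z).2
        omega
      · intro h1 z hz
        exact h1 z (by omega)

lemma mem_cand (I : Inst ℝ n m) {z : Fin m} {j : Fin n} :
    j ∈ I.cand z ↔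
      (∀ y, z < y → j ∉ I.K y) ∧ ∃ x : Fin m, I.exactType j = x ∧ I.InTree x z := by
  unfold cand
  rw [mem_restrict, mem_remaining]
  simp only [Fin.val_fin_lt, Fin.rev_lt_rev]

lemma K_disjoint (I : Inst ℝ n m) {y z : Fin m} {j : Fin n} (hy : j ∈ I.K y) (hz : j ∈ I.K z) :
    y = z := by
  rcases lt_trichotomy y z with h | h | h
  · exact absurd hz ((I.mem_cand.1 (I.K_subset_cand _ hy)).1 z h)
  · exact h
  · exact absurd hy ((I.mem_cand.1 (I.K_subset_cand _ hz)).1 y h)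

lemma exists_mem_K {I : Inst ℝ n m} (hI : I.Valid) (j : Fin n) : ∃ z, j ∈ I.K z := by
  obtain ⟨z, hz⟩ := exists_exactType hI j
  by_cases h : ∃ y, z < y ∧ j ∈ I.K y
  · obtain ⟨y, -, hy⟩ := h
    exact ⟨y, hy⟩
  · push Not at h
    refine ⟨z, ?_⟩
    rw [K_eq, mem_pick]
    exact ⟨I.mem_cand.2 ⟨h, z, hz, Relation.ReflTransGen.refl⟩, Or.inl hz⟩

lemma inTree_of_mem_K (I : Inst ℝ n m) {y : Fin m} {j : Fin n} (hy : j ∈ I.K y) :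
    ∃ x : Fin m, I.exactType j = x ∧ I.InTree x y :=
  (I.mem_cand.1 (I.K_subset_cand _ hy)).2

lemma fits_of_mem_K {I : Inst ℝ n m} (hI : I.Standard) {y : Fin m} {j : Fin n}
    (hy : j ∈ I.K y) : I.s j ≤ I.g y := by
  obtain ⟨x, hx, hxy⟩ := I.inTree_of_mem_K hy
  exact (I.exactType_eq_iff.1 hx).1.trans (hI.g_mono.monotone (I.inTree_iff.1 hxy).1)

/-- The sets `K` are disjoint, so a job that ends up at `y` was taken by no type above `z` and was
still available when `z` was processed. -/
lemma K_subset_cand_of_inTree (I : Inst ℝ n m) {y z : Fin m} (h : I.InTree y z) :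
    I.K y ⊆ I.cand z := by
  intro j hj
  obtain ⟨x, hx, hxy⟩ := I.inTree_of_mem_K hj
  refine I.mem_cand.2 ⟨fun y' hy' hj' => ?_, x, hx, Relation.ReflTransGen.trans hxy h⟩
  have := I.K_disjoint hj hj'
  subst this
  exact absurd (I.inTree_iff.1 h).1 (not_le.2 hy')

/-! ## Jobs left over by a type -/

lemma sum_ceil_le_of_not_effective {I : Inst ℝ n m} (hI : I.Valid) {X Y : Finset (Fin n)}
    {z : Fin m} {t : ℝ} (hYX : Y ⊆ X) (ht : ∀ j ∈ Y, t ∈ I.interval j)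
    (hbad : t ∉ I.effective X z) :
    ∑ x ∈ I.children z, (⌈I.size (I.restrict Y x) / I.g x⌉ : ℝ) * I.r x ≤ 1 / 3 * I.r z := by
  have h1 : I.childCost X z t < 1 / 3 * I.r z := by
    by_contra h
    exact hbad (Or.inr (not_lt.1 h))
  refine le_trans (Finset.sum_le_sum fun x _ => ?_) h1.le
  have : I.size (I.restrict Y x) ≤ I.load (I.restrict X x) t := by
    refine size_mono hI fun j hj => ?_
    rw [mem_restrict] at hj
    rw [mem_activeIn, mem_restrict]
    exact ⟨⟨hYX hj.1, hj.2⟩, ht j hj.1⟩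
  have h2 := Int.ceil_mono (div_le_div_of_nonneg_right this (hI.g_pos x).le)
  exact mul_le_mul_of_nonneg_right (by exact_mod_cast h2) (hI.r_pos x).le

lemma sum_ceil_le_of_bad_times {I : Inst ℝ n m} (hI : I.Valid) {X Y : Finset (Fin n)}
    {z : Fin m} (hYX : Y ⊆ X) (f : Fin n → ℝ) (hf : ∀ j ∈ Y, f j ∉ I.effective X z)
    (h : Y.Nonempty → ∃ j ∈ Y, ∀ i ∈ Y, f j ∈ I.interval i) :
    ∑ x ∈ I.children z, (⌈I.size (I.restrict Y x) / I.g x⌉ : ℝ) * I.r x ≤ 1 / 3 * I.r z := by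
  rcases Y.eq_empty_or_nonempty with rfl | hne
  · have := hI.r_pos z
    simp [restrict, size]
    positivity
  · obtain ⟨j, hj, hj'⟩ := h hne
    exact sum_ceil_le_of_not_effective hI hYX hj' (hf j hj)

/-- Every leftover job has a bad time, one in its interval at which `z` is not effective. The active
leftover jobs split according to whether the bad time lies before or after `t`. Each half runs
entirely at a single bad time, where the child cost is below a third of `r z`; hence two thirds. -/
lemma sum_ceil_unpicked_le {I : Inst ℝ n m} (hI : I.Valid) (X : Finset (Fin n)) (z : Fin m)
    (t : ℝ) :
    ∑ x ∈ I.children z, (⌈I.load (I.restrict (X \ I.pick X z) x) t / I.g x⌉ : ℝ) * I.r x ≤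
      2 / 3 * I.r z := by
  classical
  set U := X \ I.pick X z with hU
  have hbad : ∀ j ∈ U, ∃ t' ∈ I.interval j, t' ∉ I.effective X z := by
    intro j hj
    rw [hU, Finset.mem_sdiff, mem_pick] at hj
    have : ¬ I.interval j ⊆ I.effective X z := fun h => hj.2 ⟨hj.1, Or.inr h⟩
    simpa [Set.subset_def] using this
  choose! f hf hf' using hbad
  set L := (I.activeIn U t).filter fun j => f j ≤ t with hL
  set R := (I.activeIn U t).filter fun j => t ≤ f j with hR
  have hLU : ∀ j ∈ L, j ∈ U ∧ t ∈ I.interval j ∧ f j ≤ t := by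
    intro j hj
    simpa [hL, mem_activeIn, and_assoc] using hj
  have hRU : ∀ j ∈ R, j ∈ U ∧ t ∈ I.interval j ∧ t ≤ f j := by
    intro j hj
    simpa [hR, mem_activeIn, and_assoc] using hj
  have hUX : U ⊆ X := Finset.sdiff_subset
  -- The latest bad time of `L` is no earlier than each job's own bad time, hence after its arrival,
  -- and no later than `t`, hence before its departure. So all of `L` runs then. For `R` the
  -- earliest bad time works in the same way.
  have h1 := sum_ceil_le_of_bad_times (Y := L) hI (fun j hj => hUX (hLU j hj).1) f
    (fun j hj => hf' j (hLU j hj).1) (fun hne => by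
      obtain ⟨j, hj, hmax⟩ := Finset.exists_max_image L f hne
      refine ⟨j, hj, fun i hi => ⟨?_, ?_⟩⟩
      · exact (hf i (hLU i hi).1).1.trans (hmax i hi)
      · exact (hLU j hj).2.2.trans_lt (hLU i hi).2.1.2)
  have h2 := sum_ceil_le_of_bad_times (Y := R) hI (fun j hj => hUX (hRU j hj).1) f
    (fun j hj => hf' j (hRU j hj).1) (fun hne => by
      obtain ⟨j, hj, hmin⟩ := Finset.exists_min_image R f hne
      refine ⟨j, hj, fun i hi => ⟨?_, ?_⟩⟩
      · exact (hRU i hi).2.1.1.trans (hRU j hj).2.2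
      · exact (hmin i hi).trans_lt (hf i (hRU i hi).1).2)
  have h3 : ∀ x ∈ I.children z, (⌈I.load (I.restrict U x) t / I.g x⌉ : ℝ) * I.r x ≤
      (⌈I.size (I.restrict L x) / I.g x⌉ : ℝ) * I.r x +
        (⌈I.size (I.restrict R x) / I.g x⌉ : ℝ) * I.r x := by
    intro x _
    have h4 : I.load (I.restrict U x) t ≤ I.size (I.restrict L x) + I.size (I.restrict R x) := by
      refine (size_mono hI ?_).trans (size_union_le hI _ _)
      intro j hj
      rw [mem_activeIn, mem_restrict] at hj
      rw [Finset.mem_union, mem_restrict, mem_restrict]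
      rcases le_total (f j) t with h | h
      · exact Or.inl ⟨by simp [hL, mem_activeIn, hj.1.1, hj.2, h], hj.1.2⟩
      · exact Or.inr ⟨by simp [hR, mem_activeIn, hj.1.1, hj.2, h], hj.1.2⟩
    have h5 : ⌈I.load (I.restrict U x) t / I.g x⌉ ≤
        ⌈I.size (I.restrict L x) / I.g x⌉ + ⌈I.size (I.restrict R x) / I.g x⌉ := by
      refine le_trans (Int.ceil_mono ?_) (Int.ceil_add_le _ _)
      rw [← add_div]
      exact div_le_div_of_nonneg_right h4 (hI.g_pos x).le
    rw [← add_mul]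
    exact mul_le_mul_of_nonneg_right (by exact_mod_cast h5) (hI.r_pos x).le
  refine (Finset.sum_le_sum h3).trans ?_
  rw [Finset.sum_add_distrib]
  linarith

/-! ## The cost inside one tree -/

/-- The cost rate at time `t` of the machines that type `z` needs for the jobs `X`. -/
noncomputable def rateFor (I : Inst ℝ n m) (X : Finset (Fin n)) (z : Fin m) (t : ℝ) : ℝ :=
  (⌈I.load X t / I.g z⌉ : ℝ) * I.r z

lemma rateFor_nonneg {I : Inst ℝ n m} (hI : I.Valid) (X : Finset (Fin n)) (z : Fin m) (t : ℝ) :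
    0 ≤ I.rateFor X z t := by
  have : 0 ≤ ⌈I.load X t / I.g z⌉ := Int.ceil_nonneg (div_nonneg (load_nonneg hI _ _) (hI.g_pos z).le)
  exact mul_nonneg (by exact_mod_cast this) (hI.r_pos z).le

lemma rateFor_mono {I : Inst ℝ n m} (hI : I.Valid) {X Y : Finset (Fin n)} (h : X ⊆ Y)
    (z : Fin m) (t : ℝ) : I.rateFor X z t ≤ I.rateFor Y z t := by
  have h2 := Int.ceil_mono (div_le_div_of_nonneg_right (load_mono hI h t) (hI.g_pos z).le)
  exact mul_le_mul_of_nonneg_right (by exact_mod_cast h2) (hI.r_pos z).le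

lemma rateFor_le {I : Inst ℝ n m} (hI : I.Valid) (X : Finset (Fin n)) (z : Fin m) (t : ℝ) :
    I.rateFor X z t ≤ I.load X t * I.ratio z + I.r z := by
  have h := (Int.ceil_lt_add_one (I.load X t / I.g z)).le
  calc I.rateFor X z t ≤ (I.load X t / I.g z + 1) * I.r z :=
        mul_le_mul_of_nonneg_right h (hI.r_pos z).le
    _ = _ := by rw [ratio]; ring

open Classical in
-- Induction on the root. Type `z` itself needs at most `rateFor (I.cand z) z t`. The candidates of
-- its children are among the jobs that `z` left over, so the subtrees cost at most `3 * (2/3) * r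
-- z`, which is twice the cost of a single machine of type `z`.
lemma sum_tree_le {I : Inst ℝ n m} (hI : I.Valid) (t : ℝ) (z : Fin m) :
    ∑ y ∈ Finset.univ.filter (fun y => I.InTree y z), I.rateFor (I.K y) y t ≤
      3 * I.rateFor (I.cand z) z t := by
  induction hz : (z : ℕ) using Nat.strong_induction_on generalizing z with
  | _ d ih =>
    subst hz
    -- Without candidate load the whole tree costs nothing. With positive load the root needs at
    -- least one machine, and this one machine pays for the term `2 * I.r z` of the children.
    rcases (load_nonneg hI (I.cand z) t).eq_or_lt with h0 | hpos
    · refine le_trans (Finset.sum_nonpos fun y hy => ?_)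
        (mul_nonneg (by norm_num) (rateFor_nonneg hI _ _ _))
      have h1 : I.load (I.K y) t = 0 := by
        refine le_antisymm ?_ (load_nonneg hI _ _)
        rw [h0]
        exact load_mono hI (I.K_subset_cand_of_inTree (by simpa using hy)) t
      simp [rateFor, h1]
    have hsplit : ∑ y ∈ Finset.univ.filter (fun y => I.InTree y z), I.rateFor (I.K y) y t ≤
        I.rateFor (I.K z) z t + ∑ x ∈ I.children z,
          ∑ y ∈ Finset.univ.filter (fun y => I.InTree y x), I.rateFor (I.K y) y t := by
      have hsub : Finset.univ.filter (fun y => I.InTree y z) ⊆ {z} ∪ (I.children z).biUnion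
          fun x => Finset.univ.filter (fun y => I.InTree y x) := by
        intro y hy
        rcases InTree.eq_or_child (by simpa using hy) with h | ⟨x, hx, hyx⟩
        · simp [h]
        · simp only [Finset.mem_union, Finset.mem_biUnion, Finset.mem_filter]
          exact Or.inr ⟨x, hx, Finset.mem_univ _, hyx⟩
      have hnn : ∀ y, 0 ≤ I.rateFor (I.K y) y t := fun y => rateFor_nonneg hI _ _ _
      refine (Finset.sum_le_sum_of_subset_of_nonneg hsub fun y _ _ => hnn y).trans ?_
      refine (sum_union_le hnn _ _).trans ?_
      rw [Finset.sum_singleton]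
      gcongr
      exact sum_biUnion_le hnn _ _
    have hchild : ∑ x ∈ I.children z,
        ∑ y ∈ Finset.univ.filter (fun y => I.InTree y x), I.rateFor (I.K y) y t ≤ 2 * I.r z := by
      have h1 : ∀ x ∈ I.children z,
          ∑ y ∈ Finset.univ.filter (fun y => I.InTree y x), I.rateFor (I.K y) y t ≤
            3 * I.rateFor (I.restrict (I.cand z \ I.pick (I.cand z) z) x) x t := by
        intro x hx
        have hxz := I.lt_of_mem_children hx
        refine (ih x hxz x rfl).trans
          (mul_le_mul_of_nonneg_left (rateFor_mono hI (fun j hj => ?_) _ _) (by norm_num))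
        obtain ⟨hj1, i, hi, hix⟩ := I.mem_cand.1 hj
        rw [mem_restrict, Finset.mem_sdiff, mem_cand]
        exact ⟨⟨⟨fun y hy => hj1 y (hxz.trans hy), i, hi, hix.trans_child hx⟩, hj1 z hxz⟩,
          i, hi, hix⟩
      refine (Finset.sum_le_sum h1).trans ?_
      rw [← Finset.mul_sum]
      have := sum_ceil_unpicked_le hI (I.cand z) z t
      unfold rateFor
      linarith
    have h1 : 1 ≤ ⌈I.load (I.cand z) t / I.g z⌉ :=
      Int.one_le_ceil_iff.2 (div_pos hpos (hI.g_pos z))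
    have h2 : I.r z ≤ I.rateFor (I.cand z) z t := by
      have : (1 : ℝ) ≤ ⌈I.load (I.cand z) t / I.g z⌉ := by exact_mod_cast h1
      exact le_mul_of_one_le_left (hI.r_pos z).le this
    have h3 := rateFor_mono hI (I.K_subset_cand z) z t
    linarith

end Inst
end BSHM

/-! ### Duality for one-shot scheduling and the pointwise bound -/

namespace BSHM
namespace Inst
variable {n m : ℕ}

/-! ## A lower bound for one-shot scheduling -/

/-- The increments `δ` of a price function serve as the multipliers of the capacity constraints;
monotonicity, and nonnegativity at the lowest type, make them nonnegative. -/
lemma exists_sum_Iic_eq {f : Fin m → ℝ} (hf : Monotone f) (h0 : ∀ i, 0 ≤ f i) :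
    ∃ δ : Fin m → ℝ, (∀ i, 0 ≤ δ i) ∧ ∀ k, ∑ i ∈ Finset.Iic k, δ i = f k := by
  refine ⟨fun i => f i - if h : 0 < (i : ℕ) then f ⟨i - 1, by omega⟩ else 0, fun i => ?_, ?_⟩
  · dsimp only
    split_ifs with h
    · exact sub_nonneg.2 (hf (Fin.mk_le_of_le_val (Nat.sub_le _ _)))
    · simpa using h0 i
  · rintro ⟨d, hd⟩
    induction d with
    | zero =>
      have : Finset.Iic (⟨0, hd⟩ : Fin m) = {⟨0, hd⟩} := by
        ext i
        simp [Fin.le_def, Fin.ext_iff]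
      simp [this]
    | succ d ih =>
      have : Finset.Iic (⟨d + 1, hd⟩ : Fin m) =
          insert ⟨d + 1, hd⟩ (Finset.Iic ⟨d, by omega⟩) := by
        ext i
        simp only [Finset.mem_Iic, Finset.mem_insert, Fin.le_def, Fin.ext_iff]
        omega
      rw [this, Finset.sum_insert (by simp [Fin.le_def]), ih (by omega)]
      simp

/-- Weak duality: the constraint of type `i` is multiplied by the increment of `f` at `i`, and both
sides are summed by parts. -/
lemma sum_weighted_size_le {I : Inst ℝ n m} {X : Finset (Fin n)} {w : Fin m → ℕ}
    (hw : I.OneShotFeasible X w) {ty : Fin n → Fin m} (hty : ∀ j, I.exactType j = ty j)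
    {f : Fin m → ℝ} (hf : Monotone f) (h0 : ∀ i, 0 ≤ f i) :
    ∑ j ∈ X, I.s j * f (ty j) ≤ ∑ k, (w k : ℝ) * I.g k * f k := by
  classical
  obtain ⟨δ, hδ, hsum⟩ := exists_sum_Iic_eq hf h0
  calc ∑ j ∈ X, I.s j * f (ty j)
      = ∑ j ∈ X, ∑ i ∈ Finset.Iic (ty j), I.s j * δ i := by
        simp_rw [← hsum, Finset.mul_sum]
    _ = ∑ i : Fin m, ∑ j ∈ X.filter (fun j => (i : WithTop (Fin m)) ≤ I.exactType j), I.s j * δ i := by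
        apply Finset.sum_comm'
        intro j i
        simp [hty]
    _ = ∑ i : Fin m, δ i * I.size (X.filter fun j => (i : WithTop (Fin m)) ≤ I.exactType j) := by
        refine Finset.sum_congr rfl fun i _ => ?_
        rw [size, Finset.mul_sum]
        exact Finset.sum_congr rfl fun j _ => mul_comm _ _
    _ ≤ ∑ i, δ i * ∑ z ∈ Finset.Ici i, (w z : ℝ) * I.g z := by
        refine Finset.sum_le_sum fun i _ => mul_le_mul_of_nonneg_left ?_ (hδ i)
        convert hw i
    _ = ∑ i, ∑ z ∈ Finset.Ici i, (w z : ℝ) * I.g z * δ i := by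
        refine Finset.sum_congr rfl fun i _ => ?_
        rw [Finset.mul_sum]
        exact Finset.sum_congr rfl fun j _ => mul_comm _ _
    _ = ∑ k, ∑ i ∈ Finset.Iic k, (w k : ℝ) * I.g k * δ i := by
        apply Finset.sum_comm'
        intro i k
        simp
    _ = ∑ k, (w k : ℝ) * I.g k * f k := by
        simp_rw [← hsum, Finset.mul_sum]

lemma ratio_pos {I : Inst ℝ n m} (hI : I.Valid) (z : Fin m) : 0 < I.ratio z :=
  div_pos (hI.r_pos z) (hI.g_pos z)

/-- The price `f i` is the least ratio among the types from `i` up to below `v`. It is monotone and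
at most the ratio of every type that `w` can use. On the tree of `y ∈ Rt` it is at least the ratio
of `y`: types of the tree below `y` have larger ratios, and those between `y` and `v` do not have
smaller ones by the choice of `Rt`. -/
lemma sum_size_mul_ratio_le {I : Inst ℝ n m} (hI : I.Standard) {X : Finset (Fin n)}
    {w : Fin m → ℕ} (hw : I.OneShotFeasible X w) {v : ℕ} (hv : ∀ k : Fin m, v ≤ k → w k = 0)
    {Rt : Finset (Fin m)} (hRt : ∀ y ∈ Rt, (y : ℕ) < v ∧
      ∀ y', y < y' → (y' : ℕ) < v → I.ratio y ≤ I.ratio y') :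
    ∑ y ∈ Rt, I.size (I.restrict X y) * I.ratio y ≤ ∑ z, (w z : ℝ) * I.r z := by
  classical
  choose ty hty using exists_exactType hI.toValid
  have hρ := ratio_pos hI.toValid
  -- `M` dominates every ratio, so types outside the range never lower the minimum, and it is the
  -- value of `f` where the range is empty.
  set M := ∑ k, I.ratio k with hM
  have hρM : ∀ k, I.ratio k ≤ M := fun k =>
    Finset.single_le_sum (f := I.ratio) (fun k _ => (hρ k).le) (Finset.mem_univ k)
  set f : Fin m → ℝ := fun i => Finset.univ.inf' ⟨i, Finset.mem_univ i⟩
    (fun k : Fin m => if i ≤ k ∧ (k : ℕ) < v then I.ratio k else M) with hf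
  have hf_mono : Monotone f := by
    intro i i' hii
    refine Finset.le_inf' _ _ fun k _ => (Finset.inf'_le _ (Finset.mem_univ k)).trans ?_
    split_ifs with h1 h2 h2
    · exact le_rfl
    · exact hρM k
    · exact absurd ⟨hii.trans h2.1, h2.2⟩ h1
    · exact le_rfl
  have hf_nonneg : ∀ i, 0 ≤ f i := by
    intro i
    refine Finset.le_inf' _ _ fun k _ => ?_
    split_ifs
    · exact (hρ k).le
    · exact (hρ i).le.trans (hρM i)
  have hf_le : ∀ k : Fin m, (k : ℕ) < v → f k ≤ I.ratio k := by
    intro k hk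
    refine (Finset.inf'_le _ (Finset.mem_univ k)).trans ?_
    simp [hk]
  have hle_f : ∀ y ∈ Rt, ∀ i, I.InTree i y → I.ratio y ≤ f i := by
    intro y hy i hiy
    obtain ⟨hiy, hmin⟩ := I.inTree_iff.1 hiy
    refine Finset.le_inf' _ _ fun k _ => ?_
    split_ifs with h
    · rcases lt_trichotomy k y with hk | rfl | hk
      · exact (hmin k h.1 hk).le
      · exact le_rfl
      · exact (hRt y hy).2 k hk h.2
    · exact hρM y
  -- A common type of the trees of `y < y'` would force the ratio of `y'` below that of `y`, against
  -- the minimality of `y` up to `v`.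
  have hdisj : (Rt : Set (Fin m)).PairwiseDisjoint fun y => I.restrict X y := by
    have key : ∀ y ∈ Rt, ∀ y' ∈ Rt, y < y' → Disjoint (I.restrict X y) (I.restrict X y') := by
      intro y hy y' hy' hyy'
      rw [Finset.disjoint_left]
      intro j hj hj'
      obtain ⟨-, i, hi, hiy⟩ := I.mem_restrict.1 hj
      obtain ⟨-, i', hi', hiy'⟩ := I.mem_restrict.1 hj'
      have : i = i' := WithTop.coe_injective (hi.symm.trans hi')
      subst this
      have h1 := (I.inTree_iff.1 hiy').2 y (I.inTree_iff.1 hiy).1 hyy'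
      exact absurd ((hRt y hy).2 y' hyy' (hRt y' hy').1) (not_le.2 h1)
    intro y hy y' hy' hne
    rcases lt_or_gt_of_ne hne with h | h
    · exact key y hy y' hy' h
    · exact (key y' hy' y hy h).symm
  calc ∑ y ∈ Rt, I.size (I.restrict X y) * I.ratio y
      ≤ ∑ y ∈ Rt, ∑ j ∈ I.restrict X y, I.s j * f (ty j) := by
        refine Finset.sum_le_sum fun y hy => ?_
        rw [size, Finset.sum_mul]
        refine Finset.sum_le_sum fun j hj => mul_le_mul_of_nonneg_left ?_ (hI.s_pos j).le
        obtain ⟨-, i, hi, hiy⟩ := I.mem_restrict.1 hj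
        have : ty j = i := WithTop.coe_injective ((hty j).symm.trans hi)
        rw [this]
        exact hle_f y hy i hiy
    _ = ∑ j ∈ Rt.biUnion fun y => I.restrict X y, I.s j * f (ty j) :=
        (Finset.sum_biUnion hdisj).symm
    _ ≤ ∑ j ∈ X, I.s j * f (ty j) := by
        refine Finset.sum_le_sum_of_subset_of_nonneg ?_
          fun j _ _ => mul_nonneg (hI.s_pos j).le (hf_nonneg _)
        intro j hj
        obtain ⟨y, -, hy⟩ := Finset.mem_biUnion.1 hj
        exact (I.mem_restrict.1 hy).1
    _ ≤ ∑ k, (w k : ℝ) * I.g k * f k := sum_weighted_size_le hw hty hf_mono hf_nonneg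
    _ ≤ ∑ z, (w z : ℝ) * I.r z := by
        refine Finset.sum_le_sum fun k _ => ?_
        by_cases hk : (k : ℕ) < v
        · calc (w k : ℝ) * I.g k * f k ≤ (w k : ℝ) * I.g k * I.ratio k :=
              mul_le_mul_of_nonneg_left (hf_le k hk)
                (mul_nonneg (Nat.cast_nonneg _) (hI.g_pos k).le)
            _ = _ := by
              have := (hI.g_pos k).ne'
              rw [ratio]
              field_simp
        · simp [hv k (not_lt.1 hk)]

/-! ## Geometric growth of the rates -/

lemma eight_mul_r_le {I : Inst ℝ n m} (hI : I.Standard) {x y : Fin m} (h : x < y) :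
    8 * I.r x ≤ I.r y := by
  obtain ⟨a, ha⟩ := hI.r_pow x
  obtain ⟨b, hb⟩ := hI.r_pow y
  have hlt := hI.r_mono h
  rw [ha, hb] at hlt ⊢
  have hab : a < b := (zpow_lt_zpow_iff_right₀ (by norm_num)).1 hlt
  calc (8 : ℝ) * 8 ^ a = 8 ^ (a + 1) := by rw [zpow_add_one₀ (by norm_num)]; ring
    _ ≤ 8 ^ b := zpow_le_zpow_right₀ (by norm_num) (by omega)

/-- Geometric series: `1/8 + 1/64 + ... = 1/7`. -/
lemma sum_r_lt_le {I : Inst ℝ n m} (hI : I.Standard) (u : Fin m) :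
    ∑ x ∈ Finset.Iio u, I.r x ≤ 1 / 7 * I.r u := by
  obtain ⟨d, hd⟩ := u
  induction d with
  | zero =>
    have : Finset.Iio (⟨0, hd⟩ : Fin m) = ∅ := by
      ext i
      simp [Fin.lt_def]
    have := hI.r_pos ⟨0, hd⟩
    simp_all
    positivity
  | succ d ih =>
    have : Finset.Iio (⟨d + 1, hd⟩ : Fin m) =
        insert ⟨d, by omega⟩ (Finset.Iio ⟨d, by omega⟩) := by
      ext i
      simp only [Finset.mem_Iio, Finset.mem_insert, Fin.lt_def, Fin.ext_iff]
      omega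
    rw [this, Finset.sum_insert (by simp)]
    have h1 := ih (by omega)
    have h2 := eight_mul_r_le hI (x := ⟨d, by omega⟩) (y := ⟨d + 1, hd⟩) (by simp [Fin.lt_def])
    linarith

/-! ## Comparison with the one-shot optimum -/

/-- Parents are followed for as long as some type up to `u` has a smaller ratio; such a type keeps
the parent itself at most `u`. -/
lemma exists_root (I : Inst ℝ n m) {u i : Fin m} (hi : i ≤ u) :
    ∃ y, y ≤ u ∧ (∀ y', y < y' → y' ≤ u → I.ratio y ≤ I.ratio y') ∧ I.InTree i y := by
  induction hd : (u : ℕ) - i using Nat.strong_induction_on generalizing i with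
  | _ d ih =>
    by_cases h : ∀ y', i < y' → y' ≤ u → I.ratio i ≤ I.ratio y'
    · exact ⟨i, hi, h, Relation.ReflTransGen.refl⟩
    · push Not at h
      obtain ⟨y', h1, h2, h3⟩ := h
      obtain ⟨p, hp⟩ := I.exists_parent h1 h3
      have hp' := I.parent_eq_iff.1 hp
      have hpu : p ≤ u := (hp'.2 y' h1 h3).trans h2
      have h4 : (i : ℕ) < p := hp'.1.1
      have h5 : (p : ℕ) ≤ u := hpu
      obtain ⟨y, hy1, hy2, hy3⟩ := ih ((u : ℕ) - p) (by omega) hpu rfl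
      exact ⟨y, hy1, hy2, Relation.ReflTransGen.head hp hy3⟩

lemma load_restrict_le {I : Inst ℝ n m} (hI : I.Valid) (X : Finset (Fin n)) (y : Fin m)
    (t : ℝ) : I.load (I.restrict X y) t ≤ I.size (I.restrict (I.activeIn Finset.univ t) y) := by
  refine size_mono hI fun j hj => ?_
  rw [mem_activeIn, mem_restrict] at hj
  rw [mem_restrict, mem_activeIn]
  exact ⟨⟨Finset.mem_univ j, hj.2⟩, hj.1.2⟩

lemma r_le_cost {I : Inst ℝ n m} (hI : I.Valid) {w : Fin m → ℕ} {u : Fin m} (h : w u ≠ 0) :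
    I.r u ≤ ∑ z, (w z : ℝ) * I.r z := by
  have h1 : (1 : ℝ) ≤ w u := by exact_mod_cast Nat.one_le_iff_ne_zero.2 h
  refine (le_mul_of_one_le_left (hI.r_pos u).le h1).trans ?_
  exact Finset.single_le_sum (f := fun z => (w z : ℝ) * I.r z)
    (fun z _ => mul_nonneg (Nat.cast_nonneg _) (hI.r_pos z).le) (Finset.mem_univ u)

/-- As `w` has no machines of type `u` or above, no active job has exact type `u`. So the active job
of `K u` was picked because the child cost at `t` is at least `r u / 3`. That cost is at most the
volume in the child trees at the child ratios, hence at most the cost of `w`, plus `r u / 7` for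
rounding up. The constant is the inverse of `1/3 - 1/7 = 4/21`. -/
lemma r_le_of_active {I : Inst ℝ n m} (hI : I.Standard) {t : ℝ} {w : Fin m → ℕ}
    (hw : I.OneShotFeasible (I.activeIn Finset.univ t) w) {u : Fin m}
    (hwu : ∀ k, u ≤ k → w k = 0) {j : Fin n} (hj : j ∈ I.K u) (hjt : t ∈ I.interval j) :
    I.r u ≤ 21 / 4 * ∑ z, (w z : ℝ) * I.r z := by
  classical
  have hV := hI.toValid
  have hnoexact : ∀ i : Fin n, t ∈ I.interval i → I.exactType i ≠ u := by
    intro i hit hi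
    have h1 := hw u
    have h2 : ∑ z ∈ Finset.Ici u, (w z : ℝ) * I.g z = 0 :=
      Finset.sum_eq_zero fun z hz => by simp [hwu z (Finset.mem_Ici.1 hz)]
    rw [h2] at h1
    have h3 : i ∈ (I.activeIn Finset.univ t).filter
        fun j => (u : WithTop (Fin m)) ≤ I.exactType j := by
      simp [mem_activeIn, hit, hi]
    have h4 := size_pos hV h3
    refine absurd h1 (not_le.2 ?_)
    convert h4
  have heff : t ∈ I.effective (I.cand u) u := by
    rw [K_eq, mem_pick] at hj
    exact hj.2.resolve_left (hnoexact j hjt) hjt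
  have hcc : 1 / 3 * I.r u ≤ I.childCost (I.cand u) u t := by
    rcases heff with h | h
    · obtain ⟨i, hi, hit⟩ := I.mem_span.1 h
      exact absurd (I.mem_exactJobs.1 hi).2 (hnoexact i hit)
    · exact h
  have h1 : I.childCost (I.cand u) u t ≤
      ∑ x ∈ I.children u, I.size (I.restrict (I.activeIn Finset.univ t) x) * I.ratio x +
        ∑ x ∈ I.children u, I.r x := by
    rw [← Finset.sum_add_distrib]
    refine Finset.sum_le_sum fun x _ => (rateFor_le hV (I.restrict (I.cand u) x) x t).trans ?_
    gcongr
    · exact (ratio_pos hV x).le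
    · exact load_restrict_le hV _ _ _
  have h2 : ∑ x ∈ I.children u, I.r x ≤ 1 / 7 * I.r u := by
    refine (Finset.sum_le_sum_of_subset_of_nonneg ?_ fun x _ _ => (hI.r_pos x).le).trans
      (sum_r_lt_le hI u)
    intro x hx
    exact Finset.mem_Iio.2 (I.lt_of_mem_children hx)
  -- A child of `u` has minimal ratio among the types from itself up to below `u`, since a smaller
  -- one there would have been its parent instead.
  have h3 := sum_size_mul_ratio_le hI hw (v := (u : ℕ)) (fun k hk => hwu k hk)
    (Rt := I.children u) (fun x hx => by
      obtain ⟨⟨hxu, -⟩, hmin⟩ := I.parent_eq_iff.1 (I.mem_children.1 hx)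
      refine ⟨hxu, fun y' hy' hy'u => ?_⟩
      by_contra hcon
      exact absurd (hmin y' hy' (not_le.1 hcon)) (not_le.2 hy'u))
  linarith

/-- The types up to `u` are covered by the trees of the roots in `Rt`. Each tree costs three times
its volume at the root ratio plus one root machine. Volumes are bounded by duality and root machines
by `8/7 * r u`, so the constant obtained is `3 * (1 + 6) = 21`, and 45 leaves room. -/
lemma neededRate_le_of_feasible {I : Inst ℝ n m} (hI : I.Standard) {t : ℝ} {w : Fin m → ℕ}
    (hw : I.OneShotFeasible (I.activeIn Finset.univ t) w) :
    I.neededRate t ≤ 45 * ∑ z, (w z : ℝ) * I.r z := by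
  classical
  have hV := hI.toValid
  have hcost : 0 ≤ ∑ z, (w z : ℝ) * I.r z :=
    Finset.sum_nonneg fun z _ => mul_nonneg (Nat.cast_nonneg _) (hI.r_pos z).le
  have hzero : ∀ z, (∀ j ∈ I.K z, t ∉ I.interval j) → I.rateFor (I.K z) z t = 0 := by
    intro z hz
    have : I.activeIn (I.K z) t = ∅ := by
      rw [Finset.eq_empty_iff_forall_notMem]
      intro j hj
      rw [mem_activeIn] at hj
      exact hz j hj.1 hj.2
    simp [rateFor, load, this, size]
  change ∑ z, I.rateFor (I.K z) z t ≤ _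
  set S := Finset.univ.filter fun u : Fin m => w u ≠ 0 ∨ ∃ j ∈ I.K u, t ∈ I.interval j with hS
  rcases S.eq_empty_or_nonempty with hSe | hSne
  · have : ∀ z, I.rateFor (I.K z) z t = 0 := by
      intro z
      refine hzero z fun j hj hjt => ?_
      have : z ∈ S := by
        rw [hS, Finset.mem_filter]
        exact ⟨Finset.mem_univ z, Or.inr ⟨j, hj, hjt⟩⟩
      simp [hSe] at this
    simp only [this, Finset.sum_const_zero]
    positivity
  -- `u` is the highest type that is used by `w` or has an active job of the algorithm. Above it
  -- both sides vanish; at `u` either reason bounds `r u` by the cost of `w`.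
  obtain ⟨u, huS, humax⟩ := Finset.exists_max_image S id hSne
  have hout : ∀ k, u < k → w k = 0 ∧ ∀ j ∈ I.K k, t ∉ I.interval j := by
    intro k hk
    have : k ∉ S := fun h => absurd (humax k h) (not_le.2 hk)
    rw [hS, Finset.mem_filter] at this
    push Not at this
    exact this (Finset.mem_univ k)
  have hru : I.r u ≤ 21 / 4 * ∑ z, (w z : ℝ) * I.r z := by
    by_cases hwu : w u = 0
    · obtain ⟨j, hj, hjt⟩ := (Finset.mem_filter.1 huS).2.resolve_left (not_not.2 hwu)
      refine r_le_of_active hI hw (fun k hk => ?_) hj hjt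
      rcases hk.eq_or_lt with rfl | hk
      · exact hwu
      · exact (hout k hk).1
    · have := r_le_cost hV hwu
      linarith
  set Rt := Finset.univ.filter fun y : Fin m =>
    y ≤ u ∧ ∀ y', y < y' → y' ≤ u → I.ratio y ≤ I.ratio y' with hRt
  have h1 : ∑ z, I.rateFor (I.K z) z t ≤ ∑ y ∈ Rt,
      ∑ z ∈ Finset.univ.filter (fun z => I.InTree z y), I.rateFor (I.K z) z t := by
    refine le_trans ?_ (sum_biUnion_le (fun z => rateFor_nonneg hV _ _ _) _ _)
    rw [← Finset.sum_subset (Finset.subset_univ _)]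
    intro z _ hz
    refine hzero z (hout z ?_).2
    by_contra hzu
    obtain ⟨y, hy1, hy2, hy3⟩ := I.exists_root (not_lt.1 hzu)
    refine hz (Finset.mem_biUnion.2 ⟨y, ?_, ?_⟩)
    · rw [hRt, Finset.mem_filter]
      exact ⟨Finset.mem_univ _, hy1, hy2⟩
    · simpa using hy3
  have h2 : ∑ y ∈ Rt, ∑ z ∈ Finset.univ.filter (fun z => I.InTree z y),
      I.rateFor (I.K z) z t ≤ 3 * ∑ y ∈ Rt, (I.size (I.restrict (I.activeIn Finset.univ t) y) *
        I.ratio y + I.r y) := by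
    rw [Finset.mul_sum]
    refine Finset.sum_le_sum fun y _ => (sum_tree_le hV t y).trans ?_
    refine mul_le_mul_of_nonneg_left ((rateFor_le hV _ y t).trans ?_) (by norm_num)
    gcongr
    · exact (ratio_pos hV y).le
    · exact load_restrict_le hV _ _ _
  have h3 := sum_size_mul_ratio_le hI hw (v := (u : ℕ) + 1)
    (fun k hk => (hout k (Fin.lt_def.2 (by omega))).1) (Rt := Rt) (fun y hy => by
      rw [hRt, Finset.mem_filter] at hy
      exact ⟨Nat.lt_succ_of_le hy.2.1, fun y' h h' => hy.2.2 y' h (Nat.le_of_lt_succ h')⟩)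
  have h4 : ∑ y ∈ Rt, I.r y ≤ 8 / 7 * I.r u := by
    have : Rt ⊆ insert u (Finset.Iio u) := by
      intro y hy
      rw [hRt, Finset.mem_filter] at hy
      rw [Finset.mem_insert, Finset.mem_Iio]
      exact hy.2.1.eq_or_lt
    refine (Finset.sum_le_sum_of_subset_of_nonneg this fun x _ _ => (hI.r_pos x).le).trans ?_
    rw [Finset.sum_insert (by simp)]
    have := sum_r_lt_le hI u
    linarith
  rw [Finset.sum_add_distrib] at h2
  linarith

/-! ## One-shot configurations -/

lemma optOneShot_le {I : Inst ℝ n m} (hI : I.Valid) {X : Finset (Fin n)} {w : Fin m → ℕ}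
    (hw : I.OneShotFeasible X w) : I.optOneShot X ≤ ∑ z, (w z : ℝ) * I.r z := by
  refine csInf_le ⟨0, ?_⟩ ⟨w, hw, rfl⟩
  rintro c ⟨w, -, rfl⟩
  exact Finset.sum_nonneg fun z _ => mul_nonneg (Nat.cast_nonneg _) (hI.r_pos z).le

/-- The number of active machines of every type is a feasible configuration. -/
lemma oneShotFeasible_busy {I : Inst ℝ n m} (hI : I.Valid) {σ : Sched n m} (hσ : I.Feasible σ)
    (t : ℝ) : I.OneShotFeasible (I.activeIn Finset.univ t) fun z => I.busy σ z t := by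
  classical
  intro i
  set Y := (I.activeIn Finset.univ t).filter fun j => (i : WithTop (Fin m)) ≤ I.exactType j
    with hY
  -- At the arrival of `j` the load of its machine includes `j`, so feasibility makes the machine
  -- type large enough for `j` alone.
  have htype : ∀ j, (i : WithTop (Fin m)) ≤ I.exactType j → i ≤ (σ j).1 := by
    intro j hj
    obtain ⟨x, hx⟩ := exists_exactType hI j
    have hfit : I.s j ≤ I.g (σ j).1 := by
      refine le_trans ?_ (hσ (σ j) (I.arr j))
      refine le_size hI (I.mem_activeIn.2 ⟨by simp [jobsOn], le_rfl, hI.arr_lt_dep j⟩)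
    rw [hx] at hj
    exact (WithTop.coe_le_coe.1 hj).trans ((I.exactType_eq_iff.1 hx).2 _ hfit)
  set Ms := (I.activeIn Finset.univ t).image σ with hMs
  have h1 : I.size Y ≤ ∑ M ∈ Ms.filter (fun M => i ≤ M.1), I.load (jobsOn σ M) t := by
    unfold load size
    refine le_trans ?_ (sum_biUnion_le (fun j => (hI.s_pos j).le) _ _)
    refine Finset.sum_le_sum_of_subset_of_nonneg ?_ fun j _ _ => (hI.s_pos j).le
    intro j hj
    rw [hY, Finset.mem_filter] at hj
    have hjt := (I.mem_activeIn.1 hj.1).2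
    refine Finset.mem_biUnion.2 ⟨σ j, ?_, ?_⟩
    · rw [Finset.mem_filter]
      exact ⟨Finset.mem_image_of_mem _ hj.1, htype j hj.2⟩
    · rw [mem_activeIn]
      exact ⟨by simp [jobsOn], hjt⟩
  have h2 : ∑ M ∈ Ms.filter (fun M => i ≤ M.1), I.load (jobsOn σ M) t ≤
      ∑ M ∈ Ms.filter (fun M => i ≤ M.1), I.g M.1 := Finset.sum_le_sum fun M _ => hσ M t
  have h3 : ∑ M ∈ Ms.filter (fun M => i ≤ M.1), I.g M.1 =
      ∑ z ∈ Finset.Ici i, (I.busy σ z t : ℝ) * I.g z := by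
    rw [← Finset.sum_fiberwise_of_maps_to (t := Finset.Ici i) (g := fun M : Fin m × ℕ => M.1)
      (fun M hM => by simpa using (Finset.mem_filter.1 hM).2)]
    refine Finset.sum_congr rfl fun z hz => ?_
    rw [Finset.mem_Ici] at hz
    have : (Ms.filter (fun M => i ≤ M.1)).filter (fun M => M.1 = z) =
        Ms.filter fun M => M.1 = z := by
      ext M
      simp only [Finset.mem_filter]
      constructor
      · rintro ⟨⟨a, -⟩, c⟩
        exact ⟨a, c⟩
      · rintro ⟨a, rfl⟩
        exact ⟨⟨a, hz⟩, rfl⟩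
    rw [this, Finset.sum_congr rfl (g := fun _ => I.g z), Finset.sum_const, nsmul_eq_mul]
    · rfl
    · intro M hM
      rw [(Finset.mem_filter.1 hM).2]
  have h4 := (h1.trans h2).trans_eq h3
  convert h4

/-- Every job on a machine of its own. -/
lemma feasible_of_injective {I : Inst ℝ n m} (hI : I.Valid) {σ : Sched n m}
    (hσ : Function.Injective σ) (hfit : ∀ j, I.s j ≤ I.g (σ j).1) : I.Feasible σ := by
  intro M t
  by_cases h : ∃ j, σ j = M
  · obtain ⟨j, rfl⟩ := h
    have : I.activeIn (jobsOn σ (σ j)) t ⊆ {j} := by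
      intro i hi
      rw [mem_activeIn] at hi
      simpa using hσ (by simpa [jobsOn] using hi.1)
    refine (size_mono hI this).trans ?_
    simpa [size] using hfit j
  · have : jobsOn σ M = ∅ := by
      rw [jobsOn, Finset.filter_eq_empty_iff]
      exact fun j _ hj => h ⟨j, hj⟩
    simpa [this, load, size, activeIn] using (hI.g_pos M.1).le

lemma exists_feasible {I : Inst ℝ n m} (hI : I.Valid) : ∃ σ : Sched n m, I.Feasible σ := by
  choose f hf using hI.fits
  exact ⟨fun j => (f j, j), feasible_of_injective hI
    (fun i j h => Fin.ext (Prod.ext_iff.1 h).2) hf⟩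

lemma neededRate_le {I : Inst ℝ n m} (hI : I.Standard) (t : ℝ) :
    I.neededRate t ≤ 45 * I.optOneShot (I.activeIn Finset.univ t) := by
  obtain ⟨σ, hσ⟩ := exists_feasible hI.toValid
  have : I.neededRate t / 45 ≤ I.optOneShot (I.activeIn Finset.univ t) := by
    refine le_csInf ⟨_, _, oneShotFeasible_busy hI.toValid hσ t, rfl⟩ ?_
    rintro c ⟨w, hw, rfl⟩
    have := neededRate_le_of_feasible hI hw
    linarith
  linarith

end Inst
end BSHM

/-! ### Integration over time, and reduction of arbitrary types to standard ones -/

namespace BSHM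
namespace Inst
variable {n m : ℕ}

/-! ## Integrals over the span -/

lemma measurableSet_span (I : Inst ℝ n m) (X : Finset (Fin n)) : MeasurableSet (I.span X) :=
  Finset.measurableSet_biUnion X fun _ _ => measurableSet_Ico

lemma volume_span_ne_top (I : Inst ℝ n m) (X : Finset (Fin n)) : volume (I.span X) ≠ ⊤ := by
  refine ((measure_biUnion_finset_le X _).trans_lt ?_).ne
  exact ENNReal.sum_lt_top.2 fun j _ => by simp [interval]

lemma measurableSet_activeIn_eq (I : Inst ℝ n m) (S : Finset (Fin n)) :
    MeasurableSet {t | I.activeIn Finset.univ t = S} := by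
  have : {t | I.activeIn Finset.univ t = S} =
      ⋂ j : Fin n, {t | t ∈ I.interval j ↔ j ∈ S} := by
    ext t
    simp [Finset.ext_iff, mem_activeIn]
  rw [this]
  refine MeasurableSet.iInter fun j => ?_
  have hj : MeasurableSet (I.interval j) := measurableSet_Ico
  by_cases h : j ∈ S
  · simp only [h, iff_true]
    exact hj
  · simp only [h, iff_false]
    exact hj.compl

/-- Any function of the active set is simple: there are finitely many possible sets, each attained
on a measurable set, and the span has finite measure. -/
lemma integrableOn_active (I : Inst ℝ n m) (F : Finset (Fin n) → ℝ) :
    IntegrableOn (fun t => F (I.activeIn Finset.univ t)) (I.span Finset.univ) := by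
  classical
  have : (fun t => F (I.activeIn Finset.univ t)) = fun t => ∑ S : Finset (Fin n),
      Set.indicator {t | I.activeIn Finset.univ t = S} (fun _ => F S) t := by
    funext t
    rw [Finset.sum_eq_single (I.activeIn Finset.univ t)]
    · simp
    · intro S _ hS
      exact Set.indicator_of_notMem (fun h => hS h.symm) _
    · simp
  rw [this]
  refine integrable_finsetSum _ fun S _ => ?_
  refine Integrable.indicator ?_ (I.measurableSet_activeIn_eq S)
  exact integrableOn_const (I.volume_span_ne_top _)

lemma load_eq_size_inter (I : Inst ℝ n m) (X : Finset (Fin n)) (t : ℝ) :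
    I.load X t = I.size (X ∩ I.activeIn Finset.univ t) := by
  unfold load
  congr 1
  ext j
  simp [mem_activeIn]

lemma integrableOn_neededRate (I : Inst ℝ n m) :
    IntegrableOn (fun t => I.neededRate t) (I.span Finset.univ) := by
  have := I.integrableOn_active fun S => ∑ z, (⌈I.size (I.K z ∩ S) / I.g z⌉ : ℝ) * I.r z
  simpa only [neededRate, load_eq_size_inter] using this

/-- Each busy time is the integral of an indicator. After exchanging sum and integral, the machines
running at `t` are grouped by type. -/
lemma cost_eq_integral (I : Inst ℝ n m) (σ : Sched n m) :
    I.cost σ = ∫ t in I.span Finset.univ, ∑ z, (I.busy σ z t : ℝ) * I.r z := by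
  classical
  have h1 : ∀ M : Fin m × ℕ, I.r M.1 * volume.real (I.span (jobsOn σ M)) =
      ∫ t in I.span Finset.univ, Set.indicator (I.span (jobsOn σ M)) (fun _ => I.r M.1) t := by
    intro M
    have hsub : I.span (jobsOn σ M) ⊆ I.span Finset.univ := by
      intro t ht
      obtain ⟨j, -, hj⟩ := I.mem_span.1 ht
      exact I.mem_span.2 ⟨j, Finset.mem_univ j, hj⟩
    rw [setIntegral_indicator (I.measurableSet_span _), Set.inter_eq_self_of_subset_right hsub,
      setIntegral_const, smul_eq_mul, mul_comm]
  unfold cost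
  simp_rw [h1]
  rw [← integral_finsetSum]
  · refine integral_congr_ae (Filter.Eventually.of_forall fun t => ?_)
    dsimp only
    have h2 : ∀ M : Fin m × ℕ, M ∈ (I.activeIn Finset.univ t).image σ ↔
        t ∈ I.span (jobsOn σ M) := by
      intro M
      simp only [Finset.mem_image, mem_activeIn, mem_span, jobsOn, Finset.mem_filter,
        Finset.mem_univ, true_and]
      exact ⟨fun ⟨j, h, h'⟩ => ⟨j, h', h⟩, fun ⟨j, h, h'⟩ => ⟨j, h', h⟩⟩
    have hsub : (I.activeIn Finset.univ t).image σ ⊆ Finset.univ.image σ :=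
      Finset.image_subset_image (Finset.subset_univ _)
    rw [← Finset.sum_subset hsub fun M _ hM =>
      Set.indicator_of_notMem (fun h => hM ((h2 M).2 h)) _]
    rw [Finset.sum_congr rfl (g := fun M : Fin m × ℕ => I.r M.1)
      fun M hM => Set.indicator_of_mem ((h2 M).1 hM) _]
    rw [← Finset.sum_fiberwise_of_maps_to (t := Finset.univ) (g := fun M : Fin m × ℕ => M.1)
      (fun M _ => Finset.mem_univ _)]
    refine Finset.sum_congr rfl fun z _ => ?_
    rw [Finset.sum_congr rfl (g := fun _ => I.r z), Finset.sum_const, nsmul_eq_mul]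
    · rfl
    · intro M hM
      rw [(Finset.mem_filter.1 hM).2]
  · intro M _
    refine Integrable.indicator ?_ (I.measurableSet_span _)
    exact integrableOn_const (I.volume_span_ne_top _)

lemma integrableOn_busy (I : Inst ℝ n m) (σ : Sched n m) :
    IntegrableOn (fun t => ∑ z, (I.busy σ z t : ℝ) * I.r z) (I.span Finset.univ) :=
  I.integrableOn_active fun S => ∑ z, (((S.image σ).filter fun M => M.1 = z).card : ℝ) * I.r z

lemma cost_le_integral {I : Inst ℝ n m} (hI : I.Valid) {σ : Sched n m}
    (hσ : I.DualColoringBound σ) :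
    I.cost σ ≤ ∫ t in I.span Finset.univ, 4 * I.neededRate t := by
  rw [cost_eq_integral]
  refine integral_mono (I.integrableOn_busy σ) (I.integrableOn_neededRate.const_mul 4) fun t => ?_
  dsimp only
  rw [neededRate, Finset.mul_sum]
  refine Finset.sum_le_sum fun z _ => ?_
  rw [← mul_assoc]
  refine mul_le_mul_of_nonneg_right ?_ (hI.r_pos z).le
  exact_mod_cast hσ z t

lemma integrableOn_optOneShot (I : Inst ℝ n m) :
    IntegrableOn (fun t => I.optOneShot (I.activeIn Finset.univ t)) (I.span Finset.univ) :=
  I.integrableOn_active I.optOneShot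

lemma integral_optOneShot_le_cost {I : Inst ℝ n m} (hI : I.Valid) {σ : Sched n m}
    (hσ : I.Feasible σ) :
    (∫ t in I.span Finset.univ, I.optOneShot (I.activeIn Finset.univ t)) ≤ I.cost σ := by
  rw [cost_eq_integral]
  exact integral_mono I.integrableOn_optOneShot (I.integrableOn_busy σ)
    fun t => optOneShot_le hI (oneShotFeasible_busy hI hσ t)

lemma integral_optOneShot_le_opt {I : Inst ℝ n m} (hI : I.Valid) :
    (∫ t in I.span Finset.univ, I.optOneShot (I.activeIn Finset.univ t)) ≤ I.opt := by
  obtain ⟨σ, hσ⟩ := exists_feasible hI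
  refine le_csInf ⟨_, σ, hσ, rfl⟩ ?_
  rintro c ⟨σ, hσ, rfl⟩
  exact integral_optOneShot_le_cost hI hσ

lemma integral_neededRate_le {I : Inst ℝ n m} (hI : I.Standard) :
    (∫ t in I.span Finset.univ, 4 * I.neededRate t) ≤
      180 * ∫ t in I.span Finset.univ, I.optOneShot (I.activeIn Finset.univ t) := by
  rw [← integral_const_mul]
  refine integral_mono (I.integrableOn_neededRate.const_mul 4)
    (I.integrableOn_optOneShot.const_mul 180) fun t => ?_
  have := neededRate_le hI t
  dsimp only
  linarith

lemma cost_le_opt {I : Inst ℝ n m} (hI : I.Standard) {σ : Sched n m}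
    (hσ : I.DualColoringBound σ) : I.cost σ ≤ 180 * I.opt := by
  have h1 := cost_le_integral hI.toValid hσ
  have h2 := integral_neededRate_le hI
  have h3 := integral_optOneShot_le_opt hI.toValid
  linarith

/-! ## Normalization of the machine types -/

lemma le_round8 (c : ℝ) : c ≤ round8 c := by
  have := Int.self_le_zpow_clog (R := ℝ) (b := 8) (by norm_num) c
  exact_mod_cast this

lemma round8_le {c : ℝ} (hc : 0 < c) : round8 c ≤ 8 * c := by
  have := Int.zpow_pred_clog_lt_self (R := ℝ) (b := 8) (by norm_num) hc
  rw [zpow_sub_one₀ (by norm_num)] at this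
  unfold round8
  push_cast at this
  linarith

lemma round8_pos (c : ℝ) : 0 < round8 c := zpow_pos (by norm_num) _

lemma round8_zpow (k : ℤ) : round8 ((8 : ℝ) ^ k) = 8 ^ k := by
  have := Int.clog_zpow (R := ℝ) (b := 8) (by norm_num) k
  unfold round8
  push_cast at this
  rw [this]

/-- The interval from `c` to `8 * c`, open on the right, contains only one power of 8. -/
lemma round8_eq {c : ℝ} (hc : 0 < c) {k : ℤ} (h1 : c ≤ 8 ^ k) (h2 : (8 : ℝ) ^ k < 8 * c) :
    round8 c = 8 ^ k := by
  have h3 := le_round8 c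
  have h4 := round8_le hc
  unfold round8 at *
  congr 1
  have h8 : (8 : ℝ) ^ (k - 1) < 8 ^ Int.clog 8 c := by
    rw [zpow_sub_one₀ (by norm_num)]
    linarith
  have h9 : (8 : ℝ) ^ (Int.clog 8 c - 1) < 8 ^ k := by
    have := Int.zpow_pred_clog_lt_self (R := ℝ) (b := 8) (by norm_num) hc
    push_cast at this
    linarith
  rw [zpow_lt_zpow_iff_right₀ (by norm_num)] at h8 h9
  omega

section Normalization

variable {k : ℕ} {A : Inst ℝ n k} {I : Inst ℝ n m} {e : Fin m → Fin k}

lemma IsNormalization.injective (h : A.IsNormalization I e) : Function.Injective e := by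
  intro x y hxy
  refine h.standard.g_mono.injective ?_
  rw [h.g_eq, h.g_eq, hxy]

lemma IsNormalization.interval_eq (h : A.IsNormalization I e) : I.interval = A.interval := by
  funext j
  rw [interval, interval, h.arr_eq, h.dep_eq]

lemma IsNormalization.span_eq (h : A.IsNormalization I e) : I.span = A.span := by
  funext X
  rw [span, span, h.interval_eq]

lemma IsNormalization.load_eq (h : A.IsNormalization I e) : I.load = A.load := by
  funext X t
  rw [load, load, size, size, activeIn, activeIn, h.interval_eq, h.s_eq]

lemma jobsOn_liftSched (he : Function.Injective e) (σ : Sched n m) (M : Fin m × ℕ) :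
    jobsOn (liftSched e σ) (e M.1, M.2) = jobsOn σ M := by
  ext j
  simp [jobsOn, liftSched, Prod.ext_iff, he.eq_iff]

lemma IsNormalization.feasible_lift (hA : A.Valid) (h : A.IsNormalization I e) {σ : Sched n m}
    (hσ : I.Feasible σ) : A.Feasible (liftSched e σ) := by
  rintro ⟨y, i⟩ t
  by_cases hy : ∃ z, e z = y
  · obtain ⟨z, rfl⟩ := hy
    have h1 := hσ (z, i) t
    rw [h.load_eq, h.g_eq, ← jobsOn_liftSched h.injective] at h1
    exact h1
  · have : jobsOn (liftSched e σ) (y, i) = ∅ := by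
      rw [jobsOn, Finset.filter_eq_empty_iff]
      exact fun j _ hj => hy ⟨(σ j).1, (Prod.ext_iff.1 hj).1⟩
    rw [this]
    simpa [load, size, activeIn] using (hA.g_pos y).le

lemma IsNormalization.cost_lift_le (h : A.IsNormalization I e) (σ : Sched n m) :
    A.cost (liftSched e σ) ≤ I.cost σ := by
  classical
  have h1 : Finset.univ.image (liftSched e σ) =
      (Finset.univ.image σ).image fun M => (e M.1, M.2) := by
    rw [Finset.image_image]
    rfl
  unfold cost
  rw [h1, Finset.sum_image]
  · refine Finset.sum_le_sum fun M _ => ?_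
    rw [jobsOn_liftSched h.injective, h.span_eq, h.r_eq]
    exact mul_le_mul_of_nonneg_right (le_round8 _) measureReal_nonneg
  · intro M _ M' _ hMM
    simp only [Prod.mk.injEq] at hMM
    exact Prod.ext (h.injective hMM.1) hMM.2

/-- Every machine of a schedule for the original types is replaced by a machine of a kept type that
dominates its type. Capacity does not shrink, and the rate is at most the rounded one, hence at most
8 times the original. -/
lemma IsNormalization.opt_le (hA : A.Valid) (h : A.IsNormalization I e) :
    I.opt ≤ 8 * A.opt := by
  classical
  obtain ⟨σ₀, hσ₀⟩ := exists_feasible hA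
  have key : ∀ σ : Sched n k, A.Feasible σ → I.opt ≤ 8 * A.cost σ := by
    intro σ hσ
    choose d hd1 hd2 using h.dominated
    -- Several original types may be replaced by the same kept type; pairing the old type with the
    -- old number keeps their machines distinct.
    let f : Fin k × ℕ → Fin m × ℕ := fun M => (d M.1, Nat.pair M.1 M.2)
    have hf : Function.Injective f := by
      rintro ⟨y, i⟩ ⟨y', i'⟩ hyy
      have := (Nat.pair_eq_pair.1 (Prod.ext_iff.1 hyy).2)
      exact Prod.ext (Fin.ext this.1) this.2
    have hjobs : ∀ M, jobsOn (f ∘ σ) (f M) = jobsOn σ M := by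
      intro M
      ext j
      simp [jobsOn, hf.eq_iff]
    have hfeas : I.Feasible (f ∘ σ) := by
      intro M t
      by_cases hM : ∃ M', f M' = M
      · obtain ⟨M', rfl⟩ := hM
        rw [hjobs, h.load_eq]
        exact (hσ M' t).trans (hd1 M'.1)
      · have : jobsOn (f ∘ σ) M = ∅ := by
          rw [jobsOn, Finset.filter_eq_empty_iff]
          exact fun j _ hj => hM ⟨σ j, hj⟩
        rw [this]
        simpa [load, size, activeIn] using (h.standard.g_pos M.1).le
    have hbdd : I.opt ≤ I.cost (f ∘ σ) := by
      refine csInf_le ⟨0, ?_⟩ ⟨_, hfeas, rfl⟩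
      rintro c ⟨σ', -, rfl⟩
      exact Finset.sum_nonneg fun M _ => mul_nonneg (h.standard.r_pos _).le measureReal_nonneg
    refine hbdd.trans ?_
    have h1 : Finset.univ.image (f ∘ σ) = (Finset.univ.image σ).image f := by
      rw [Finset.image_image]
    unfold cost
    rw [h1, Finset.sum_image fun M _ M' _ hMM => hf hMM, Finset.mul_sum]
    refine Finset.sum_le_sum fun M _ => ?_
    rw [hjobs, h.span_eq, ← mul_assoc]
    exact mul_le_mul_of_nonneg_right ((hd2 M.1).trans (round8_le (hA.r_pos _))) measureReal_nonneg
  have : I.opt / 8 ≤ A.opt := by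
    refine le_csInf ⟨_, σ₀, hσ₀, rfl⟩ ?_
    rintro c ⟨σ, hσ, rfl⟩
    have := key σ hσ
    linarith
  linarith

lemma IsNormalization.lift_bound (hA : A.Valid) (h : A.IsNormalization I e) {σ : Sched n m}
    (hσ : I.DualColoringBound σ) : A.cost (liftSched e σ) ≤ 1440 * A.opt := by
  have h1 := h.cost_lift_le σ
  have h2 := cost_le_opt h.standard hσ
  have h3 := h.opt_le hA
  linarith

/-- Rounding fixes powers of 8, and in a standard instance a type is dominated only by itself, so
`e` is onto. It is also strictly increasing, and the only order automorphism of `Fin m` is the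
identity. -/
lemma IsNormalization.eq_of_standard (hA : A.Standard) (h : A.IsNormalization I e) :
    ∃ hmk : m = k, (∀ z, e z = Fin.cast hmk z) := by
  have hmono : StrictMono e := by
    intro x y hxy
    have := h.standard.g_mono hxy
    rw [h.g_eq, h.g_eq] at this
    exact hA.g_mono.lt_iff_lt.1 this
  have hround : ∀ y, round8 (A.r y) = A.r y := by
    intro y
    obtain ⟨i, hi⟩ := hA.r_pow y
    rw [hi, round8_zpow]
  have hsurj : Function.Surjective e := by
    intro y
    obtain ⟨z, h1, h2⟩ := h.dominated y
    rw [h.g_eq] at h1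
    rw [h.r_eq, hround, hround] at h2
    exact ⟨z, le_antisymm (hA.r_mono.le_iff_le.1 h2) (hA.g_mono.le_iff_le.1 h1)⟩
  have hmk : m = k := by
    simpa using Fintype.card_of_bijective ⟨hmono.injective, hsurj⟩
  subst hmk
  refine ⟨rfl, fun z => ?_⟩
  have : hmono.orderIsoOfSurjective e hsurj = OrderIso.refl (Fin m) := Subsingleton.elim _ _
  simpa using congrArg (fun f => f z) this

end Normalization

end Inst
end BSHM

/-! ### A subroutine for one type: greedy layers of small jobs -/

namespace BSHM
namespace Inst
variable {n m : ℕ}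

/-! ## Machines of a single type -/

lemma load_insert (I : Inst ℝ n m) {X : Finset (Fin n)} {j : Fin n} (hj : j ∉ X) (t : ℝ)
    [Decidable (t ∈ I.interval j)] :
    I.load (insert j X) t = I.load X t + if t ∈ I.interval j then I.s j else 0 := by
  classical
  unfold load size
  split_ifs with h
  · have : I.activeIn (insert j X) t = insert j (I.activeIn X t) := by
      ext i
      simp only [mem_activeIn, Finset.mem_insert]
      constructor
      · rintro ⟨h1 | h1, h2⟩
        · exact Or.inl h1
        · exact Or.inr ⟨h1, h2⟩
      · rintro (rfl | h1)
        · exact ⟨Or.inl rfl, h⟩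
        · exact ⟨Or.inr h1.1, h1.2⟩
    rw [this, Finset.sum_insert (fun h' => hj (I.mem_activeIn.1 h').1), add_comm]
  · have : I.activeIn (insert j X) t = I.activeIn X t := by
      ext i
      simp only [mem_activeIn, Finset.mem_insert]
      constructor
      · rintro ⟨rfl | h1, h2⟩
        · exact absurd h2 h
        · exact ⟨h1, h2⟩
      · exact fun h1 => ⟨Or.inr h1.1, h1.2⟩
    rw [this, add_zero]

lemma load_sdiff_add (I : Inst ℝ n m) {X D : Finset (Fin n)} (h : D ⊆ X) (t : ℝ) :
    I.load (X \ D) t + I.load D t = I.load X t := by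
  classical
  unfold load size
  rw [← Finset.sum_sdiff (I.activeIn_mono h t)]
  congr 2
  ext j
  simp only [mem_activeIn, Finset.mem_sdiff]
  tauto

open Classical in
/-- A maximal set of jobs of `Y` whose removal from `X` leaves load `h`, wherever there is any
of them. -/
noncomputable def leftoverAux (I : Inst ℝ n m) (h : ℝ) (X Y : List (Fin n)) : List (Fin n) :=
  Y.foldr (fun j D => if ∀ t ∈ I.interval j,
    I.load D.toFinset t + I.s j ≤ I.load X.toFinset t - h then j :: D else D) []

/-- The jobs of `X` that do not go to the first layer. -/
noncomputable def leftover (I : Inst ℝ n m) (h : ℝ) (X : List (Fin n)) : List (Fin n) :=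
  I.leftoverAux h X X

lemma leftoverAux_sublist (I : Inst ℝ n m) (h : ℝ) (X Y : List (Fin n)) :
    (I.leftoverAux h X Y).Sublist Y := by
  induction Y with
  | nil => exact List.Sublist.refl _
  | cons j Y ih =>
    unfold leftoverAux at ih ⊢
    rw [List.foldr_cons]
    split_ifs
    · exact ih.cons_cons j
    · exact ih.cons j

lemma leftoverAux_cons (I : Inst ℝ n m) (h : ℝ) (X Y : List (Fin n)) (j : Fin n) :
    (I.leftoverAux h X (j :: Y) = j :: I.leftoverAux h X Y ∧ ∀ t ∈ I.interval j,
      I.load (I.leftoverAux h X Y).toFinset t + I.s j ≤ I.load X.toFinset t - h) ∨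
    (I.leftoverAux h X (j :: Y) = I.leftoverAux h X Y ∧ ∃ t ∈ I.interval j,
      I.load X.toFinset t - h < I.load (I.leftoverAux h X Y).toFinset t + I.s j) := by
  unfold leftoverAux
  rw [List.foldr_cons]
  split_ifs with hc
  · exact Or.inl ⟨rfl, hc⟩
  · push Not at hc
    exact Or.inr ⟨rfl, hc⟩

/-- Inside the interval of an admitted job the bound is the admission test itself; outside it the
load does not change. The `0` covers times at which no job has been admitted. -/
lemma load_leftoverAux_le {I : Inst ℝ n m} (h : ℝ) (X : List (Fin n)) {Y : List (Fin n)}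
    (hY : Y.Nodup) (t : ℝ) :
    I.load (I.leftoverAux h X Y).toFinset t ≤ max (I.load X.toFinset t - h) 0 := by
  classical
  induction Y with
  | nil => simp [leftoverAux, load, activeIn, size]
  | cons j Y ih =>
    have hjY := (List.nodup_cons.1 hY).1
    rcases I.leftoverAux_cons h X Y j with ⟨h1, h2⟩ | ⟨h1, -⟩
    · rw [h1, List.toFinset_cons, load_insert]
      · split_ifs with ht
        · exact (h2 t ht).trans (le_max_left _ _)
        · rw [add_zero]
          exact ih (List.nodup_cons.1 hY).2
      · rw [List.mem_toFinset]
        exact fun h' => hjY ((I.leftoverAux_sublist h X Y).subset h')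
    · rw [h1]
      exact ih (List.nodup_cons.1 hY).2

/-- The admitted set only grows, so the time at which `j` failed the test remains a witness against
the final set. -/
lemma exists_witness {I : Inst ℝ n m} (hI : I.Valid) {h : ℝ} {X Y : List (Fin n)}
    {j : Fin n} (hj : j ∈ Y) (hj' : j ∉ I.leftoverAux h X Y) :
    ∃ t ∈ I.interval j,
      I.load X.toFinset t - h < I.load (I.leftoverAux h X Y).toFinset t + I.s j := by
  induction Y with
  | nil => simp at hj
  | cons i Y ih =>
    rcases I.leftoverAux_cons h X Y i with ⟨h1, -⟩ | ⟨h1, t, ht, h2⟩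
    · rw [h1] at hj' ⊢
      rw [List.mem_cons, not_or] at hj'
      obtain ⟨t, ht, h3⟩ := ih ((List.mem_cons.1 hj).resolve_left hj'.1) hj'.2
      refine ⟨t, ht, h3.trans_le ?_⟩
      gcongr
      refine load_mono hI ?_ t
      rw [List.toFinset_cons]
      exact Finset.subset_insert _ _
    · rw [h1] at hj' ⊢
      rcases List.mem_cons.1 hj with rfl | hj
      · exact ⟨t, ht, h2⟩
      · exact ih hj hj'

lemma leftover_sublist (I : Inst ℝ n m) (h : ℝ) (X : List (Fin n)) :
    (I.leftover h X).Sublist X := I.leftoverAux_sublist h X X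

/-- A job of the layer failed the admission test at some time of its interval, where the load of the
layer is below `h + s j ≤ 2 * h`. The splitting at `t` by witness times, as for leftover jobs of a
type, gives twice that at every time. With `h = g / 4` a layer fits on one machine. -/
lemma load_layer_lt {I : Inst ℝ n m} (hI : I.Valid) {h : ℝ} (hh : 0 < h) {X : List (Fin n)}
    (hs : ∀ j ∈ X, I.s j ≤ h) (t : ℝ) :
    I.load (X.toFinset \ (I.leftover h X).toFinset) t < 4 * h := by
  classical
  set Q := X.toFinset \ (I.leftover h X).toFinset with hQ
  have hsub : (I.leftover h X).toFinset ⊆ X.toFinset := by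
    intro j hj
    rw [List.mem_toFinset] at hj ⊢
    exact (I.leftover_sublist h X).subset hj
  have hwit : ∀ j ∈ Q, ∃ t ∈ I.interval j, I.load Q t < 2 * h := by
    intro j hj
    rw [hQ, Finset.mem_sdiff, List.mem_toFinset, List.mem_toFinset] at hj
    obtain ⟨t, ht, h1⟩ := exists_witness hI hj.1 hj.2
    have h2 := I.load_sdiff_add hsub t
    have h3 := hs j hj.1
    refine ⟨t, ht, ?_⟩
    rw [← hQ] at h2
    unfold leftover at h2
    linarith
  choose! f hf hf' using hwit
  set L := (I.activeIn Q t).filter fun j => f j ≤ t with hL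
  set R := (I.activeIn Q t).filter fun j => t ≤ f j with hR
  have hLQ : ∀ j ∈ L, j ∈ Q ∧ t ∈ I.interval j ∧ f j ≤ t := by
    intro j hj
    simpa [hL, mem_activeIn, and_assoc] using hj
  have hRQ : ∀ j ∈ R, j ∈ Q ∧ t ∈ I.interval j ∧ t ≤ f j := by
    intro j hj
    simpa [hR, mem_activeIn, and_assoc] using hj
  have h1 : I.size L < 2 * h := by
    rcases L.eq_empty_or_nonempty with h0 | hne
    · simpa [h0, size] using hh
    · obtain ⟨j, hj, hmax⟩ := Finset.exists_max_image L f hne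
      refine lt_of_le_of_lt (size_mono hI fun i hi => ?_) (hf' j (hLQ j hj).1)
      have hi' := hLQ i hi
      exact I.mem_activeIn.2 ⟨hi'.1, (hf i hi'.1).1.trans (hmax i hi),
        (hLQ j hj).2.2.trans_lt hi'.2.1.2⟩
  have h2 : I.size R < 2 * h := by
    rcases R.eq_empty_or_nonempty with h0 | hne
    · simpa [h0, size] using hh
    · obtain ⟨j, hj, hmin⟩ := Finset.exists_min_image R f hne
      refine lt_of_le_of_lt (size_mono hI fun i hi => ?_) (hf' j (hRQ j hj).1)
      have hi' := hRQ i hi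
      exact I.mem_activeIn.2 ⟨hi'.1, hi'.2.1.1.trans (hRQ j hj).2.2,
        (hmin i hi).trans_lt (hf i hi'.1).2⟩
  have h3 : I.load Q t ≤ I.size L + I.size R := by
    refine (size_mono hI fun j hj => ?_).trans (size_union_le hI L R)
    rw [Finset.mem_union]
    rcases le_total (f j) t with h | h
    · exact Or.inl (Finset.mem_filter.2 ⟨hj, h⟩)
    · exact Or.inr (Finset.mem_filter.2 ⟨hj, h⟩)
  linarith

/-- The jobs left after `k` layers. -/
noncomputable def layers (I : Inst ℝ n m) (h : ℝ) (X : List (Fin n)) (k : ℕ) : List (Fin n) :=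
  (I.leftover h)^[k] X

lemma layers_succ (I : Inst ℝ n m) (h : ℝ) (X : List (Fin n)) (k : ℕ) :
    I.layers h X (k + 1) = I.leftover h (I.layers h X k) :=
  Function.iterate_succ_apply' _ _ _

lemma layers_sublist (I : Inst ℝ n m) (h : ℝ) (X : List (Fin n)) (k : ℕ) :
    (I.layers h X k).Sublist X := by
  induction k with
  | zero => exact List.Sublist.refl _
  | succ k ih =>
    rw [layers_succ]
    exact (I.leftover_sublist h _).trans ih

lemma load_layers_le {I : Inst ℝ n m} {h : ℝ} (hh : 0 < h) {X : List (Fin n)}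
    (hX : X.Nodup) (k : ℕ) (t : ℝ) :
    I.load (I.layers h X k).toFinset t ≤ max (I.load X.toFinset t - k * h) 0 := by
  induction k with
  | zero => simp [layers]
  | succ k ih =>
    rw [layers_succ]
    refine (load_leftoverAux_le h _ (hX.sublist (I.layers_sublist h X k)) t).trans ?_
    refine max_le ?_ (le_max_right _ _)
    rcases le_max_iff.1 ih with h1 | h1
    · refine le_max_of_le_left ?_
      push_cast
      linarith
    · exact le_max_of_le_right (by linarith)

/-- If nothing were removed, the load at the arrival of a job would be positive and yet smaller than
itself by `h`. Hence `X.length` layers exhaust `X`. -/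
lemma length_leftover_lt {I : Inst ℝ n m} (hI : I.Valid) {h : ℝ} (hh : 0 < h)
    {X : List (Fin n)} (hX : X.Nodup) (hne : X ≠ []) : (I.leftover h X).length < X.length := by
  refine lt_of_le_of_ne (I.leftover_sublist h X).length_le fun heq => ?_
  have heq := (I.leftover_sublist h X).eq_of_length heq
  obtain ⟨j, hj⟩ := List.exists_mem_of_ne_nil X hne
  have h1 := load_leftoverAux_le (I := I) h X hX (I.arr j)
  have h2 : 0 < I.load X.toFinset (I.arr j) :=
    size_pos hI (I.mem_activeIn.2 ⟨List.mem_toFinset.2 hj, le_rfl, hI.arr_lt_dep j⟩)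
  change I.leftoverAux h X X = X at heq
  rw [heq] at h1
  rcases le_max_iff.1 h1 with h3 | h3 <;> linarith

lemma layers_length_le {I : Inst ℝ n m} (hI : I.Valid) {h : ℝ} (hh : 0 < h)
    {X : List (Fin n)} (hX : X.Nodup) (k : ℕ) :
    (I.layers h X k).length ≤ X.length - k := by
  induction k with
  | zero => exact le_rfl
  | succ k ih =>
    rw [layers_succ]
    by_cases hne : I.layers h X k = []
    · have := (I.leftover_sublist h (I.layers h X k)).length_le
      rw [hne] at this ⊢
      simp at this
      simp [this]
    · have := length_leftover_lt hI hh (hX.sublist (I.layers_sublist h X k)) hne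
      omega

open Classical in
/-- The index of the layer of `X` that contains the job. -/
noncomputable def layerIdx (I : Inst ℝ n m) (h : ℝ) (X : List (Fin n)) (j : Fin n) : ℕ :=
  ∑ k ∈ Finset.range X.length, if j ∈ I.layers h X (k + 1) then 1 else 0

/-- For a decreasing property, counting the positive indices where it holds finds the last one. The
layer index is defined by such a count because the program can accumulate it. -/
lemma sum_ite_of_antitone {P : ℕ → Prop} [DecidablePred P] (hP : ∀ i, P (i + 1) → P i) (h0 : P 0) {N : ℕ}
    (hN : ¬ P N) :
    P (∑ k ∈ Finset.range N, if P (k + 1) then 1 else 0) ∧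
      ¬ P ((∑ k ∈ Finset.range N, if P (k + 1) then 1 else 0) + 1) := by
  suffices H : ∀ N, (P N → (∑ k ∈ Finset.range N, if P (k + 1) then 1 else 0) = N) ∧
      P (∑ k ∈ Finset.range N, if P (k + 1) then 1 else 0) ∧
      (¬ P N → ¬ P ((∑ k ∈ Finset.range N, if P (k + 1) then 1 else 0) + 1)) from
    ⟨(H N).2.1, (H N).2.2 hN⟩
  intro N
  induction N with
  | zero => simp [h0]
  | succ N ih =>
    rw [Finset.sum_range_succ]
    by_cases h : P (N + 1)
    · rw [if_pos h, ih.1 (hP N h)]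
      exact ⟨fun _ => rfl, h, fun h' => absurd h h'⟩
    · rw [if_neg h, add_zero]
      refine ⟨fun h' => absurd h' h, ih.2.1, fun _ => ?_⟩
      by_cases h' : P N
      · rwa [ih.1 h']
      · exact ih.2.2 h'

lemma mem_layers_layerIdx {I : Inst ℝ n m} (hI : I.Valid) {h : ℝ} (hh : 0 < h)
    {X : List (Fin n)} (hX : X.Nodup) {j : Fin n} (hj : j ∈ X) :
    j ∈ I.layers h X (I.layerIdx h X j) ∧ j ∉ I.layers h X (I.layerIdx h X j + 1) := by
  refine sum_ite_of_antitone (P := fun i => j ∈ I.layers h X i) (fun i hi => ?_) hj ?_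
  · rw [layers_succ] at hi
    exact (I.leftover_sublist h _).subset hi
  · have := layers_length_le hI hh hX X.length
    rw [Nat.sub_self, Nat.le_zero, List.length_eq_zero_iff] at this
    simp [this]

/-! ## Schedules of the offline algorithm -/

open Classical in
/-- The jobs of `X` in increasing order. -/
noncomputable def sorted (X : Finset (Fin n)) : List (Fin n) :=
  (List.finRange n).filter (· ∈ X)

lemma mem_sorted {X : Finset (Fin n)} {j : Fin n} : j ∈ sorted X ↔ j ∈ X := by
  simp [sorted]

lemma nodup_sorted (X : Finset (Fin n)) : (sorted X).Nodup :=
  (List.nodup_finRange n).filter _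

lemma toFinset_sorted (X : Finset (Fin n)) : (sorted X).toFinset = X := by
  ext j
  simp [mem_sorted]

/-- The jobs of `X` that share machines of type `z`. -/
noncomputable def small (I : Inst ℝ n m) (X : Finset (Fin n)) (z : Fin m) : Finset (Fin n) :=
  X.filter fun j => I.s j ≤ I.g z / 4

open Classical in
/-- The number of the machine of type `z` that gets the job. -/
noncomputable def machine (I : Inst ℝ n m) (num : Fin n → ℕ) (X : Finset (Fin n)) (z : Fin m)
    (j : Fin n) : ℕ :=
  if I.s j ≤ I.g z / 4 then n + I.layerIdx (I.g z / 4) (sorted (I.small X z)) j else num j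

/-- The schedule with given types: large jobs have machines of their own, small ones are put
in layers. -/
noncomputable def layered (I : Inst ℝ n m) (num : Fin n → ℕ) (ty : Fin n → Fin m) : Sched n m :=
  fun j => (ty j, I.machine num (I.K (ty j)) (ty j) j)

section Layered

variable {I : Inst ℝ n m} {num : Fin n → ℕ} {ty : Fin n → Fin m}

lemma ty_eq_iff (hty : ∀ j, j ∈ I.K (ty j)) {z : Fin m} {j : Fin n} :
    ty j = z ↔ j ∈ I.K z :=
  ⟨fun h => h ▸ hty j, fun h => I.K_disjoint (hty j) h⟩

lemma mem_small {X : Finset (Fin n)} {z : Fin m} {j : Fin n} :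
    j ∈ I.small X z ↔ j ∈ X ∧ I.s j ≤ I.g z / 4 := by
  simp [small]

lemma feasible_layered (hI : I.Standard) (hty : ∀ j, j ∈ I.K (ty j))
    (hnum : Function.Injective num) (hlt : ∀ j, num j < n) :
    I.Feasible (I.layered num ty) := by
  classical
  have hV := hI.toValid
  rintro ⟨z, c⟩ t
  have hgz := hI.g_pos z
  have hjobs : ∀ j ∈ jobsOn (I.layered num ty) (z, c), j ∈ I.K z ∧
      I.machine num (I.K z) z j = c := by
    intro j hj
    simp only [jobsOn, layered, Finset.mem_filter, Finset.mem_univ, true_and,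
      Prod.mk.injEq] at hj
    obtain ⟨rfl, h⟩ := hj
    exact ⟨hty j, h⟩
  -- Numbers below `n` belong to single large jobs, numbers from `n` on to layers, so the two kinds
  -- never share a machine.
  by_cases hc : c < n
  · by_cases hne : ∃ i, i ∈ jobsOn (I.layered num ty) (z, c)
    · obtain ⟨i, hi⟩ := hne
      have hone : ∀ j ∈ jobsOn (I.layered num ty) (z, c), num j = c := by
        intro j hj
        have := (hjobs j hj).2
        unfold machine at this
        split_ifs at this
        · omega
        · exact this
      have hsub : I.activeIn (jobsOn (I.layered num ty) (z, c)) t ⊆ {i} := by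
        intro j hj
        rw [mem_activeIn] at hj
        rw [Finset.mem_singleton]
        exact hnum ((hone j hj.1).trans (hone i hi).symm)
      refine (size_mono hV hsub).trans ?_
      simpa [size] using fits_of_mem_K hI (hjobs i hi).1
    · have : jobsOn (I.layered num ty) (z, c) = ∅ :=
        Finset.eq_empty_iff_forall_notMem.2 fun j hj => hne ⟨j, hj⟩
      simpa [this, load, size, activeIn] using hgz.le
  · set X := sorted (I.small (I.K z) z) with hX
    have hh : 0 < I.g z / 4 := by linarith
    have hsub : jobsOn (I.layered num ty) (z, c) ⊆ (I.layers (I.g z / 4) X (c - n)).toFinset \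
        (I.leftover (I.g z / 4) (I.layers (I.g z / 4) X (c - n))).toFinset := by
      intro j hj
      obtain ⟨h1, h2⟩ := hjobs j hj
      unfold machine at h2
      split_ifs at h2 with h3
      · have h4 : c - n = I.layerIdx (I.g z / 4) X j := by
          rw [← h2, Nat.add_sub_cancel_left]
        rw [Finset.mem_sdiff, List.mem_toFinset, List.mem_toFinset, ← layers_succ, h4]
        exact mem_layers_layerIdx hV hh (nodup_sorted _)
          (mem_sorted.2 (mem_small.2 ⟨h1, h3⟩))
      · have := hlt j
        omega
    refine (load_mono hV hsub t).trans ?_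
    have := load_layer_lt hV hh (X := I.layers (I.g z / 4) X (c - n)) (fun j hj => ?_) t
    · linarith
    · have := (I.layers_sublist _ X _).subset hj
      exact (mem_small.1 (mem_sorted.1 this)).2

lemma isOffline_layered (hI : I.Standard) (hty : ∀ j, j ∈ I.K (ty j))
    (hnum : Function.Injective num) (hlt : ∀ j, num j < n) :
    I.IsOffline (I.layered num ty) :=
  ⟨feasible_layered hI hty hnum hlt, fun _ _ => ty_eq_iff hty⟩

/-- With `h = g / 4`, each large job accounts for more than `h` of load. Every layer lowers the load
of the small jobs by `h` while any is left, so at most `⌈S / h⌉` layers are active. The total is at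
most `⌈4 * load / g⌉`. -/
lemma dualColoringBound_layered (hI : I.Standard) (hty : ∀ j, j ∈ I.K (ty j)) :
    I.DualColoringBound (I.layered num ty) := by
  classical
  intro z t
  have hV := hI.toValid
  have hgz := hI.g_pos z
  set h := I.g z / 4 with hdef
  have hh : 0 < h := by rw [hdef]; linarith
  set X := sorted (I.small (I.K z) z) with hX
  set B := (I.activeIn (I.K z) t).filter fun j => ¬ I.s j ≤ h with hB
  set S := I.load (I.small (I.K z) z) t with hS
  have hsub : ((I.activeIn Finset.univ t).image (I.layered num ty)).filter (fun M => M.1 = z) ⊆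
      B.image (fun j => (z, num j)) ∪
        (Finset.range ⌈S / h⌉₊).image fun k => (z, n + k) := by
    intro M hM
    rw [Finset.mem_filter, Finset.mem_image] at hM
    obtain ⟨⟨j, hj, rfl⟩, rfl⟩ := hM
    have hjt := (I.mem_activeIn.1 hj).2
    have hjK := hty j
    rw [Finset.mem_union, Finset.mem_image, Finset.mem_image]
    change j ∈ I.K (I.layered num ty j).1 at hjK
    set z := (I.layered num ty j).1
    have hmach : (I.layered num ty j) = (z, I.machine num (I.K z) z j) := rfl
    rw [hmach]
    unfold machine
    split_ifs with hs
    · right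
      refine ⟨I.layerIdx h X j, ?_, rfl⟩
      have hm := (mem_layers_layerIdx hV hh (nodup_sorted _)
        (mem_sorted.2 (mem_small.2 ⟨hjK, hs⟩))).1
      -- An active job of layer `k` makes the load left after `k` layers positive, so `k * h < S`.
      have h1 := load_layers_le (I := I) hh (nodup_sorted (I.small (I.K z) z))
        (I.layerIdx h X j) t
      have h2 : 0 < I.load (I.layers h X (I.layerIdx h X j)).toFinset t :=
        size_pos hV (I.mem_activeIn.2 ⟨List.mem_toFinset.2 hm, hjt⟩)
      rw [toFinset_sorted] at h1
      rw [Finset.mem_range, Nat.lt_ceil, lt_div_iff₀ hh]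
      rcases le_max_iff.1 h1 with h3 | h3 <;> linarith
    · left
      refine ⟨j, ?_, rfl⟩
      rw [hB, Finset.mem_filter, mem_activeIn]
      exact ⟨⟨hjK, hjt⟩, hs⟩
  have hcard : I.busy (I.layered num ty) z t ≤ B.card + ⌈S / h⌉₊ := by
    refine (Finset.card_le_card hsub).trans ((Finset.card_union_le _ _).trans ?_)
    refine add_le_add Finset.card_image_le ?_
    simpa using Finset.card_image_le (s := Finset.range ⌈S / h⌉₊) (f := fun k => (z, n + k))
  have hSnn : 0 ≤ S := load_nonneg hV _ _
  have hBsize : (B.card : ℝ) * h ≤ I.size B := by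
    rw [size, ← nsmul_eq_mul]
    refine Finset.card_nsmul_le_sum _ _ _ fun j hj => ?_
    exact (not_le.1 (Finset.mem_filter.1 hj).2).le
  have hsum : I.size B + S = I.load (I.K z) t := by
    rw [hS, load, load, size, size, size,
      ← Finset.sum_filter_not_add_sum_filter (I.activeIn (I.K z) t) (fun j => I.s j ≤ h)]
    congr 2
    ext j
    simp only [mem_activeIn, mem_small, Finset.mem_filter]
    tauto
  have h1 : ((B.card : ℤ) + ⌈S / h⌉) ≤ ⌈4 * (I.load (I.K z) t / I.g z)⌉ := by
    rw [← Int.ceil_natCast_add]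
    refine Int.ceil_mono ?_
    have : 4 * (I.load (I.K z) t / I.g z) = (I.size B + S) / h := by
      rw [hsum, hdef]
      field_simp
    rw [this, add_div]
    gcongr
    rwa [le_div_iff₀ hh]
  have h2 : ⌈4 * (I.load (I.K z) t / I.g z)⌉ ≤ 4 * ⌈I.load (I.K z) t / I.g z⌉ := by
    rw [Int.ceil_le]
    push_cast
    have := Int.le_ceil (I.load (I.K z) t / I.g z)
    linarith
  have h3 : ((⌈S / h⌉₊ : ℕ) : ℤ) = ⌈S / h⌉ := Int.natCast_ceil_eq_ceil (by positivity)
  have h4 : (I.busy (I.layered num ty) z t : ℤ) ≤ B.card + ⌈S / h⌉ := by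
    rw [← h3]
    exact_mod_cast hcard
  exact h4.trans (h1.trans h2)

end Layered

lemma exists_offline {I : Inst ℝ n m} (hI : I.Standard) :
    ∃ σ : Sched n m, I.IsOffline σ ∧ I.DualColoringBound σ := by
  choose ty hty using exists_mem_K hI.toValid
  exact ⟨I.layered (fun j => j) ty, isOffline_layered hI hty Fin.val_injective fun j => j.2,
    dualColoringBound_layered hI hty⟩

end Inst
end BSHM

/-! ### Renaming in programs, and bit sizes under arithmetic -/

namespace BSHM

/-! ## Renaming of variables -/

/-- A renaming under a binder. -/
def liftRen {Γ Δ : List Ty} {c : Ty} (f : ∀ b, Var Γ b → Var Δ b) :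
    ∀ b, Var (c :: Γ) b → Var (c :: Δ) b
  | _, .zero => .zero
  | _, .succ x => .succ (f _ x)

/-- Renaming the variables of a term. -/
def Tm.rename : {Γ Δ : List Ty} → {a : Ty} → (∀ b, Var Γ b → Var Δ b) → Tm Γ a → Tm Δ a
  | _, _, _, f, .var x => .var (f _ x)
  | _, _, _, f, .letIn u v => .letIn (u.rename f) (v.rename (liftRen f))
  | _, _, _, _, .lit q => .lit q
  | _, _, _, f, .op o u v => .op o (u.rename f) (v.rename f)
  | _, _, _, f, .floor u => .floor (u.rename f)
  | _, _, _, f, .bits u => .bits (u.rename f)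
  | _, _, _, f, .le u v => .le (u.rename f) (v.rename f)
  | _, _, _, f, .ite c u v => .ite (c.rename f) (u.rename f) (v.rename f)
  | _, _, _, f, .pair u v => .pair (u.rename f) (v.rename f)
  | _, _, _, f, .fst u => .fst (u.rename f)
  | _, _, _, f, .snd u => .snd (u.rename f)
  | _, _, _, _, .nil => .nil
  | _, _, _, f, .cons u v => .cons (u.rename f) (v.rename f)
  | _, _, _, f, .cases l u v => .cases (l.rename f) (u.rename f) (v.rename (liftRen (liftRen f)))
  | _, _, _, f, .fold l u v => .fold (l.rename f) (u.rename f) (v.rename (liftRen (liftRen f)))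

lemma get_liftRen {Γ Δ : List Ty} {f : ∀ b, Var Γ b → Var Δ b} {ρ : Env Γ} {ρ' : Env Δ}
    (h : ∀ b (x : Var Γ b), (f b x).get ρ' = x.get ρ) {c : Ty} (v : c.Val) (b : Ty)
    (x : Var (c :: Γ) b) :
    (liftRen f b x).get (Γ := c :: Δ) (v, ρ') = x.get (Γ := c :: Γ) (v, ρ) := by
  cases x with
  | zero => rfl
  | succ x => exact h _ x

/-- Both the value and the step count are unchanged, so a program can be reused under binders
without cost. -/
lemma eval_rename {Γ : List Ty} {a : Ty} (t : Tm Γ a) :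
    ∀ {Δ : List Ty} (f : ∀ b, Var Γ b → Var Δ b) (ρ : Env Γ) (ρ' : Env Δ),
      (∀ b (x : Var Γ b), (f b x).get ρ' = x.get ρ) → (t.rename f).eval ρ' = t.eval ρ := by
  induction t with
  | var x =>
    intro Δ f ρ ρ' h
    simp [Tm.rename, Tm.eval, h]
  | letIn u v ihu ihv =>
    intro Δ f ρ ρ' h
    simp only [Tm.rename, Tm.eval]
    rw [ihu f ρ ρ' h, ihv (liftRen f) (_, ρ) (_, ρ') (get_liftRen h _)]
  | lit q =>
    intro Δ f ρ ρ' h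
    simp [Tm.rename, Tm.eval]
  | op o u v ihu ihv =>
    intro Δ f ρ ρ' h
    simp only [Tm.rename, Tm.eval]
    rw [ihu f ρ ρ' h, ihv f ρ ρ' h]
  | floor u ihu =>
    intro Δ f ρ ρ' h
    simp only [Tm.rename, Tm.eval]
    rw [ihu f ρ ρ' h]
  | bits u ihu =>
    intro Δ f ρ ρ' h
    simp only [Tm.rename, Tm.eval]
    rw [ihu f ρ ρ' h]
  | le u v ihu ihv =>
    intro Δ f ρ ρ' h
    simp only [Tm.rename, Tm.eval]
    rw [ihu f ρ ρ' h, ihv f ρ ρ' h]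
  | ite c u v ihc ihu ihv =>
    intro Δ f ρ ρ' h
    simp only [Tm.rename, Tm.eval]
    rw [ihc f ρ ρ' h, ihu f ρ ρ' h, ihv f ρ ρ' h]
  | pair u v ihu ihv =>
    intro Δ f ρ ρ' h
    simp only [Tm.rename, Tm.eval]
    rw [ihu f ρ ρ' h, ihv f ρ ρ' h]
  | fst u ihu =>
    intro Δ f ρ ρ' h
    simp only [Tm.rename, Tm.eval]
    rw [ihu f ρ ρ' h]
  | snd u ihu =>
    intro Δ f ρ ρ' h
    simp only [Tm.rename, Tm.eval]
    rw [ihu f ρ ρ' h]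
  | nil =>
    intro Δ f ρ ρ' h
    simp [Tm.rename, Tm.eval]
  | cons u v ihu ihv =>
    intro Δ f ρ ρ' h
    simp only [Tm.rename, Tm.eval]
    rw [ihu f ρ ρ' h, ihv f ρ ρ' h]
  | cases l u v ihl ihu ihv =>
    intro Δ f ρ ρ' h
    simp only [Tm.rename, Tm.eval]
    rw [ihl f ρ ρ' h, ihu f ρ ρ' h]
    have : ∀ x y, (v.rename (liftRen (liftRen f))).eval (x, y, ρ') = v.eval (x, y, ρ) :=
      fun x y => ihv _ _ _ (get_liftRen (get_liftRen h y) x)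
    simp only [this]
  | fold l u v ihl ihu ihv =>
    intro Δ f ρ ρ' h
    simp only [Tm.rename, Tm.eval]
    rw [ihl f ρ ρ' h, ihu f ρ ρ' h]
    have : ∀ x y, (v.rename (liftRen (liftRen f))).eval (x, y, ρ') = v.eval (x, y, ρ) :=
      fun x y => ihv _ _ _ (get_liftRen (get_liftRen h y) x)
    simp only [this]

/-- The only variable of a context of length one, in a longer context. -/
def topRen {Γ : List Ty} {c : Ty} : ∀ b, Var [c] b → Var (c :: Γ) b
  | _, .zero => .zero

lemma eval_topRen {Γ : List Ty} {a c : Ty} (t : Tm [c] a) (v : c.Val) (ρ : Env Γ) :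
    (t.rename (topRen (Γ := Γ))).eval (Γ := c :: Γ) (v, ρ) = t.eval (Γ := [c]) (v, ()) := by
  refine eval_rename t _ _ _ fun b x => ?_
  cases x with
  | zero => rfl
  | succ x => cases x

/-! ## Sizes of values -/

/-- The size of a value. -/
def Ty.size : (a : Ty) → a.Val → ℕ
  | .num, q => max (Nat.size (Rat.num q).natAbs) (Nat.size (Rat.den q))
  | .bool, _ => 1
  | .prod a b, p => a.size p.1 + b.size p.2 + 1
  | .list a, l => (List.map (fun x => a.size x + 1) l).sum + 1

/-- Types whose elements are represented by values. -/
class Rep (A : Type) where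
  ty : Ty
  enc : A → ty.Val

instance : Rep ℚ := ⟨.num, fun q => q⟩
instance : Rep Bool := ⟨.bool, fun b => b⟩
instance {A B : Type} [Rep A] [Rep B] : Rep (A × B) :=
  ⟨.prod (Rep.ty A) (Rep.ty B), fun p => (Rep.enc p.1, Rep.enc p.2)⟩
instance {A : Type} [Rep A] : Rep (List A) := ⟨.list (Rep.ty A), fun l => l.map Rep.enc⟩

variable {A B C : Type} [Rep A] [Rep B] [Rep C]

/-- The size of the representation. -/
def sz (x : A) : ℕ := (Rep.ty A).size (Rep.enc x)

lemma sz_num (q : ℚ) : sz q = max q.num.natAbs.size q.den.size := rfl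

lemma sz_bool (b : Bool) : sz b = 1 := rfl

lemma sz_prod (p : A × B) : sz p = sz p.1 + sz p.2 + 1 := rfl

lemma sz_list (l : List A) : sz l = (l.map fun x => sz x + 1).sum + 1 := by
  change (List.map _ (l.map Rep.enc)).sum + 1 = _
  rw [List.map_map]
  rfl

lemma sz_nil : sz ([] : List A) = 1 := rfl

lemma sz_cons (a : A) (l : List A) : sz (a :: l) = sz a + 1 + sz l := by
  simp [sz_list, add_assoc]

lemma length_lt_sz (l : List A) : l.length < sz l := by
  induction l with
  | nil => simp [sz_nil]
  | cons a l ih =>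
    rw [sz_cons, List.length_cons]
    omega

lemma sz_le_of_sublist {l l' : List A} (h : l.Sublist l') : sz l ≤ sz l' := by
  induction h with
  | slnil => exact le_rfl
  | cons a _ ih =>
    rw [sz_cons]
    omega
  | cons_cons a _ ih =>
    rw [sz_cons, sz_cons]
    omega

lemma sz_lt_of_mem {a : A} {l : List A} (h : a ∈ l) : sz a < sz l := by
  have := sz_le_of_sublist (List.singleton_sublist.2 h)
  rw [sz_cons, sz_nil] at this
  omega

lemma numSize_le (q : ℚ) : numSize q ≤ 2 * sz q := by
  rw [sz_num, numSize]
  omega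

lemma sz_le_numSize (q : ℚ) : sz q ≤ numSize q := by
  rw [sz_num, numSize]
  omega

lemma sz_num_le {q : ℚ} {k : ℕ} : sz q ≤ k ↔ q.num.natAbs < 2 ^ k ∧ q.den < 2 ^ k := by
  rw [sz_num, max_le_iff, Nat.size_le, Nat.size_le]

lemma lt_two_pow_sz (q : ℚ) : q.num.natAbs < 2 ^ sz q ∧ q.den < 2 ^ sz q := sz_num_le.1 le_rfl

/-- Reduction to lowest terms replaces numerator and denominator by divisors, so bounds for an
unreduced fraction suffice. The numerator 0 is separate because it has no bounding divisor property.
-/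
lemma sz_divInt_le {a b : ℤ} (hb : b ≠ 0) {k : ℕ} (ha : a.natAbs < 2 ^ k)
    (hb' : b.natAbs < 2 ^ k) : sz (Rat.divInt a b) ≤ k := by
  rw [sz_num_le]
  by_cases ha0 : a = 0
  · subst ha0
    rw [Rat.zero_divInt]
    exact ⟨by simp, lt_of_le_of_lt (Int.natAbs_pos.2 hb) hb'⟩
  constructor
  · exact lt_of_le_of_lt (Nat.le_of_dvd (Int.natAbs_pos.2 ha0)
      (Int.natAbs_dvd_natAbs.2 (Rat.num_dvd a hb))) ha
  · refine lt_of_le_of_lt (Nat.le_of_dvd (Int.natAbs_pos.2 hb) ?_) hb'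
    have := Int.natAbs_dvd_natAbs.2 (Rat.den_dvd a b)
    simpa using this

lemma sz_add_le (x y : ℚ) : sz (x + y) ≤ sz x + sz y + 1 := by
  obtain ⟨hx, hx'⟩ := lt_two_pow_sz x
  obtain ⟨hy, hy'⟩ := lt_two_pow_sz y
  have hpow : 2 ^ (sz x + sz y + 1) = 2 ^ sz x * 2 ^ sz y + 2 ^ sz x * 2 ^ sz y := by
    rw [pow_succ, pow_add]
    ring
  have hden : x.den * y.den < 2 ^ sz x * 2 ^ sz y := Nat.mul_lt_mul'' hx' hy'
  have h1 : x + y = Rat.divInt (x.num * y.den + y.num * x.den) (x.den * y.den) := by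
    conv_lhs => rw [← Rat.num_divInt_den x, ← Rat.num_divInt_den y]
    exact Rat.divInt_add_divInt _ _ (by exact_mod_cast x.den_ne_zero)
      (by exact_mod_cast y.den_ne_zero)
  rw [h1]
  refine sz_divInt_le (by exact_mod_cast mul_ne_zero x.den_ne_zero y.den_ne_zero) ?_ ?_
  · rw [hpow]
    refine lt_of_le_of_lt (Int.natAbs_add_le _ _) (add_lt_add ?_ ?_)
    · rw [Int.natAbs_mul]
      exact Nat.mul_lt_mul'' hx hy'
    · rw [Int.natAbs_mul, mul_comm]
      exact Nat.mul_lt_mul'' hx' hy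
  · rw [hpow, ← Nat.cast_mul, Int.natAbs_natCast]
    omega

lemma sz_neg (x : ℚ) : sz (-x) = sz x := by
  simp [sz_num]

lemma sz_sub_le (x y : ℚ) : sz (x - y) ≤ sz x + sz y + 1 := by
  rw [sub_eq_add_neg, ← sz_neg y]
  exact sz_add_le _ _

lemma sz_mul_le (x y : ℚ) : sz (x * y) ≤ sz x + sz y := by
  obtain ⟨hx, hx'⟩ := lt_two_pow_sz x
  obtain ⟨hy, hy'⟩ := lt_two_pow_sz y
  have h1 : x * y = Rat.divInt (x.num * y.num) (x.den * y.den) := by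
    conv_lhs => rw [← Rat.num_divInt_den x, ← Rat.num_divInt_den y]
    exact Rat.divInt_mul_divInt _ _
  rw [h1]
  refine sz_divInt_le (by exact_mod_cast mul_ne_zero x.den_ne_zero y.den_ne_zero) ?_ ?_
  · rw [Int.natAbs_mul, pow_add]
    exact Nat.mul_lt_mul'' hx hy
  · rw [← Nat.cast_mul, Int.natAbs_natCast, pow_add]
    exact Nat.mul_lt_mul'' hx' hy'

lemma one_le_sz (x : ℚ) : 1 ≤ sz x := by
  have h := (lt_two_pow_sz x).2
  have := x.den_pos
  by_contra hc
  have : sz x = 0 := by omega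
  rw [this, pow_zero] at h
  omega

lemma sz_inv_le (x : ℚ) : sz x⁻¹ ≤ sz x := by
  by_cases h : x = 0
  · simp [h]
  · obtain ⟨hx, hx'⟩ := lt_two_pow_sz x
    rw [Rat.inv_def]
    exact sz_divInt_le (by simpa using h) (by simpa using hx') hx

lemma sz_div_le (x y : ℚ) : sz (x / y) ≤ sz x + sz y := by
  rw [div_eq_mul_inv]
  exact (sz_mul_le _ _).trans (Nat.add_le_add_left (sz_inv_le y) _)

lemma sz_floor_le (x : ℚ) : sz ((⌊x⌋ : ℤ) : ℚ) ≤ sz x + 1 := by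
  obtain ⟨hx, hx'⟩ := lt_two_pow_sz x
  have hden := x.den_pos
  rw [sz_num_le]
  have hle : ⌊x⌋.natAbs ≤ x.num.natAbs + 1 := by
    rw [Rat.floor_def']
    have h1 := Int.natAbs_ediv_le_natAbs x.num x.den
    omega
  have h2 : 2 ^ (sz x + 1) = 2 ^ sz x + 2 ^ sz x := by ring
  have h3 : 0 < 2 ^ sz x := by positivity
  simp only [Rat.num_intCast, Rat.den_intCast]
  omega

lemma natFloor_lt (x : ℚ) : ⌊|x|⌋₊ < 2 ^ sz x := by
  obtain ⟨hx, hx'⟩ := lt_two_pow_sz x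
  refine lt_of_le_of_lt ?_ hx
  have h1 : |x| ≤ x.num.natAbs := by
    conv_lhs => rw [← Rat.num_div_den x]
    rw [abs_div, Nat.abs_cast, Nat.cast_natAbs, Int.cast_abs]
    exact div_le_self (abs_nonneg _) (by exact_mod_cast x.den_pos)
  exact Nat.floor_le_of_le h1

lemma sz_natCast_le {k l : ℕ} (h : k < 2 ^ l) (hl : 0 < l) : sz (k : ℚ) ≤ l := by
  rw [sz_num_le]
  simp only [Rat.num_natCast, Int.natAbs_natCast, Rat.den_natCast]
  exact ⟨h, Nat.one_lt_two_pow hl.ne'⟩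

end BSHM

/-! ### A calculus of polynomial-time functions -/

namespace BSHM

variable {A B C D : Type} [Rep A] [Rep B] [Rep C] [Rep D]

/-! ## Polynomially bounded functions -/

lemma eval_mono (p : Polynomial ℕ) : Monotone fun s => p.eval s := by
  intro s t h
  simp only [Polynomial.eval_eq_sum_range]
  exact Finset.sum_le_sum fun i _ => Nat.mul_le_mul_left _ (Nat.pow_le_pow_left h i)

/-- `f` is bounded by a polynomial in the size of the argument. -/
def PolyBdd (f : A → ℕ) : Prop := ∃ p : Polynomial ℕ, ∀ x, f x ≤ p.eval (sz x)

namespace PolyBdd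

lemma mono {f g : A → ℕ} (hg : PolyBdd g) (h : ∀ x, f x ≤ g x) : PolyBdd f := by
  obtain ⟨p, hp⟩ := hg
  exact ⟨p, fun x => (h x).trans (hp x)⟩

lemma const (k : ℕ) : PolyBdd fun _ : A => k := ⟨Polynomial.C k, fun x => by simp⟩

lemma size : PolyBdd fun x : A => sz x := ⟨Polynomial.X, fun x => by simp⟩

lemma add {f g : A → ℕ} (hf : PolyBdd f) (hg : PolyBdd g) : PolyBdd fun x => f x + g x := by
  obtain ⟨p, hp⟩ := hf
  obtain ⟨q, hq⟩ := hg
  exact ⟨p + q, fun x => by simpa using add_le_add (hp x) (hq x)⟩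

lemma mul {f g : A → ℕ} (hf : PolyBdd f) (hg : PolyBdd g) : PolyBdd fun x => f x * g x := by
  obtain ⟨p, hp⟩ := hf
  obtain ⟨q, hq⟩ := hg
  exact ⟨p * q, fun x => by simpa using mul_le_mul' (hp x) (hq x)⟩

lemma sq {f : A → ℕ} (hf : PolyBdd f) : PolyBdd fun x => f x ^ 2 := by
  simpa only [_root_.sq] using hf.mul hf

lemma evalComp (p : Polynomial ℕ) {f : A → ℕ} (hf : PolyBdd f) :
    PolyBdd fun x => p.eval (f x) := by
  obtain ⟨q, hq⟩ := hf
  exact ⟨p.comp q, fun x => by simpa [Polynomial.eval_comp] using eval_mono p (hq x)⟩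

lemma comp {g : B → ℕ} {f : A → B} (hg : PolyBdd g) (hf : PolyBdd fun x => sz (f x)) :
    PolyBdd fun x => g (f x) := by
  obtain ⟨p, hp⟩ := hg
  exact (evalComp p hf).mono fun x => hp (f x)

/-- A bound that is uniform over the members of a list. -/
lemma of_mem {g : A × B → ℕ} (hg : PolyBdd g) {l : A → List B}
    (hl : PolyBdd fun x => sz (l x)) :
    ∃ q : Polynomial ℕ, ∀ x, ∀ b ∈ l x, g (x, b) ≤ q.eval (sz x) := by
  obtain ⟨p, hp⟩ := hg
  obtain ⟨q, hq⟩ := evalComp p ((size (A := A)).add (hl.add (const 1)))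
  refine ⟨q, fun x b hb => (hp _).trans (le_trans (eval_mono p ?_) (hq x))⟩
  have := sz_lt_of_mem hb
  rw [sz_prod]
  dsimp only
  omega

end PolyBdd

/-! ## Functions computed by programs in polynomial time -/

/-- `f` is computed by a program in polynomial time. -/
@[fun_prop]
def PT (f : A → B) : Prop :=
  ∃ t : Tm [Rep.ty A] (Rep.ty B), (∀ x, (t.eval (Rep.enc x, ())).1 = Rep.enc (f x)) ∧
    PolyBdd (fun x => (t.eval (Rep.enc x, ())).2) ∧ PolyBdd fun x => sz (f x)

namespace PT

lemma size {f : A → B} (h : PT f) : PolyBdd fun x => sz (f x) := by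
  obtain ⟨-, -, -, h⟩ := h
  exact h

@[fun_prop]
lemma id : PT fun x : A => x :=
  ⟨.var .zero, fun _ => rfl, PolyBdd.const 1, PolyBdd.size⟩

-- The size bound on outputs in `PT` is what makes the cost of the second program polynomial in the
-- original input.
@[fun_prop]
lemma comp {g : B → C} {f : A → B} (hg : PT g) (hf : PT f) : PT fun x => g (f x) := by
  obtain ⟨t, ht, ht', ht''⟩ := hf
  obtain ⟨u, hu, hu', hu''⟩ := hg
  have h : ∀ x : A, (Tm.letIn t (u.rename topRen)).eval (Rep.enc x, ()) =
      (Rep.enc (g (f x)), (t.eval (Rep.enc x, ())).2 + (u.eval (Rep.enc (f x), ())).2 + 1) := by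
    intro x
    rw [Tm.eval, eval_topRen, ht, ← hu]
  refine ⟨.letIn t (u.rename topRen), fun x => by rw [h], ?_, hu''.comp ht''⟩
  exact ((ht'.add (hu'.comp ht'')).add (PolyBdd.const 1)).mono fun x => by rw [h]

@[fun_prop]
lemma pair {f : A → B} {g : A → C} (hf : PT f) (hg : PT g) : PT fun x => (f x, g x) := by
  obtain ⟨t, ht, ht', ht''⟩ := hf
  obtain ⟨u, hu, hu', hu''⟩ := hg
  refine ⟨.pair t u, fun x => ?_, (ht'.add hu').add (PolyBdd.const 1),
    (ht''.add hu'').add (PolyBdd.const 1)⟩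
  simp only [Tm.eval, ht, hu]
  rfl

@[fun_prop]
lemma fst {f : A → B × C} (hf : PT f) : PT fun x => (f x).1 := by
  obtain ⟨t, ht, ht', ht''⟩ := hf
  refine ⟨.fst t, fun x => ?_, ht'.add (PolyBdd.const 1), ht''.mono fun x => ?_⟩
  · simp only [Tm.eval, ht]
    rfl
  · dsimp only
    rw [sz_prod (f x)]
    omega

@[fun_prop]
lemma snd {f : A → B × C} (hf : PT f) : PT fun x => (f x).2 := by
  obtain ⟨t, ht, ht', ht''⟩ := hf
  refine ⟨.snd t, fun x => ?_, ht'.add (PolyBdd.const 1), ht''.mono fun x => ?_⟩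
  · simp only [Tm.eval, ht]
    rfl
  · dsimp only
    rw [sz_prod (f x)]
    omega

lemma lit (q : ℚ) : PT fun _ : A => q :=
  ⟨.lit q, fun _ => rfl, PolyBdd.const _, PolyBdd.const _⟩

lemma polyBdd_sq {f g : A → ℚ} (hf : PT f) (hg : PT g) :
    PolyBdd fun x => (numSize (f x) + numSize (g x)) ^ 2 :=
  ((((PolyBdd.const 2).mul hf.size).mono fun x => numSize_le (f x)).add
    (((PolyBdd.const 2).mul hg.size).mono fun x => numSize_le (g x))).sq

lemma op (o : Op) (ho : ∀ x y, sz (o.apply x y) ≤ sz x + sz y + 1) {f g : A → ℚ} (hf : PT f)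
    (hg : PT g) : PT fun x => o.apply (f x) (g x) := by
  have hsq := polyBdd_sq hf hg
  obtain ⟨t, ht, ht', ht''⟩ := hf
  obtain ⟨u, hu, hu', hu''⟩ := hg
  refine ⟨.op o t u, fun x => ?_,
    (((ht'.add hu').add hsq).add (PolyBdd.const 1)).mono fun x => ?_,
    ((ht''.add hu'').add (PolyBdd.const 1)).mono fun x => ho _ _⟩
  · simp only [Tm.eval, ht, hu]
    rfl
  · simp only [Tm.eval, ht, hu]
    exact le_rfl

@[fun_prop]
lemma add {f g : A → ℚ} (hf : PT f) (hg : PT g) : PT fun x => f x + g x :=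
  op .add sz_add_le hf hg

@[fun_prop]
lemma sub {f g : A → ℚ} (hf : PT f) (hg : PT g) : PT fun x => f x - g x :=
  op .sub sz_sub_le hf hg

@[fun_prop]
lemma mul {f g : A → ℚ} (hf : PT f) (hg : PT g) : PT fun x => f x * g x :=
  op .mul (fun x y => (sz_mul_le x y).trans (Nat.le_succ _)) hf hg

@[fun_prop]
lemma div {f g : A → ℚ} (hf : PT f) (hg : PT g) : PT fun x => f x / g x :=
  op .div (fun x y => (sz_div_le x y).trans (Nat.le_succ _)) hf hg

@[fun_prop]
lemma neg {f : A → ℚ} (hf : PT f) : PT fun x => -f x := by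
  simpa using (lit 0).sub hf

lemma polyBdd_numSize_sq {f : A → ℚ} (hf : PT f) : PolyBdd fun x => numSize (f x) ^ 2 :=
  (((PolyBdd.const 2).mul hf.size).mono fun x => numSize_le (f x)).sq

@[fun_prop]
lemma floor {f : A → ℚ} (hf : PT f) : PT fun x => ((⌊f x⌋ : ℤ) : ℚ) := by
  have hsq := polyBdd_numSize_sq hf
  obtain ⟨t, ht, ht', ht''⟩ := hf
  refine ⟨.floor t, fun x => ?_, ((ht'.add hsq).add (PolyBdd.const 1)).mono fun x => ?_,
    (ht''.add (PolyBdd.const 1)).mono fun x => sz_floor_le _⟩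
  · simp only [Tm.eval, ht]
    rfl
  · simp only [Tm.eval, ht]
    exact le_rfl

@[fun_prop]
lemma ceil {f : A → ℚ} (hf : PT f) : PT fun x => ((⌈f x⌉ : ℤ) : ℚ) := by
  have : (fun x => ((⌈f x⌉ : ℤ) : ℚ)) = fun x => -((⌊-f x⌋ : ℤ) : ℚ) := by
    funext x
    rw [Int.floor_neg]
    push_cast
    ring
  rw [this]
  exact hf.neg.floor.neg

@[fun_prop]
lemma bits {f : A → ℚ} (hf : PT f) : PT fun x => Nat.bits ⌊|f x|⌋₊ := by
  have hsq := polyBdd_numSize_sq hf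
  obtain ⟨t, ht, ht', ht''⟩ := hf
  refine ⟨.bits t, fun x => ?_, ((ht'.add hsq).add (PolyBdd.const 1)).mono fun x => ?_,
    (((PolyBdd.const 2).mul ht'').add (PolyBdd.const 1)).mono fun x => ?_⟩
  · simp only [Tm.eval, ht]
    change Nat.bits ⌊|f x|⌋₊ = (Nat.bits ⌊|f x|⌋₊).map fun b => b
    rw [List.map_id']
  · simp only [Tm.eval, ht]
    exact le_rfl
  · have h1 : (Nat.bits ⌊|f x|⌋₊).length ≤ sz (f x) := by
      rw [Nat.size_eq_bits_len, Nat.size_le]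
      exact natFloor_lt _
    rw [sz_list]
    simp only [sz_bool, List.map_const', List.sum_replicate, smul_eq_mul]
    omega

@[fun_prop]
lemma le {f g : A → ℚ} (hf : PT f) (hg : PT g) : PT fun x => decide (f x ≤ g x) := by
  have hsq := polyBdd_sq hf hg
  obtain ⟨t, ht, ht', ht''⟩ := hf
  obtain ⟨u, hu, hu', hu''⟩ := hg
  refine ⟨.le t u, fun x => ?_,
    (((ht'.add hu').add hsq).add (PolyBdd.const 1)).mono fun x => ?_, PolyBdd.const 1⟩
  · simp only [Tm.eval, ht, hu]
    rfl
  · simp only [Tm.eval, ht, hu]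
    exact le_rfl

@[fun_prop]
lemma cond {c : A → Bool} {f g : A → B} (hc : PT c) (hf : PT f) (hg : PT g) :
    PT fun x => bif c x then f x else g x := by
  obtain ⟨r, hr, hr', -⟩ := hc
  obtain ⟨t, ht, ht', ht''⟩ := hf
  obtain ⟨u, hu, hu', hu''⟩ := hg
  refine ⟨.ite r t u, fun x => ?_, (((hr'.add ht').add hu').add (PolyBdd.const 1)).mono fun x => ?_,
    (ht''.add hu'').mono fun x => ?_⟩
  · simp only [Tm.eval, hr]
    change (bif c x then _ else _ : _ × ℕ).1 = _
    cases c x <;> simp [ht, hu]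
  · simp only [Tm.eval, hr]
    change _ + (bif c x then _ else _ : _ × ℕ).2 + 1 ≤ _
    cases c x <;> simp
  · dsimp only
    cases c x <;> simp

lemma true : PT fun _ : A => Bool.true := by
  simpa using (lit (A := A) 0).le (lit 0)

lemma false : PT fun _ : A => Bool.false := by
  have h : decide ((1 : ℚ) ≤ 0) = Bool.false := decide_eq_false (by norm_num)
  simpa only [h] using (lit (A := A) 1).le (lit 0)

@[fun_prop]
lemma and {f g : A → Bool} (hf : PT f) (hg : PT g) : PT fun x => f x && g x := by
  have : (fun x => f x && g x) = fun x => bif f x then g x else Bool.false := by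
    funext x
    cases f x <;> rfl
  rw [this]
  exact hf.cond hg false

@[fun_prop]
lemma or {f g : A → Bool} (hf : PT f) (hg : PT g) : PT fun x => f x || g x := by
  have : (fun x => f x || g x) = fun x => bif f x then Bool.true else g x := by
    funext x
    cases f x <;> rfl
  rw [this]
  exact hf.cond true hg

@[fun_prop]
lemma not {f : A → Bool} (hf : PT f) : PT fun x => !f x := by
  have : (fun x => !f x) = fun x => bif f x then Bool.false else Bool.true := by
    funext x
    cases f x <;> rfl
  rw [this]
  exact hf.cond false true

lemma nil : PT fun _ : A => ([] : List B) :=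
  ⟨.nil, fun _ => rfl, PolyBdd.const 1, PolyBdd.const 1⟩

@[fun_prop]
lemma cons {f : A → B} {g : A → List B} (hf : PT f) (hg : PT g) : PT fun x => f x :: g x := by
  obtain ⟨t, ht, ht', ht''⟩ := hf
  obtain ⟨u, hu, hu', hu''⟩ := hg
  refine ⟨.cons t u, fun x => ?_, (ht'.add hu').add (PolyBdd.const 1),
    ((ht''.add (PolyBdd.const 1)).add hu'').mono fun x => (sz_cons _ _).le⟩
  simp only [Tm.eval, ht, hu]
  rfl

/-! ## Recursion over lists -/

/-- A fold body sees element, accumulator and environment as three variables, while a `PT` program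
takes one argument. Packing them costs five steps and the binding one. -/
lemma eval_fold_body (t : Tm [Rep.ty (A × B × C)] (Rep.ty C)) (x : A) (b : B) (c : C) :
    (Tm.letIn (.pair (.var (.succ (.succ .zero))) (.pair (.var .zero) (.var (.succ .zero))))
      (t.rename topRen) : Tm [Rep.ty B, Rep.ty C, Rep.ty A] (Rep.ty C)).eval
        (Rep.enc b, Rep.enc c, Rep.enc x, ()) =
      ((t.eval (Rep.enc (x, b, c), ())).1, (t.eval (Rep.enc (x, b, c), ())).2 + 6) := by
  simp only [Tm.eval]
  rw [eval_topRen]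
  refine Prod.ext rfl ?_
  change 5 + _ + 1 = _
  rw [add_assoc, add_comm]
  rfl

/-- A recursion over a list is computed in polynomial time if its intermediate results have
polynomial size. -/
lemma foldr {f : A → B → C → C} {u : A → C} {l : A → List B}
    (hf : PT fun p : A × B × C => f p.1 p.2.1 p.2.2) (hu : PT u) (hl : PT l)
    (hb : ∃ q : Polynomial ℕ, ∀ x, ∀ l', l' <:+ l x →
      sz (l'.foldr (f x) (u x)) ≤ q.eval (sz x)) :
    PT fun x => (l x).foldr (f x) (u x) := by
  obtain ⟨q, hq⟩ := hb
  obtain ⟨tf, htf, ⟨pf, hpf⟩, -⟩ := hf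
  obtain ⟨tu, htu, htu', htu''⟩ := hu
  obtain ⟨tl, htl, htl', htl''⟩ := hl
  set body : Tm [Rep.ty B, Rep.ty C, Rep.ty A] (Rep.ty C) :=
    .letIn (.pair (.var (.succ (.succ .zero))) (.pair (.var .zero) (.var (.succ .zero))))
      (tf.rename topRen) with hbody
  -- The `2` comes from the two pairs around the argument, the `7` from the six packing steps and
  -- the step of the fold itself.
  set step : A → ℕ := fun x => pf.eval (sz x + sz (l x) + q.eval (sz x) + 2) + 7 with hstep
  have key : ∀ x s, ∀ l', l' <:+ l x →
      (List.foldr (fun h p => ((body.eval (h, p.1, Rep.enc x, ())).1,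
          p.2 + (body.eval (h, p.1, Rep.enc x, ())).2 + 1)) (Rep.enc (u x), s)
        (List.map Rep.enc l')).1 = Rep.enc (l'.foldr (f x) (u x)) ∧
      (List.foldr (fun h p => ((body.eval (h, p.1, Rep.enc x, ())).1,
          p.2 + (body.eval (h, p.1, Rep.enc x, ())).2 + 1)) (Rep.enc (u x), s)
        (List.map Rep.enc l')).2 ≤ s + l'.length * step x := by
    intro x s l'
    induction l' with
    | nil => simp
    | cons b l' ih =>
      intro hsuf
      have hsuf' : l' <:+ l x := (List.suffix_cons b l').trans hsuf
      obtain ⟨ih1, ih2⟩ := ih hsuf'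
      rw [List.map_cons, List.foldr_cons, ih1, hbody, eval_fold_body, ← hbody]
      constructor
      · simp only [htf]
        rfl
      · have h1 : (tf.eval (Rep.enc (x, b, l'.foldr (f x) (u x)), ())).2 + 7 ≤ step x := by
          refine Nat.add_le_add_right ((hpf _).trans (eval_mono pf ?_)) _
          have h2 := sz_lt_of_mem (hsuf.subset (List.mem_cons_self (a := b) (l := l')))
          have h3 := hq x l' hsuf'
          rw [sz_prod, sz_prod]
          dsimp only
          omega
        simp only [List.length_cons, Nat.succ_mul]
        omega
  have heval : ∀ x, (Tm.fold tl tu body).eval (Rep.enc x, ()) =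
      List.foldr (fun h p => ((body.eval (h, p.1, Rep.enc x, ())).1,
          p.2 + (body.eval (h, p.1, Rep.enc x, ())).2 + 1)) (Rep.enc (u x),
            (tl.eval (Rep.enc x, ())).2 + (tu.eval (Rep.enc x, ())).2 + 1)
        (List.map Rep.enc (l x)) := by
    intro x
    rw [Tm.eval, htl, htu]
    rfl
  refine ⟨.fold tl tu body, fun x => ?_, ?_, ⟨q, fun x => hq x _ (List.suffix_refl _)⟩⟩
  · rw [heval]
    exact (key x _ _ (List.suffix_refl _)).1
  · refine (((htl'.add htu').add (PolyBdd.const 1)).add (htl''.mul ((PolyBdd.evalComp pf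
      (((PolyBdd.size.add htl'').add (PolyBdd.evalComp q PolyBdd.size)).add
        (PolyBdd.const 2))).add (PolyBdd.const 7)))).mono fun x => ?_
    rw [heval]
    refine (key x _ _ (List.suffix_refl _)).2.trans ?_
    exact Nat.add_le_add_left (Nat.mul_le_mul_right _ (length_lt_sz _).le) _

/-- Additive growth by a polynomial amount per step stays polynomial over the length of the list;
this rules out repeated squaring. -/
lemma foldr_of_incr {f : A → B → C → C} {u : A → C} {l : A → List B}
    (hf : PT fun p : A × B × C => f p.1 p.2.1 p.2.2) (hu : PT u) (hl : PT l)
    (hb : ∃ q : Polynomial ℕ, ∀ x, ∀ b ∈ l x, ∀ c, sz (f x b c) ≤ sz c + q.eval (sz x)) :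
    PT fun x => (l x).foldr (f x) (u x) := by
  refine foldr hf hu hl ?_
  obtain ⟨q, hq⟩ := hb
  obtain ⟨r, hr⟩ := hu.size.add (hl.size.mul (PolyBdd.evalComp q PolyBdd.size))
  refine ⟨r, fun x l' hsuf => le_trans ?_ (hr x)⟩
  suffices H : sz (l'.foldr (f x) (u x)) ≤ sz (u x) + l'.length * q.eval (sz x) by
    refine H.trans (Nat.add_le_add_left (Nat.mul_le_mul_right _ ?_) _)
    exact (length_lt_sz l').le.trans (sz_le_of_sublist hsuf.sublist)
  induction l' with
  | nil => simp
  | cons b l' ih =>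
    have h1 := hq x b (hsuf.subset (List.mem_cons_self (a := b) (l := l')))
      (l'.foldr (f x) (u x))
    have h2 := ih ((List.suffix_cons b l').trans hsuf)
    rw [List.foldr_cons, List.length_cons, Nat.succ_mul]
    omega

@[fun_prop]
lemma map {f : A → B → C} {l : A → List B} (hf : PT fun p : A × B => f p.1 p.2) (hl : PT l) :
    PT fun x => (l x).map (f x) := by
  have : (fun x => (l x).map (f x)) = fun x => (l x).foldr (fun b c => f x b :: c) [] := by
    funext x
    exact List.map_eq_foldr
  rw [this]
  refine foldr_of_incr (f := fun x b c => f x b :: c) ?_ nil hl ?_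
  · exact cons (hf.comp (by fun_prop : PT fun p : A × B × List C => (p.1, p.2.1))) (by fun_prop)
  · obtain ⟨q, hq⟩ := hf.size.of_mem hl.size
    refine ⟨q + 1, fun x b hb c => ?_⟩
    have := hq x b hb
    rw [sz_cons, Polynomial.eval_add, Polynomial.eval_one]
    dsimp only at this
    omega

@[fun_prop]
lemma filter {f : A → B → Bool} {l : A → List B} (hf : PT fun p : A × B => f p.1 p.2)
    (hl : PT l) : PT fun x => (l x).filter (f x) := by
  have : (fun x => (l x).filter (f x)) =
      fun x => (l x).foldr (fun b c => bif f x b then b :: c else c) [] := by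
    funext x
    induction l x with
    | nil => rfl
    | cons b l ih =>
      rw [List.filter_cons, List.foldr_cons, ih]
      cases f x b <;> rfl
  rw [this]
  refine foldr_of_incr (f := fun x b c => bif f x b then b :: c else c) ?_ nil hl ?_
  · exact cond (hf.comp (by fun_prop : PT fun p : A × B × List B => (p.1, p.2.1)))
      (by fun_prop) (by fun_prop)
  · obtain ⟨q, hq⟩ := hl.size.add (PolyBdd.const 1)
    refine ⟨q, fun x b hb c => ?_⟩
    have h1 := hq x
    have h2 := sz_lt_of_mem hb
    dsimp only at h1
    cases f x b
    · simp
    · rw [cond_true, sz_cons]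
      omega

@[fun_prop]
lemma any {f : A → B → Bool} {l : A → List B} (hf : PT fun p : A × B => f p.1 p.2)
    (hl : PT l) : PT fun x => (l x).any (f x) := by
  have : (fun x => (l x).any (f x)) =
      fun x => (l x).foldr (fun b c => f x b || c) Bool.false := by
    funext x
    induction l x with
    | nil => rfl
    | cons b l ih => rw [List.any_cons, List.foldr_cons, ih]
  rw [this]
  refine foldr_of_incr (f := fun x b c => f x b || c) ?_ false hl
    ⟨0, fun x b _ c => by simp [sz_bool]⟩
  exact or (hf.comp (by fun_prop : PT fun p : A × B × Bool => (p.1, p.2.1))) (by fun_prop)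

@[fun_prop]
lemma all {f : A → B → Bool} {l : A → List B} (hf : PT fun p : A × B => f p.1 p.2)
    (hl : PT l) : PT fun x => (l x).all (f x) := by
  have : (fun x => (l x).all (f x)) = fun x => !(l x).any fun b => !f x b := by
    funext x
    rw [List.all_eq_not_any_not]
  rw [this]
  exact not (any (f := fun x b => !f x b) (not hf) hl)

@[fun_prop]
lemma append {f g : A → List B} (hf : PT f) (hg : PT g) : PT fun x => f x ++ g x := by
  have : (fun x => f x ++ g x) = fun x => (f x).foldr (fun b c => b :: c) (g x) := by
    funext x
    rw [List.foldr_cons_eq_append']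
  rw [this]
  refine foldr_of_incr (f := fun _ b c => b :: c) (by fun_prop) hg hf ?_
  obtain ⟨q, hq⟩ := hf.size.add (PolyBdd.const 1)
  refine ⟨q, fun x b hb c => ?_⟩
  have h1 := hq x
  have h2 := sz_lt_of_mem hb
  dsimp only at h1
  rw [sz_cons]
  omega

@[fun_prop]
lemma sum {l : A → List ℚ} (hl : PT l) : PT fun x => (l x).sum := by
  have : (fun x => (l x).sum) = fun x => (l x).foldr (fun b c => b + c) 0 := by
    funext x
    rw [List.sum_eq_foldr]
  rw [this]
  refine foldr_of_incr (f := fun _ b c => b + c) (by fun_prop) (lit 0) hl ?_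
  obtain ⟨q, hq⟩ := hl.size.add (PolyBdd.const 1)
  refine ⟨q, fun x b hb c => ?_⟩
  have h1 := hq x
  have h2 := sz_lt_of_mem hb
  have h3 := sz_add_le b c
  dsimp only at h1
  omega

end PT

attribute [fun_prop] PT.lit PT.nil PT.true PT.false

end BSHM

/-! ### The algorithm on lists and its running time -/

namespace BSHM

/-! ## Pareto-optimal elements -/

section Pareto

variable {α F : Type} [LinearOrder F]

/-- Adds `x` to a list of Pareto-optimal elements with increasing `g` and `r`. -/
def paretoInsert (g r : α → F) (x : α) (L : List α) : List α :=
  bif L.any (fun y => decide (g x ≤ g y) && decide (r y ≤ r x)) then L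
  else L.filter (fun y => !decide (g x ≤ g y) && !decide (r x ≤ r y)) ++
    x :: L.filter (fun y => !decide (g y ≤ g x) && !decide (r y ≤ r x))

/-- The Pareto-optimal elements of a list, in increasing order. -/
def pareto (g r : α → F) (l : List α) : List α := l.foldr (paretoInsert g r) []

/-- Both functions increase along the list. -/
def ParetoSorted (g r : α → F) (L : List α) : Prop :=
  L.Pairwise fun x y => g x < g y ∧ r x < r y

lemma paretoSorted_insert {g r : α → F} {x : α} {L : List α} (hL : ParetoSorted g r L) :
    ParetoSorted g r (paretoInsert g r x L) := by
  unfold paretoInsert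
  cases h : L.any (fun y => decide (g x ≤ g y) && decide (r y ≤ r x))
  · rw [cond_false]
    unfold ParetoSorted at *
    rw [List.pairwise_append, List.pairwise_cons]
    refine ⟨hL.filter _, ⟨fun y hy => ?_, hL.filter _⟩, fun y hy z hz => ?_⟩
    · simpa using (List.mem_filter.1 hy).2
    · have hy' : g y < g x ∧ r y < r x := by simpa using (List.mem_filter.1 hy).2
      rcases List.mem_cons.1 hz with rfl | hz
      · exact hy'
      · have hz' : g x < g z ∧ r x < r z := by simpa using (List.mem_filter.1 hz).2
        exact ⟨hy'.1.trans hz'.1, hy'.2.trans hz'.2⟩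
  · exact hL

lemma mem_of_mem_paretoInsert {g r : α → F} {x y : α} {L : List α}
    (h : y ∈ paretoInsert g r x L) : y = x ∨ y ∈ L := by
  unfold paretoInsert at h
  cases h' : L.any (fun y => decide (g x ≤ g y) && decide (r y ≤ r x))
  · rw [h', cond_false, List.mem_append, List.mem_cons, List.mem_filter, List.mem_filter] at h
    tauto
  · rw [h', cond_true] at h
    exact Or.inr h

/-- When `x` itself is not dominated, a list element is dropped only if `x` dominates it, and
domination is transitive. -/
lemma exists_dominating_insert {g r : α → F} {x y : α} {L : List α}
    (h : y = x ∨ ∃ z ∈ L, g y ≤ g z ∧ r z ≤ r y) :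
    ∃ z ∈ paretoInsert g r x L, g y ≤ g z ∧ r z ≤ r y := by
  unfold paretoInsert
  cases h' : L.any (fun y => decide (g x ≤ g y) && decide (r y ≤ r x))
  · rw [cond_false]
    have key : ∀ z, g y ≤ g z → r z ≤ r y → z = x ∨ z ∈ L →
        ∃ z ∈ L.filter (fun y => !decide (g x ≤ g y) && !decide (r x ≤ r y)) ++
          x :: L.filter (fun y => !decide (g y ≤ g x) && !decide (r y ≤ r x)),
          g y ≤ g z ∧ r z ≤ r y := by
      rintro z hz hz' (rfl | hzL)
      · exact ⟨z, by simp, hz, hz'⟩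
      · have h1 : g z < g x ∨ r x < r z := by
          have := List.any_eq_false.1 h' z hzL
          simp only [Bool.and_eq_true, decide_eq_true_eq, not_and, not_le] at this
          by_cases hc : g x ≤ g z
          · exact Or.inr (this hc)
          · exact Or.inl (not_le.1 hc)
        by_cases hx : g z ≤ g x ∧ r x ≤ r z
        · exact ⟨x, by simp, hz.trans hx.1, hx.2.trans hz'⟩
        · refine ⟨z, ?_, hz, hz'⟩
          rw [List.mem_append, List.mem_cons, List.mem_filter, List.mem_filter]
          simp only [Bool.and_eq_true, Bool.not_eq_true', decide_eq_false_iff_not, not_le]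
          rw [not_and_or, not_le, not_le] at hx
          rcases hx with hx | hx
          · refine Or.inr (Or.inr ⟨hzL, hx, ?_⟩)
            exact h1.resolve_left (not_lt.2 hx.le)
          · refine Or.inl ⟨hzL, ?_, hx⟩
            exact h1.resolve_right (not_lt.2 hx.le)
    rcases h with rfl | ⟨z, hz, h1, h2⟩
    · exact key y le_rfl le_rfl (Or.inl rfl)
    · exact key z h1 h2 (Or.inr hz)
  · rw [cond_true]
    rcases h with rfl | h
    · simpa using h'
    · exact h

lemma pareto_spec (g r : α → F) (l : List α) :
    ParetoSorted g r (pareto g r l) ∧ (∀ x ∈ pareto g r l, x ∈ l) ∧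
      ∀ x ∈ l, ∃ y ∈ pareto g r l, g x ≤ g y ∧ r y ≤ r x := by
  induction l with
  | nil => exact ⟨List.Pairwise.nil, by simp [pareto], by simp⟩
  | cons x l ih =>
    obtain ⟨h1, h2, h3⟩ := ih
    change ParetoSorted g r (paretoInsert g r x (pareto g r l)) ∧
      (∀ y ∈ paretoInsert g r x (pareto g r l), y ∈ x :: l) ∧
      ∀ y ∈ x :: l, ∃ z ∈ paretoInsert g r x (pareto g r l), g y ≤ g z ∧ r z ≤ r y
    refine ⟨paretoSorted_insert h1, fun y hy => ?_, fun y hy => ?_⟩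
    · rcases mem_of_mem_paretoInsert hy with rfl | hy
      · exact List.mem_cons_self
      · exact List.mem_cons_of_mem _ (h2 y hy)
    · refine exists_dominating_insert ?_
      rcases List.mem_cons.1 hy with rfl | hy
      · exact Or.inl rfl
      · exact Or.inr (h3 y hy)

end Pareto

/-! ## The program -/

namespace Alg

/-- Number, size, arrival and departure of a job. -/
abbrev Job : Type := ℚ × ℚ × ℚ × ℚ

/-- Capacity, rate and index of a type. -/
abbrev Kind : Type := ℚ × ℚ × ℚ

def active (j : Job) (t : ℚ) : Bool := decide (j.2.2.1 ≤ t) && !decide (j.2.2.2 ≤ t)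

def load (X : List Job) (t : ℚ) : ℚ :=
  ((X.filter fun j => active j t).map fun j => j.2.1).sum

def ratio (z : Kind) : ℚ := z.2.1 / z.1

/-- Types are compared by capacity in place of index, and trees are tested by the pointwise
criterion of `Inst.inTree_iff`. -/
def inTree (Ts : List Kind) (z : Kind) (j : Job) : Bool :=
  decide (j.2.1 ≤ z.1) && Ts.all fun y =>
    !decide (j.2.1 ≤ y.1) || (decide (z.1 ≤ y.1) || !decide (ratio y ≤ ratio z))

def isExact (Ts : List Kind) (z : Kind) (j : Job) : Bool :=
  decide (j.2.1 ≤ z.1) && Ts.all fun y => decide (z.1 ≤ y.1) || !decide (j.2.1 ≤ y.1)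

def isChild (Ts : List Kind) (z x : Kind) : Bool :=
  (!decide (z.1 ≤ x.1) && !decide (ratio x ≤ ratio z)) && Ts.all fun y =>
    decide (y.1 ≤ x.1) || (decide (z.1 ≤ y.1) || decide (ratio x ≤ ratio y))

def childCost (Ts : List Kind) (X : List Job) (z : Kind) (t : ℚ) : ℚ :=
  ((Ts.filter fun x => isChild Ts z x).map fun x =>
    ((⌈load (X.filter fun j => inTree Ts x j) t / x.1⌉ : ℤ) : ℚ) * x.2.1).sum

def effective (Ts : List Kind) (X : List Job) (z : Kind) (t : ℚ) : Bool :=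
  (X.any fun j => isExact Ts z j && active j t) || decide (1 / 3 * z.2.1 ≤ childCost Ts X z t)

/-- Inclusion of the interval in the effective times is tested only at the times in `E`. -/
def picked (Ts : List Kind) (E : List ℚ) (X : List Job) (z : Kind) (j : Job) : Bool :=
  isExact Ts z j || E.all fun t => !active j t || effective Ts X z t

def cand (Ts : List Kind) (X : List Job) (z : Kind) : List Job := X.filter fun j => inTree Ts z j

/-- `foldr` starts at the end of the list, so on a list sorted by capacity the largest type chooses
first. -/
def remaining (Ts : List Kind) (E : List ℚ) (Js : List Job) (z : Kind) : List Job :=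
  (Ts.filter fun y => !decide (y.1 ≤ z.1)).foldr
    (fun y X => X.filter fun j => !(inTree Ts y j && picked Ts E (cand Ts X y) y j)) Js

def assigned (Ts : List Kind) (E : List ℚ) (Js : List Job) (z : Kind) : List Job :=
  (cand Ts (remaining Ts E Js z) z).filter fun j =>
    picked Ts E (cand Ts (remaining Ts E Js z) z) z j

def leftoverAux (h : ℚ) (E : List ℚ) (X Y : List Job) : List Job :=
  Y.foldr (fun j D => bif E.all (fun t =>
    !active j t || decide (load D t + j.2.1 ≤ load X t - h)) then j :: D else D) []

def hasNumber (X : List Job) (q : Job) : Bool :=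
  X.any fun j => decide (j.1 ≤ q.1) && decide (q.1 ≤ j.1)

/-- `Y` only counts the rounds. The second component counts the rounds after which `q` is still
present, which is its layer index. -/
def layersAux (h : ℚ) (E : List ℚ) (q : Job) (X Y : List Job) : List Job × ℚ :=
  Y.foldr (fun _ p => (leftoverAux h E p.1 p.1,
    p.2 + bif hasNumber (leftoverAux h E p.1 p.1) q then 1 else 0)) (X, 0)

def len {A : Type} (l : List A) : ℚ := (l.map fun _ => (1 : ℚ)).sum

def machine (n : ℚ) (E : List ℚ) (X : List Job) (z : Kind) (q : Job) : ℚ :=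
  bif decide (q.2.1 ≤ z.1 / 4) then
    n + (layersAux (z.1 / 4) E q (X.filter fun j => decide (j.2.1 ≤ z.1 / 4))
      (X.filter fun j => decide (j.2.1 ≤ z.1 / 4))).2
  else q.1

def kinds (Ts : List Kind) (E : List ℚ) (Js : List Job) (q : Job) : List Kind :=
  Ts.filter fun z => hasNumber (assigned Ts E Js z) q

/-- On valid input exactly one kind holds the job, and the sum of a singleton list extracts its
entry. -/
def assign (Ts : List Kind) (E : List ℚ) (Js : List Job) (q : Job) : ℚ × ℚ :=
  (((kinds Ts E Js q).map fun z => z.2.2).sum,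
    ((kinds Ts E Js q).map fun z => machine (len Js) E (assigned Ts E Js z) z q).sum)

/-- The inner recursion multiplies by 8 until `c` is reached, the outer one divides by 8 while the
result stays at least `c`. The bits of `c` and of `1 / c` only supply enough rounds. -/
def roundUp (c : ℚ) : ℚ :=
  (Nat.bits ⌊|1 / c|⌋₊).foldr (fun _ p => bif decide (c ≤ p / 8) then p / 8 else p)
    ((Nat.bits ⌊|c|⌋₊).foldr (fun _ p => bif decide (c ≤ p) then p else p * 8) 1)

/-- An element is numbered by the length of the tail behind it, so numbers run backwards; `types`
inverts them to recover the indices. -/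
def enum {A : Type} (l : List A) : List (ℚ × A) :=
  l.foldr (fun b acc => (len acc, b) :: acc) []

def types (l : List (ℚ × ℚ)) : List Kind :=
  pareto (fun y : Kind => y.1) (fun y => y.2.1)
    ((enum l).map fun y => (y.2.1, roundUp y.2.2, len l - 1 - y.1))

def events (l : List (ℚ × ℚ × ℚ)) : List ℚ := (l.map fun j => j.2.1) ++ l.map fun j => j.2.2

def run (p : List (ℚ × ℚ) × List (ℚ × ℚ × ℚ)) : List (ℚ × ℚ) :=
  (enum p.2).map fun q => assign (types p.1) (events p.2) (enum p.2) q

/-! ## The program runs in polynomial time -/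

lemma len_eq {B : Type} (l : List B) : len l = l.length := by
  simp [len]

lemma length_enum {B : Type} (l : List B) : (enum l).length = l.length := by
  induction l with
  | nil => rfl
  | cons b l ih =>
    unfold enum at ih ⊢
    rw [List.foldr_cons, List.length_cons, List.length_cons, ih]

section PT

variable {A B : Type} [Rep A] [Rep B]

@[fun_prop]
lemma pt_active {j : A → Job} {t : A → ℚ} (hj : PT j) (ht : PT t) :
    PT fun x => active (j x) (t x) := by
  unfold active
  fun_prop

@[fun_prop]
lemma pt_load {X : A → List Job} {t : A → ℚ} (hX : PT X) (ht : PT t) :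
    PT fun x => load (X x) (t x) := by
  unfold load
  fun_prop

@[fun_prop]
lemma pt_ratio {z : A → Kind} (hz : PT z) : PT fun x => ratio (z x) := by
  unfold ratio
  fun_prop

variable {Ts : A → List Kind} {E : A → List ℚ} {X Y : A → List Job} {z y : A → Kind} {j : A → Job}
  {t h c : A → ℚ}

@[fun_prop]
lemma pt_inTree (hT : PT Ts) (hz : PT z) (hj : PT j) : PT fun x => inTree (Ts x) (z x) (j x) := by
  unfold inTree
  fun_prop

@[fun_prop]
lemma pt_isExact (hT : PT Ts) (hz : PT z) (hj : PT j) : PT fun x => isExact (Ts x) (z x) (j x) := by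
  unfold isExact
  fun_prop

@[fun_prop]
lemma pt_isChild (hT : PT Ts) (hz : PT z) (hy : PT y) : PT fun x => isChild (Ts x) (z x) (y x) := by
  unfold isChild
  fun_prop

@[fun_prop]
lemma pt_childCost (hT : PT Ts) (hX : PT X) (hz : PT z) (ht : PT t) :
    PT fun x => childCost (Ts x) (X x) (z x) (t x) := by
  unfold childCost
  fun_prop

@[fun_prop]
lemma pt_effective (hT : PT Ts) (hX : PT X) (hz : PT z) (ht : PT t) :
    PT fun x => effective (Ts x) (X x) (z x) (t x) := by
  unfold effective
  fun_prop

@[fun_prop]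
lemma pt_picked (hT : PT Ts) (hE : PT E) (hX : PT X) (hz : PT z) (hj : PT j) :
    PT fun x => picked (Ts x) (E x) (X x) (z x) (j x) := by
  unfold picked
  fun_prop

@[fun_prop]
lemma pt_cand (hT : PT Ts) (hX : PT X) (hz : PT z) :
    PT fun x => cand (Ts x) (X x) (z x) := by
  unfold cand
  fun_prop

@[fun_prop]
lemma pt_remaining (hT : PT Ts) (hE : PT E) (hX : PT X) (hz : PT z) :
    PT fun x => remaining (Ts x) (E x) (X x) (z x) := by
  unfold remaining
  refine PT.foldr (f := fun x y X => X.filter fun j =>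
    !(inTree (Ts x) y j && picked (Ts x) (E x) (cand (Ts x) X y) y j))
    (l := fun x => (Ts x).filter fun y => !decide (y.1 ≤ (z x).1)) (by fun_prop) hX
    (by fun_prop) ?_
  obtain ⟨q, hq⟩ := hX.size
  -- Every round only filters, so all intermediate results are sublists of the initial list.
  refine ⟨q, fun x l' hs => (sz_le_of_sublist ?_).trans (hq x)⟩
  clear hs
  induction l' with
  | nil => exact List.Sublist.refl _
  | cons b l' ih => exact List.filter_sublist.trans ih

@[fun_prop]
lemma pt_assigned (hT : PT Ts) (hE : PT E) (hX : PT X) (hz : PT z) :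
    PT fun x => assigned (Ts x) (E x) (X x) (z x) := by
  unfold assigned
  fun_prop

@[fun_prop]
lemma pt_leftoverAux (hh : PT h) (hE : PT E) (hX : PT X) (hY : PT Y) :
    PT fun x => leftoverAux (h x) (E x) (X x) (Y x) := by
  unfold leftoverAux
  refine PT.foldr_of_incr (f := fun x j D => bif (E x).all (fun t =>
    !active j t || decide (load D t + j.2.1 ≤ load (X x) t - h x)) then j :: D else D)
    (by fun_prop) (by fun_prop) hY ?_
  obtain ⟨q, hq⟩ := hY.size.add (PolyBdd.const 1)
  refine ⟨q, fun x b hb c => ?_⟩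
  have h1 := hq x
  have h2 := sz_lt_of_mem hb
  dsimp only at h1
  cases (E x).all _
  · simp
  · rw [cond_true, sz_cons]
    omega

@[fun_prop]
lemma pt_hasNumber (hX : PT X) (hj : PT j) : PT fun x => hasNumber (X x) (j x) := by
  unfold hasNumber
  fun_prop

lemma leftoverAux_sublist (h : ℚ) (E : List ℚ) (X Y : List Job) :
    (leftoverAux h E X Y).Sublist Y := by
  induction Y with
  | nil => exact List.Sublist.refl _
  | cons j Y ih =>
    unfold leftoverAux at ih ⊢
    rw [List.foldr_cons]
    cases E.all _
    · exact ih.cons j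
    · exact ih.cons_cons j

@[fun_prop]
lemma pt_layersAux (hh : PT h) (hE : PT E) (hj : PT j) (hX : PT X) (hY : PT Y) :
    PT fun x => layersAux (h x) (E x) (j x) (X x) (Y x) := by
  unfold layersAux
  refine PT.foldr_of_incr (f := fun x (_ : Job) p => (leftoverAux (h x) (E x) p.1 p.1,
    p.2 + bif hasNumber (leftoverAux (h x) (E x) p.1 p.1) (j x) then (1 : ℚ) else 0))
    (by fun_prop) (by fun_prop) hY ⟨2, fun x b _ c => ?_⟩
  have h1 := sz_le_of_sublist (leftoverAux_sublist (h x) (E x) c.1 c.1)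
  have h2 := sz_add_le c.2 (bif hasNumber (leftoverAux (h x) (E x) c.1 c.1) (j x)
    then (1 : ℚ) else 0)
  have h3 : sz (bif hasNumber (leftoverAux (h x) (E x) c.1 c.1) (j x)
    then (1 : ℚ) else 0) = 1 := by
    cases hasNumber _ _ <;> rfl
  rw [sz_prod, sz_prod c]
  have h4 : Polynomial.eval (sz x) (2 : Polynomial ℕ) = 2 := by simp
  rw [h4]
  dsimp only
  omega

@[fun_prop]
lemma pt_len {l : A → List B} (hl : PT l) : PT fun x => len (l x) := by
  unfold len
  fun_prop

@[fun_prop]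
lemma pt_machine (hc : PT c) (hE : PT E) (hX : PT X) (hz : PT z) (hj : PT j) :
    PT fun x => machine (c x) (E x) (X x) (z x) (j x) := by
  unfold machine
  fun_prop

@[fun_prop]
lemma pt_kinds (hT : PT Ts) (hE : PT E) (hX : PT X) (hj : PT j) :
    PT fun x => kinds (Ts x) (E x) (X x) (j x) := by
  unfold kinds
  fun_prop

@[fun_prop]
lemma pt_assign (hT : PT Ts) (hE : PT E) (hX : PT X) (hj : PT j) :
    PT fun x => assign (Ts x) (E x) (X x) (j x) := by
  unfold assign
  fun_prop

@[fun_prop]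
lemma pt_roundUp (hc : PT c) : PT fun x => roundUp (c x) := by
  have h8 : sz (8 : ℚ) = 4 := by decide +kernel
  have h1 : PT fun x => (Nat.bits ⌊|c x|⌋₊).foldr
      (fun _ p => bif decide (c x ≤ p) then p else p * 8) (1 : ℚ) := by
    refine PT.foldr_of_incr (f := fun x (_ : Bool) p => bif decide (c x ≤ p) then p else p * 8)
      (by fun_prop) (by fun_prop) (by fun_prop) ⟨4, fun x b _ p => ?_⟩
    have h2 := sz_mul_le p 8
    have h4 : Polynomial.eval (sz x) (4 : Polynomial ℕ) = 4 := by simp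
    rw [h4]
    cases decide (c x ≤ p)
    · rw [cond_false]
      omega
    · rw [cond_true]
      omega
  unfold roundUp
  refine PT.foldr_of_incr (f := fun x (_ : Bool) p => bif decide (c x ≤ p / 8) then p / 8 else p)
    (by fun_prop) h1 (by fun_prop) ⟨4, fun x b _ p => ?_⟩
  have h2 := sz_div_le p 8
  have h4 : Polynomial.eval (sz x) (4 : Polynomial ℕ) = 4 := by simp
  rw [h4]
  cases decide (c x ≤ p / 8)
  · rw [cond_false]
    omega
  · rw [cond_true]
    omega

@[fun_prop]
lemma pt_enum {l : A → List B} (hl : PT l) : PT fun x => enum (l x) := by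
  unfold enum
  -- The counter grows with the accumulator, so no increment bound independent of it is at hand.
  -- Instead, intermediate results are enumerations of suffixes, with counters below the length.
  refine PT.foldr (f := fun _ (b : B) (acc : List (ℚ × B)) => (len acc, b) :: acc)
    (by fun_prop) (by fun_prop) hl ?_
  obtain ⟨q, hq⟩ := hl.size.add (hl.size.mul (hl.size.add (PolyBdd.const 1)))
  refine ⟨q, fun x l' hl' => le_trans ?_ (hq x)⟩
  change sz (enum l') ≤ _
  have hlen := (length_lt_sz l').le.trans (sz_le_of_sublist hl'.sublist)
  suffices H : sz (enum l') ≤ sz l' + l'.length * (sz (l x) + 1) by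
    exact H.trans (add_le_add (sz_le_of_sublist hl'.sublist) (Nat.mul_le_mul_right _ hlen))
  clear hlen
  induction l' with
  | nil => simp [enum, sz_nil]
  | cons b l' ih =>
    have h1 := ih ((List.suffix_cons b l').trans hl')
    have h2 : sz (len (enum l')) ≤ sz (l x) := by
      rw [len_eq, length_enum]
      have h3 := (length_lt_sz l').trans_le
        (sz_le_of_sublist ((List.suffix_cons b l').trans hl').sublist)
      exact sz_natCast_le (h3.trans Nat.lt_two_pow_self) (by omega)
    change sz ((len (enum l'), b) :: enum l') ≤ _
    rw [sz_cons, sz_prod, sz_cons, List.length_cons, Nat.succ_mul]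
    dsimp only
    omega

/-- Disjoint filters share the entries of the list; the `1` pays for the second empty list. This
keeps a Pareto insertion within an additive bound. -/
lemma sz_filter_add_le {p q : B → Bool} (hpq : ∀ b, p b = true → q b = false) (l : List B) :
    sz (l.filter p) + sz (l.filter q) ≤ sz l + 1 := by
  induction l with
  | nil => exact le_rfl
  | cons b l ih =>
    rw [List.filter_cons, List.filter_cons, sz_cons]
    cases hp : p b
    · cases hq : q b
      · simp only [Bool.false_eq_true, if_false]
        omega
      · simp only [Bool.false_eq_true, if_false, if_true, sz_cons]
        omega
    · simp only [hpq b hp, Bool.false_eq_true, if_false, if_true, sz_cons]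
      omega

@[fun_prop]
lemma pt_types {l : A → List (ℚ × ℚ)} (hl : PT l) : PT fun x => types (l x) := by
  unfold types pareto paretoInsert
  dsimp only
  have hl' : PT fun x => (enum (l x)).map fun y =>
      ((y.2.1, roundUp y.2.2, len (l x) - 1 - y.1) : Kind) := by fun_prop
  refine PT.foldr_of_incr (f := fun _ (y : Kind) L =>
    bif L.any (fun z : Kind => decide (y.1 ≤ z.1) && decide (z.2.1 ≤ y.2.1)) then L
    else L.filter (fun z => !decide (y.1 ≤ z.1) && !decide (y.2.1 ≤ z.2.1)) ++
      y :: L.filter (fun z => !decide (z.1 ≤ y.1) && !decide (z.2.1 ≤ y.2.1)))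
    (u := fun _ => []) (by fun_prop) (by fun_prop) hl' ?_
  obtain ⟨q, hq⟩ := hl'.size.add (PolyBdd.const 1)
  refine ⟨q, fun x b hb L => ?_⟩
  have h1 := hq x
  have h2 := sz_lt_of_mem hb
  dsimp only at h1
  cases L.any _
  · rw [cond_false]
    have h3 := sz_filter_add_le (p := fun z : Kind => !decide (b.1 ≤ z.1) && !decide (b.2.1 ≤ z.2.1))
      (q := fun z => !decide (z.1 ≤ b.1) && !decide (z.2.1 ≤ b.2.1)) (fun z hz => by
        simp only [Bool.and_eq_true, Bool.not_eq_true', decide_eq_false_iff_not, not_le] at hz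
        simp [hz.1.le]) L
    have h4 : ∀ l₁ l₂ : List Kind, sz (l₁ ++ l₂) + 1 = sz l₁ + sz l₂ := by
      intro l₁ l₂
      simp only [sz_list, List.map_append, List.sum_append]
      omega
    have h5 := h4 (L.filter fun z => !decide (b.1 ≤ z.1) && !decide (b.2.1 ≤ z.2.1))
      (b :: L.filter fun z => !decide (z.1 ≤ b.1) && !decide (z.2.1 ≤ b.2.1))
    rw [sz_cons] at h5
    omega
  · rw [cond_true]
    omega

@[fun_prop]
lemma pt_events {l : A → List (ℚ × ℚ × ℚ)} (hl : PT l) : PT fun x => events (l x) := by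
  unfold events
  fun_prop

lemma pt_run : PT run := by
  unfold run
  fun_prop

end PT

/-- The program of the algorithm. -/
lemma exists_prog : ∃ (P : Prog) (p : Polynomial ℕ), ∀ x : inputTy.Val,
    (Tm.eval P (x, ())).1 = run x ∧ (Tm.eval P (x, ())).2 ≤ p.eval (inputTy.size x) := by
  obtain ⟨t, ht, ⟨p, hp⟩, -⟩ := pt_run
  refine ⟨t, p, fun x => ?_⟩
  -- The encoding of these types is the identity, but on lists only after removing a `List.map` of
  -- the identity.
  have hid : ∀ (A : Type) (e : A → A), (∀ a, e a = a) → ∀ l : List A, l.map e = l :=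
    fun A e he l => by rw [funext he]; exact List.map_id' l
  have henc : Rep.enc (A := List (ℚ × ℚ) × List (ℚ × ℚ × ℚ)) x = x :=
    Prod.ext (hid _ _ (fun _ => rfl) _) (hid _ _ (fun _ => rfl) _)
  have h1 := ht x
  have h2 := hp x
  unfold sz at h2
  dsimp only at h2
  rw [henc] at h1 h2
  exact ⟨h1.trans (hid _ _ (fun _ => rfl) _), h2⟩

end Alg
end BSHM

/-! ### Agreement of the program with the real-valued algorithm -/

namespace BSHM

/-! ## Normalizations from lists of types -/

namespace Inst

variable {n k : ℕ}

/-- The instance with the machine types of a list, at rounded rates. -/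
noncomputable def ofTypes (A : Inst ℝ n k) (L : List (Fin k)) : Inst ℝ n L.length where
  g z := A.g (L.get z)
  r z := round8 (A.r (L.get z))
  s := A.s
  arr := A.arr
  dep := A.dep

lemma isNormalization_ofTypes {A : Inst ℝ n k} (hA : A.Valid) {L : List (Fin k)}
    (hL : ParetoSorted A.g (fun y => round8 (A.r y)) L)
    (hdom : ∀ y, ∃ z ∈ L, A.g y ≤ A.g z ∧ round8 (A.r z) ≤ round8 (A.r y)) :
    A.IsNormalization (A.ofTypes L) L.get where
  standard :=
    { g_pos := fun z => hA.g_pos _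
      r_pos := fun z => round8_pos _
      s_pos := hA.s_pos
      arr_lt_dep := hA.arr_lt_dep
      fits := fun j => by
        obtain ⟨y, hy⟩ := hA.fits j
        obtain ⟨z, hz, hyz, -⟩ := hdom y
        obtain ⟨i, rfl⟩ := List.mem_iff_get.1 hz
        exact ⟨i, hy.trans hyz⟩
      g_mono := fun i i' h => (List.pairwise_iff_get.1 hL i i' h).1
      r_mono := fun i i' h => (List.pairwise_iff_get.1 hL i i' h).2
      r_pow := fun z => ⟨_, rfl⟩ }
  s_eq := rfl
  arr_eq := rfl
  dep_eq := rfl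
  g_eq _ := rfl
  r_eq _ := rfl
  dominated y := by
    obtain ⟨z, hz, h1, h2⟩ := hdom y
    obtain ⟨i, rfl⟩ := List.mem_iff_get.1 hz
    exact ⟨i, h1, h2⟩

lemma exists_normalization {A : Inst ℝ n k} (hA : A.Valid) :
    ∃ (m : ℕ) (I : Inst ℝ n m) (e : Fin m → Fin k), A.IsNormalization I e := by
  obtain ⟨h1, -, h3⟩ := pareto_spec A.g (fun y => round8 (A.r y)) (List.finRange k)
  exact ⟨_, _, _, isNormalization_ofTypes hA h1 fun y => h3 y (List.mem_finRange y)⟩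

end Inst

/-! ## Correctness of the program -/

namespace Alg

open Inst

variable {n m : ℕ}

/-- The values `φ j` and `τ z` describe the jobs and the types of `I`. -/
structure Represents (I : Inst ℝ n m) (φ : Fin n → Job) (τ : Fin m → Kind) : Prop where
  s : ∀ j, ((φ j).2.1 : ℝ) = I.s j
  arr : ∀ j, ((φ j).2.2.1 : ℝ) = I.arr j
  dep : ∀ j, ((φ j).2.2.2 : ℝ) = I.dep j
  g : ∀ z, ((τ z).1 : ℝ) = I.g z
  r : ∀ z, ((τ z).2.1 : ℝ) = I.r z
  num : ∀ i j, (φ i).1 = (φ j).1 → i = j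

/-- `E` contains all arrival and departure times. -/
def HasEvents (φ : Fin n → Job) (E : List ℚ) : Prop :=
  ∀ j, (φ j).2.2.1 ∈ E ∧ (φ j).2.2.2 ∈ E

section Correct

variable {I : Inst ℝ n m} {φ : Fin n → Job} {τ : Fin m → Kind} {E : List ℚ}

lemma filter_sorted (X : Finset (Fin n)) (p : Fin n → Bool) :
    (sorted X).filter p = sorted (X.filter fun j => p j = true) := by
  unfold sorted
  rw [List.filter_filter]
  refine List.filter_congr fun j _ => ?_
  simp only [Finset.mem_filter, Bool.decide_and, Bool.decide_eq_true]
  exact Bool.and_comm _ _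

lemma sorted_univ : sorted (Finset.univ : Finset (Fin n)) = List.finRange n := by
  simp [sorted]

lemma filter_map_sorted (X : Finset (Fin n)) (p : Job → Bool) :
    ((sorted X).map φ).filter p = (sorted (X.filter fun j => p (φ j) = true)).map φ := by
  rw [List.filter_map, filter_sorted]
  rfl

namespace Represents

lemma le_g_iff (h : Represents I φ τ) (j : Fin n) (z : Fin m) :
    (φ j).2.1 ≤ (τ z).1 ↔ I.s j ≤ I.g z := by
  rw [← h.s, ← h.g, Rat.cast_le]

lemma active_iff (h : Represents I φ τ) (j : Fin n) (t : ℚ) :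
    active (φ j) t = true ↔ (t : ℝ) ∈ I.interval j := by
  unfold active interval
  rw [Set.mem_Ico, ← h.arr, ← h.dep, Rat.cast_le, Rat.cast_lt]
  simp

lemma load_eq (h : Represents I φ τ) {Y : List (Fin n)} (hY : Y.Nodup) (t : ℚ) :
    ((load (Y.map φ) t : ℚ) : ℝ) = I.load Y.toFinset t := by
  classical
  unfold load
  rw [List.filter_map, List.map_map, Rat.cast_list_sum, List.map_map,
    ← List.sum_toFinset _ (hY.filter _)]
  unfold Inst.load Inst.size
  refine Finset.sum_congr ?_ fun j _ => h.s j
  ext j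
  rw [List.mem_toFinset, List.mem_filter, mem_activeIn, List.mem_toFinset, ← h.active_iff]
  rfl

lemma load_sorted (h : Represents I φ τ) (X : Finset (Fin n)) (t : ℚ) :
    ((load ((sorted X).map φ) t : ℚ) : ℝ) = I.load X t := by
  rw [h.load_eq (nodup_sorted X), toFinset_sorted]

lemma ratio_eq (h : Represents I φ τ) (z : Fin m) : ((ratio (τ z) : ℚ) : ℝ) = I.ratio z := by
  unfold ratio Inst.ratio
  rw [Rat.cast_div, h.g, h.r]

lemma ratio_le_iff (h : Represents I φ τ) (y z : Fin m) :
    ratio (τ y) ≤ ratio (τ z) ↔ I.ratio y ≤ I.ratio z := by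
  rw [← h.ratio_eq, ← h.ratio_eq, Rat.cast_le]

lemma g_le_iff (h : Represents I φ τ) (hI : I.Standard) (y z : Fin m) :
    (τ y).1 ≤ (τ z).1 ↔ y ≤ z := by
  rw [← hI.g_mono.le_iff_le, ← h.g, ← h.g, Rat.cast_le]

lemma inTree_iff (h : Represents I φ τ) (hI : I.Standard) (z : Fin m) (j : Fin n) :
    inTree ((List.finRange m).map τ) (τ z) (φ j) = true ↔
      ∃ x : Fin m, I.exactType j = x ∧ I.InTree x z := by
  unfold inTree
  simp only [Bool.and_eq_true, decide_eq_true_eq, List.all_eq_true, List.mem_map,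
    List.mem_finRange, true_and, forall_exists_index, forall_apply_eq_imp_iff, Bool.or_eq_true,
    Bool.not_eq_true', decide_eq_false_iff_not, h.le_g_iff, h.ratio_le_iff, h.g_le_iff hI]
  obtain ⟨x, hx⟩ := exists_exactType hI.toValid j
  have hx' := I.exactType_eq_iff.1 hx
  -- Capacities increase, so fitting on `y` means having exact type at most `y`; the program never
  -- computes the exact type.
  have hle : ∀ y, I.s j ≤ I.g y ↔ x ≤ y := fun y =>
    ⟨hx'.2 y, fun hxy => hx'.1.trans (hI.g_mono.monotone hxy)⟩
  simp only [hle]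
  rw [hx]
  constructor
  · rintro ⟨h1, h2⟩
    refine ⟨x, rfl, I.inTree_iff.2 ⟨h1, fun y hxy hyz => ?_⟩⟩
    rcases h2 y with h3 | h3 | h3
    · exact absurd hxy h3
    · exact absurd hyz (not_lt.2 h3)
    · exact not_le.1 h3
  · rintro ⟨x', hxx, h1⟩
    have : x = x' := WithTop.coe_injective hxx
    subst this
    obtain ⟨h1, h2⟩ := I.inTree_iff.1 h1
    refine ⟨h1, fun y => ?_⟩
    by_cases h3 : x ≤ y
    · by_cases h4 : z ≤ y
      · exact Or.inr (Or.inl h4)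
      · exact Or.inr (Or.inr (not_le.2 (h2 y h3 (not_le.1 h4))))
    · exact Or.inl h3

lemma isExact_iff (h : Represents I φ τ) (hI : I.Standard) (z : Fin m) (j : Fin n) :
    isExact ((List.finRange m).map τ) (τ z) (φ j) = true ↔ I.exactType j = z := by
  unfold isExact
  simp only [Bool.and_eq_true, decide_eq_true_eq, List.all_eq_true, List.mem_map,
    List.mem_finRange, true_and, forall_exists_index, forall_apply_eq_imp_iff, Bool.or_eq_true,
    Bool.not_eq_true', decide_eq_false_iff_not, h.le_g_iff, h.g_le_iff hI]
  rw [I.exactType_eq_iff]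
  refine and_congr_right fun _ => forall_congr' fun y => ?_
  tauto

lemma isChild_iff (h : Represents I φ τ) (hI : I.Standard) (z x : Fin m) :
    isChild ((List.finRange m).map τ) (τ z) (τ x) = true ↔ x ∈ I.children z := by
  unfold isChild
  simp only [Bool.and_eq_true, decide_eq_true_eq, List.all_eq_true, List.mem_map,
    List.mem_finRange, true_and, forall_exists_index, forall_apply_eq_imp_iff, Bool.or_eq_true,
    Bool.not_eq_true', decide_eq_false_iff_not, h.ratio_le_iff, h.g_le_iff hI]
  rw [I.mem_children, I.parent_eq_iff]
  simp only [not_le]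
  refine and_congr_right fun _ => forall_congr' fun y => ?_
  rw [← not_lt, ← not_lt (a := I.ratio y)]
  tauto

lemma cand_eq (h : Represents I φ τ) (hI : I.Standard) (X : Finset (Fin n)) (z : Fin m) :
    cand ((List.finRange m).map τ) ((sorted X).map φ) (τ z) =
      (sorted (I.restrict X z)).map φ := by
  unfold cand
  rw [filter_map_sorted]
  congr 2
  ext j
  rw [Finset.mem_filter, h.inTree_iff hI, mem_restrict]

lemma childCost_eq (h : Represents I φ τ) (hI : I.Standard) (X : Finset (Fin n)) (z : Fin m)
    (t : ℚ) :
    ((childCost ((List.finRange m).map τ) ((sorted X).map φ) (τ z) t : ℚ) : ℝ) =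
      I.childCost X z t := by
  unfold childCost
  rw [List.filter_map, List.map_map, Rat.cast_list_sum, List.map_map,
    ← List.sum_toFinset _ ((List.nodup_finRange m).filter _)]
  unfold Inst.childCost
  refine Finset.sum_congr ?_ fun x _ => ?_
  · ext x
    simp [h.isChild_iff hI]
  · have h1 := h.cand_eq hI X x
    unfold cand at h1
    simp only [Function.comp_apply, Rat.cast_mul, Rat.cast_intCast, h.r, h1]
    rw [← Rat.ceil_cast (α := ℝ), Rat.cast_div, h.load_sorted, h.g]

lemma effective_iff (h : Represents I φ τ) (hI : I.Standard) (X : Finset (Fin n)) (z : Fin m)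
    (t : ℚ) :
    effective ((List.finRange m).map τ) ((sorted X).map φ) (τ z) t = true ↔
      (t : ℝ) ∈ I.effective X z := by
  unfold effective Inst.effective
  rw [Bool.or_eq_true, decide_eq_true_eq, Set.mem_union, mem_span]
  refine or_congr ?_ ?_
  · simp only [List.any_eq_true, List.mem_map, mem_sorted, exists_exists_and_eq_and,
      Bool.and_eq_true, h.isExact_iff hI, h.active_iff, mem_exactJobs]
    tauto
  · rw [Set.mem_ofPred_eq, ← h.childCost_eq hI, ← h.r, ← Rat.cast_le (K := ℝ)]
    push_cast
    rfl

/-- The last event not after `t` will do: no arrival or departure lies after it and up to `t`, so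
the same jobs are active at both times. -/
lemma exists_event (h : Represents I φ τ) (hE : HasEvents φ E) {j : Fin n} {t : ℝ}
    (ht : t ∈ I.interval j) : ∃ e ∈ E, ∀ i, t ∈ I.interval i ↔ (e : ℝ) ∈ I.interval i := by
  classical
  obtain ⟨e, he, hmax⟩ := Finset.exists_max_image (E.toFinset.filter fun e : ℚ => (e : ℝ) ≤ t)
    (fun e : ℚ => (e : ℝ)) ⟨(φ j).2.2.1, by
      rw [Finset.mem_filter, List.mem_toFinset, h.arr]
      exact ⟨(hE j).1, ht.1⟩⟩
  rw [Finset.mem_filter, List.mem_toFinset] at he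
  have key : ∀ q ∈ E, (q : ℝ) ≤ t ↔ (q : ℝ) ≤ e := fun q hq =>
    ⟨fun h => hmax q (Finset.mem_filter.2 ⟨List.mem_toFinset.2 hq, h⟩), fun h => h.trans he.2⟩
  refine ⟨e, he.1, fun i => ?_⟩
  unfold interval
  rw [Set.mem_Ico, Set.mem_Ico, ← h.arr, ← h.dep, key _ (hE i).1, ← not_le, ← not_le,
    key _ (hE i).2]

/-- A property that depends only on the active set need be tested only at events. This turns both
the picking rule and the admission test for layers into finite checks. -/
lemma forall_interval_iff (h : Represents I φ τ) (hE : HasEvents φ E) (j : Fin n)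
    {P : ℝ → Prop} (hP : ∀ t t', (∀ i, t ∈ I.interval i ↔ t' ∈ I.interval i) → P t' → P t) :
    (∀ t ∈ E, (t : ℝ) ∈ I.interval j → P t) ↔ ∀ t ∈ I.interval j, P t := by
  constructor
  · intro H t ht
    obtain ⟨e, he, hte⟩ := h.exists_event hE ht
    exact hP t e hte (H e he ((hte j).1 ht))
  · exact fun H t _ ht => H t ht

lemma picked_iff (h : Represents I φ τ) (hI : I.Standard) (hE : HasEvents φ E)
    {X : Finset (Fin n)} (z : Fin m) {j : Fin n} (hj : j ∈ X) :
    picked ((List.finRange m).map τ) E ((sorted X).map φ) (τ z) (φ j) = true ↔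
      j ∈ I.pick X z := by
  unfold picked
  rw [Bool.or_eq_true, h.isExact_iff hI, mem_pick, and_iff_right hj]
  refine or_congr_right ?_
  simp only [List.all_eq_true, Bool.or_eq_true, Bool.not_eq_true', ← Bool.not_eq_true,
    h.active_iff, h.effective_iff hI, ← imp_iff_not_or]
  rw [h.forall_interval_iff hE j]
  · rfl
  · intro t t' htt ht'
    have hact : ∀ Y, I.activeIn Y t = I.activeIn Y t' := by
      intro Y
      ext i
      rw [mem_activeIn, mem_activeIn, htt]
    unfold Inst.effective at ht' ⊢
    rw [Set.mem_union, mem_span, Set.mem_ofPred_eq] at ht' ⊢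
    simp only [Inst.childCost, Inst.load, hact, htt]
    exact ht'

/-- The last `i` types of the list are those processed in the first `i` rounds. -/
lemma foldr_remaining (h : Represents I φ τ) (hI : I.Standard) (hE : HasEvents φ E) (i : ℕ)
    (hi : i ≤ m) :
    (((List.finRange m).drop (m - i)).map τ).foldr (fun y X => X.filter fun j =>
      !(inTree ((List.finRange m).map τ) y j && picked ((List.finRange m).map τ) E
        (cand ((List.finRange m).map τ) X y) y j)) ((sorted Finset.univ).map φ) =
      (sorted (I.remaining i)).map φ := by
  induction i with
  | zero =>
    rw [Nat.sub_zero, List.drop_of_length_le (by simp), List.map_nil, List.foldr_nil]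
    rfl
  | succ i ih =>
    have hlt : m - (i + 1) < (List.finRange m).length := by
      rw [List.length_finRange]
      omega
    have hsucc : m - (i + 1) + 1 = m - i := by omega
    rw [List.drop_eq_getElem_cons hlt, hsucc, List.map_cons, List.foldr_cons, ih (by omega)]
    have hrev : (List.finRange m)[m - (i + 1)] = Fin.rev ⟨i, hi⟩ := by
      rw [List.getElem_finRange]
      ext
      simp
    rw [hrev, h.cand_eq hI, filter_map_sorted, Inst.remaining, dif_pos (show i < m from hi)]
    congr 2
    ext j
    rw [Finset.mem_filter, Finset.mem_sdiff]
    refine and_congr_right fun hj => ?_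
    rw [Bool.not_eq_true', ← Bool.not_eq_true, not_iff_not, Bool.and_eq_true, h.inTree_iff hI]
    constructor
    · rintro ⟨h1, h2⟩
      exact (h.picked_iff hI hE _ (I.mem_restrict.2 ⟨hj, h1⟩)).1 h2
    · intro h1
      have h2 := (I.mem_pick.1 h1).1
      exact ⟨(I.mem_restrict.1 h2).2, (h.picked_iff hI hE _ h2).2 h1⟩

lemma filter_finRange_lt (z : Fin m) :
    (List.finRange m).filter (fun y => decide (z < y)) = (List.finRange m).drop (z + 1) := by
  conv_lhs => rw [← List.take_append_drop ((z : ℕ) + 1) (List.finRange m), List.filter_append]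
  have h1 : ((List.finRange m).take (z + 1)).filter (fun y => decide (z < y)) = [] := by
    rw [List.filter_eq_nil_iff]
    intro y hy
    obtain ⟨i, hi, rfl⟩ := List.mem_take_iff_getElem.1 hy
    simp only [List.getElem_finRange, decide_eq_true_eq, Fin.lt_def]
    simp at hi ⊢
    omega
  have h2 : ((List.finRange m).drop (z + 1)).filter (fun y => decide (z < y)) =
      (List.finRange m).drop (z + 1) := by
    rw [List.filter_eq_self]
    intro y hy
    obtain ⟨i, hi, rfl⟩ := List.mem_drop_iff_getElem.1 hy
    simp only [List.getElem_finRange, decide_eq_true_eq, Fin.lt_def]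
    simp
    omega
  rw [h1, h2, List.nil_append]

lemma remaining_eq (h : Represents I φ τ) (hI : I.Standard) (hE : HasEvents φ E) (z : Fin m) :
    remaining ((List.finRange m).map τ) E ((sorted Finset.univ).map φ) (τ z) =
      (sorted (I.remaining (Fin.rev z))).map φ := by
  have h1 : ((List.finRange m).map τ).filter (fun y => !decide (y.1 ≤ (τ z).1)) =
      ((List.finRange m).drop (m - (Fin.rev z : ℕ))).map τ := by
    have hz : m - (Fin.rev z : ℕ) = z + 1 := by
      rw [Fin.val_rev]
      omega
    rw [List.filter_map, hz, ← filter_finRange_lt]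
    congr 1
    refine List.filter_congr fun y _ => ?_
    simp only [Function.comp_apply, h.g_le_iff hI, ← not_le, decide_not]
  unfold remaining
  rw [h1]
  exact h.foldr_remaining hI hE _ (Fin.rev z).2.le

lemma assigned_eq (h : Represents I φ τ) (hI : I.Standard) (hE : HasEvents φ E) (z : Fin m) :
    assigned ((List.finRange m).map τ) E ((sorted Finset.univ).map φ) (τ z) =
      (sorted (I.K z)).map φ := by
  unfold assigned
  rw [h.remaining_eq hI hE, h.cand_eq hI, filter_map_sorted]
  congr 2
  ext j
  rw [Finset.mem_filter]
  constructor
  · rintro ⟨h1, h2⟩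
    exact (h.picked_iff hI hE z h1).1 h2
  · intro h1
    have h2 := (I.mem_pick.1 h1).1
    exact ⟨h2, (h.picked_iff hI hE z h2).2 h1⟩

lemma hasNumber_iff (h : Represents I φ τ) (Y : List (Fin n)) (j : Fin n) :
    hasNumber (Y.map φ) (φ j) = true ↔ j ∈ Y := by
  unfold hasNumber
  simp only [List.any_eq_true, List.mem_map, exists_exists_and_eq_and, Bool.and_eq_true,
    decide_eq_true_eq]
  constructor
  · rintro ⟨i, hi, h1, h2⟩
    rwa [← h.num i j (le_antisymm h1 h2)]
  · exact fun hj => ⟨j, hj, le_rfl, le_rfl⟩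

lemma leftoverAux_eq (h : Represents I φ τ) (hE : HasEvents φ E) {c : ℚ} {X Y : List (Fin n)}
    (hX : X.Nodup) (hY : Y.Nodup) :
    leftoverAux c E (X.map φ) (Y.map φ) = (I.leftoverAux c X Y).map φ := by
  classical
  induction Y with
  | nil => rfl
  | cons j Y ih =>
    have ih := ih (List.nodup_cons.1 hY).2
    have hD : (I.leftoverAux c X Y).Nodup :=
      (List.nodup_cons.1 hY).2.sublist (I.leftoverAux_sublist c X Y)
    have h1 : (E.all fun t => !active (φ j) t ||
        decide (load ((I.leftoverAux c X Y).map φ) t + (φ j).2.1 ≤ load (X.map φ) t - c)) =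
          true ↔ ∀ t ∈ I.interval j,
            I.load (I.leftoverAux c X Y).toFinset t + I.s j ≤ I.load X.toFinset t - c := by
      simp only [List.all_eq_true, Bool.or_eq_true, Bool.not_eq_true', ← Bool.not_eq_true,
        h.active_iff, ← imp_iff_not_or, decide_eq_true_eq]
      rw [← h.forall_interval_iff hE j]
      · refine forall_congr' fun t => imp_congr_right fun _ => imp_congr_right fun _ => ?_
        rw [← h.load_eq hD, ← h.load_eq hX, ← h.s]
        exact_mod_cast Iff.rfl
      · intro t t' htt ht'
        have hact : ∀ Y, I.activeIn Y t = I.activeIn Y t' := by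
          intro Y
          ext i
          rw [mem_activeIn, mem_activeIn, htt]
        simpa only [Inst.load, hact] using ht'
    have h2 : leftoverAux c E (X.map φ) ((j :: Y).map φ) =
        bif (E.all fun t => !active (φ j) t ||
          decide (load ((I.leftoverAux c X Y).map φ) t + (φ j).2.1 ≤ load (X.map φ) t - c))
        then φ j :: (I.leftoverAux c X Y).map φ else (I.leftoverAux c X Y).map φ := by
      rw [← ih]
      rfl
    rw [h2]
    rcases I.leftoverAux_cons c X Y j with ⟨h3, h4⟩ | ⟨h3, t, ht, h4⟩
    · rw [h1.2 h4, h3]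
      rfl
    · rw [h3, Bool.eq_false_iff.2 fun hc => absurd (h1.1 hc t ht) (not_le.2 h4)]
      rfl

lemma layersAux_eq (h : Represents I φ τ) (hE : HasEvents φ E) {c : ℚ} {X : List (Fin n)}
    (hX : X.Nodup) (j : Fin n) (Y : List Job) :
    layersAux c E (φ j) (X.map φ) Y = ((I.layers c X Y.length).map φ,
      ((∑ k ∈ Finset.range Y.length, if j ∈ I.layers c X (k + 1) then 1 else 0 : ℕ) : ℚ)) := by
  induction Y with
  | nil => simp [layersAux, layers]
  | cons y Y ih =>
    have hD := hX.sublist (I.layers_sublist c X Y.length)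
    have h1 : layersAux c E (φ j) (X.map φ) (y :: Y) =
        (leftoverAux c E (layersAux c E (φ j) (X.map φ) Y).1
          (layersAux c E (φ j) (X.map φ) Y).1,
        (layersAux c E (φ j) (X.map φ) Y).2 + bif hasNumber (leftoverAux c E
          (layersAux c E (φ j) (X.map φ) Y).1 (layersAux c E (φ j) (X.map φ) Y).1) (φ j)
          then 1 else 0) := rfl
    have h2 : I.leftoverAux c (I.layers c X Y.length) (I.layers c X Y.length) =
        I.layers c X (Y.length + 1) := (I.layers_succ c X Y.length).symm
    rw [h1, ih]
    dsimp only
    rw [h.leftoverAux_eq hE hD hD, h2, List.length_cons, Finset.sum_range_succ]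
    refine Prod.ext rfl ?_
    have h3 := h.hasNumber_iff (I.layers c X (Y.length + 1)) j
    rw [Nat.cast_add]
    congr 1
    by_cases h4 : j ∈ I.layers c X (Y.length + 1)
    · rw [h3.2 h4, if_pos h4]
      simp
    · rw [Bool.eq_false_iff.2 fun hc => h4 (h3.1 hc), if_neg h4]
      simp

lemma machine_eq (h : Represents I φ τ) (hE : HasEvents φ E) {num : Fin n → ℕ}
    (hnum : ∀ j, (φ j).1 = num j) (X : Finset (Fin n)) (z : Fin m) (j : Fin n) :
    machine (n : ℚ) E ((sorted X).map φ) (τ z) (φ j) = (I.machine num X z j : ℚ) := by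
  have hc : (((τ z).1 / 4 : ℚ) : ℝ) = I.g z / 4 := by
    rw [← h.g]
    push_cast
    rfl
  have hle : ∀ i, (φ i).2.1 ≤ (τ z).1 / 4 ↔ I.s i ≤ I.g z / 4 := by
    intro i
    rw [← hc, ← h.s, Rat.cast_le]
  have hf : ((sorted X).map φ).filter (fun j => decide (j.2.1 ≤ (τ z).1 / 4)) =
      (sorted (I.small X z)).map φ := by
    rw [filter_map_sorted]
    congr 2
    ext i
    rw [Finset.mem_filter, decide_eq_true_eq, hle, mem_small]
  unfold machine Inst.machine
  rw [hf, h.layersAux_eq hE (nodup_sorted _), List.length_map, hc]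
  by_cases h1 : I.s j ≤ I.g z / 4
  · rw [decide_eq_true ((hle j).2 h1), if_pos h1, cond_true]
    unfold layerIdx
    push_cast
    rfl
  · rw [decide_eq_false fun hh => h1 ((hle j).1 hh), if_neg h1, cond_false, hnum]

/-- The sets `K` partition the jobs, so the list of kinds holding a job is the singleton of its type
and the sums return its entries. -/
lemma assign_eq (h : Represents I φ τ) (hI : I.Standard) (hE : HasEvents φ E) {num : Fin n → ℕ}
    (hnum : ∀ j, (φ j).1 = num j) {ty : Fin n → Fin m} (hty : ∀ j, j ∈ I.K (ty j)) (j : Fin n) :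
    assign ((List.finRange m).map τ) E ((sorted Finset.univ).map φ) (φ j) =
      ((τ (ty j)).2.2, (I.machine num (I.K (ty j)) (ty j) j : ℚ)) := by
  have hk : kinds ((List.finRange m).map τ) E ((sorted Finset.univ).map φ) (φ j) =
      [τ (ty j)] := by
    unfold kinds
    rw [List.filter_map]
    have : (List.finRange m).filter ((fun z => hasNumber
        (assigned ((List.finRange m).map τ) E ((sorted Finset.univ).map φ) z) (φ j)) ∘ τ) =
        [ty j] := by
      have h1 : ∀ z ∈ List.finRange m, ((fun z => hasNumber (assigned ((List.finRange m).map τ) E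
          ((sorted Finset.univ).map φ) z) (φ j)) ∘ τ) z = decide (z = ty j) := by
        intro z _
        rw [Function.comp_apply, h.assigned_eq hI hE, Bool.eq_iff_iff, h.hasNumber_iff,
          mem_sorted, decide_eq_true_eq, eq_comm, ty_eq_iff hty]
      rw [List.filter_congr h1, List.filter_eq, List.count_eq_one_of_mem
        (List.nodup_finRange m) (List.mem_finRange _), List.replicate_one]
    rw [this]
    rfl
  unfold assign
  rw [hk, len_eq]
  simp only [List.map_cons, List.map_nil, List.sum_singleton]
  rw [h.assigned_eq hI hE, List.length_map, sorted_univ, List.length_finRange,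
    h.machine_eq hE hnum]

end Represents

end Correct

end Alg
end BSHM

/-! ### Rounding, the normalization found by the program, and assembly -/

namespace BSHM

namespace Alg

open Inst

/-! ## Rounding -/

/-- Either `c` has been reached or every round has multiplied. A multiplication happens only below
`c`, so the new power stays below `8 * c`. -/
lemma exists_foldr_mul (c : ℚ) (l : List Bool) : ∃ i : ℕ,
    l.foldr (fun _ p => bif decide (c ≤ p) then p else p * 8) 1 = (8 : ℚ) ^ i ∧
      (c ≤ 8 ^ i ∨ i = l.length) ∧ (i = 0 ∨ (8 : ℚ) ^ i < 8 * c) := by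
  induction l with
  | nil => exact ⟨0, by simp, Or.inr rfl, Or.inl rfl⟩
  | cons b l ih =>
    obtain ⟨i, h1, h2, h3⟩ := ih
    rw [List.foldr_cons, h1]
    by_cases h : c ≤ 8 ^ i
    · rw [decide_eq_true h, cond_true]
      exact ⟨i, rfl, Or.inl h, h3⟩
    · rw [decide_eq_false h, cond_false]
      refine ⟨i + 1, (pow_succ _ _).symm, Or.inr (by rw [h2.resolve_left h, List.length_cons]),
        Or.inr ?_⟩
      rw [pow_succ]
      linarith [not_le.1 h]

/-- A refused division shows that the power is below `8 * c` already, and then it stays so;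
otherwise every round has divided. -/
lemma exists_foldr_div (c : ℚ) (u : ℤ) (hu : c ≤ 8 ^ u) (l : List Bool) : ∃ i : ℤ,
    l.foldr (fun _ p => bif decide (c ≤ p / 8) then p / 8 else p) (8 ^ u) = (8 : ℚ) ^ i ∧
      c ≤ 8 ^ i ∧ i ≤ u ∧ ((8 : ℚ) ^ i < 8 * c ∨ i = u - l.length) := by
  induction l with
  | nil => exact ⟨u, rfl, hu, le_rfl, Or.inr (by simp)⟩
  | cons b l ih =>
    obtain ⟨i, h1, h2, h3, h4⟩ := ih
    have h5 : (8 : ℚ) ^ i / 8 = 8 ^ (i - 1) := (zpow_sub_one₀ (by norm_num) i).symm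
    rw [List.foldr_cons, h1, h5]
    by_cases h : c ≤ (8 : ℚ) ^ (i - 1)
    · rw [decide_eq_true h, cond_true]
      refine ⟨i - 1, rfl, h, by omega, Or.inr ?_⟩
      rcases h4 with h4 | h4
      · rw [← h5] at h
        linarith
      · rw [h4, List.length_cons]
        push_cast
        ring
    · rw [decide_eq_false h, cond_false]
      refine ⟨i, rfl, h2, h3, Or.inl ?_⟩
      rw [← h5] at h
      linarith [not_le.1 h]

lemma lt_two_pow_length_bits {c : ℚ} (hc : 0 < c) :
    c < 2 ^ (Nat.bits ⌊|c|⌋₊).length := by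
  rw [abs_of_pos hc, Nat.size_eq_bits_len]
  refine (Nat.lt_floor_add_one c).trans_le ?_
  exact_mod_cast Nat.lt_size_self _

lemma roundUp_eq {c : ℚ} (hc : 0 < c) : ((roundUp c : ℚ) : ℝ) = round8 c := by
  obtain ⟨u, h1, h2, h3⟩ := exists_foldr_mul c (Nat.bits ⌊|c|⌋₊)
  have h2' : c ≤ 8 ^ u := by
    rcases h2 with h2 | h2
    · exact h2
    · rw [h2]
      exact (lt_two_pow_length_bits hc).le.trans (pow_le_pow_left₀ (by norm_num) (by norm_num) _)
  obtain ⟨i, h4, h5, h6, h7⟩ := exists_foldr_div c u (by exact_mod_cast h2')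
    (Nat.bits ⌊|1 / c|⌋₊)
  have h8 : (8 : ℚ) ^ i < 8 * c := by
    rcases h7 with h7 | h7
    · exact h7
    -- If the first loop never multiplied, enough divisions are available because `1 / c < 8 ^ l`
    -- for the bit length `l` of `1 / c`. If it did multiply, it ended below `8 * c`, and dividing
    -- only decreases.
    rcases h3 with h3 | h3
    · have h9 := lt_two_pow_length_bits (one_div_pos.2 hc)
      rw [h7, h3, Nat.cast_zero, zero_sub, zpow_neg, zpow_natCast]
      have h10 : (2 : ℚ) ^ (Nat.bits ⌊|1 / c|⌋₊).length ≤ 8 ^ (Nat.bits ⌊|1 / c|⌋₊).length :=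
        pow_le_pow_left₀ (by norm_num) (by norm_num) _
      have h11 := inv_lt_of_inv_lt₀ hc ((one_div c).symm.trans_lt (h9.trans_le h10))
      exact h11.trans_le (le_mul_of_one_le_left hc.le (by norm_num))
    · refine lt_of_le_of_lt ?_ h3
      rw [← zpow_natCast]
      exact zpow_le_zpow_right₀ (by norm_num) h6
  have h9 : roundUp c = (8 : ℚ) ^ i := by
    unfold roundUp
    rw [h1, ← h4, zpow_natCast]
  have h10 : (c : ℝ) ≤ 8 ^ i := by
    have := (Rat.cast_le (K := ℝ)).2 h5
    push_cast at this
    exact this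
  have h11 : (8 : ℝ) ^ i < 8 * c := by
    have := (Rat.cast_lt (K := ℝ)).2 h8
    push_cast at this
    exact this
  rw [h9, round8_eq (Rat.cast_pos.2 hc) h10 h11]
  push_cast
  rfl

/-! ## Correctness of the output -/

lemma enum_ofFn {B : Type} {n : ℕ} (f : Fin n → B) :
    enum (List.ofFn f) = (List.finRange n).map fun i => (((Fin.rev i : ℕ) : ℚ), f i) := by
  induction n with
  | zero => rfl
  | succ n ih =>
    rw [List.ofFn_succ, List.finRange_succ, List.map_cons, List.map_map]
    have h1 : enum (f 0 :: List.ofFn fun i : Fin n => f i.succ) =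
      (len (enum (List.ofFn fun i : Fin n => f i.succ)), f 0) ::
        enum (List.ofFn fun i : Fin n => f i.succ) := rfl
    rw [h1, len_eq, length_enum, ih, List.length_ofFn]
    congr 1
    refine List.map_congr_left fun i _ => ?_
    simp [Fin.val_rev]

lemma paretoInsert_map {B C F : Type} [LinearOrder F] (κ : B → C) (g r : C → F) (x : B)
    (L : List B) : paretoInsert g r (κ x) (L.map κ) =
      (paretoInsert (fun b => g (κ b)) (fun b => r (κ b)) x L).map κ := by
  unfold paretoInsert
  rw [List.any_map, List.filter_map, List.filter_map]
  simp only [Function.comp_def]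
  cases L.any _
  · simp
  · simp

lemma pareto_map {B C F : Type} [LinearOrder F] (κ : B → C) (g r : C → F) (l : List B) :
    pareto g r (l.map κ) = (pareto (fun b => g (κ b)) (fun b => r (κ b)) l).map κ := by
  induction l with
  | nil => rfl
  | cons b l ih =>
    unfold pareto at ih ⊢
    rw [List.map_cons, List.foldr_cons, ih, paretoInsert_map, List.foldr_cons]

variable {n k : ℕ} (A : Inst ℚ n k)

/-- The jobs of an instance as values of the program. -/
def jobVal (j : Fin n) : Job := (((Fin.rev j : ℕ) : ℚ), A.s j, A.arr j, A.dep j)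

/-- The types of an instance, at rounded rates, as values of the program. -/
def kindVal (y : Fin k) : Kind := (A.g y, roundUp (A.r y), ((y : ℕ) : ℚ))

/-- The types that are not dominated after rounding. -/
def keptTypes : List (Fin k) :=
  pareto (fun y => A.g y) (fun y => roundUp (A.r y)) (List.finRange k)

lemma enum_encode : enum A.encode.2 = (List.finRange n).map (jobVal A) := enum_ofFn _

lemma types_encode : types A.encode.1 = (List.finRange (keptTypes A).length).map
    fun z => kindVal A ((keptTypes A).get z) := by
  have h1 : (enum A.encode.1).map (fun y => ((y.2.1, roundUp y.2.2,
      len A.encode.1 - 1 - y.1) : Kind)) = (List.finRange k).map (kindVal A) := by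
    have h2 : enum A.encode.1 = (List.finRange k).map
        fun y => (((Fin.rev y : ℕ) : ℚ), (A.g y, A.r y)) := enum_ofFn _
    rw [h2, List.map_map]
    refine List.map_congr_left fun y _ => ?_
    have h3 : len A.encode.1 = (k : ℚ) := by
      rw [len_eq]
      simp [Inst.encode]
    have h4 : (((Fin.rev y : ℕ) : ℚ)) = k - 1 - (y : ℕ) := by
      have : (Fin.rev y : ℕ) + 1 + (y : ℕ) = k := by
        rw [Fin.val_rev]
        omega
      have h5 : (((Fin.rev y : ℕ) : ℚ)) + 1 + ((y : ℕ) : ℚ) = k := by exact_mod_cast this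
      rw [← h5]
      ring
    simp only [Function.comp_apply, h3, h4, kindVal]
    ring_nf
  unfold types
  rw [h1, pareto_map]
  change (keptTypes A).map (kindVal A) = _
  conv_lhs => rw [← List.map_get_finRange (keptTypes A), List.map_map]
  rfl

lemma hasEvents_encode : HasEvents (jobVal A) (events A.encode.2) := by
  intro j
  unfold events
  have h : (A.s j, A.arr j, A.dep j) ∈ A.encode.2 := List.mem_ofFn.2 ⟨j, rfl⟩
  exact ⟨List.mem_append_left _ (List.mem_map_of_mem (f := fun j : ℚ × ℚ × ℚ => j.2.1) h),
    List.mem_append_right _ (List.mem_map_of_mem (f := fun j : ℚ × ℚ × ℚ => j.2.2) h)⟩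

variable {A}

lemma isNormalization_keptTypes (hA : A.toReal.Valid) :
    A.toReal.IsNormalization (A.toReal.ofTypes (keptTypes A)) (keptTypes A).get := by
  obtain ⟨h1, -, h3⟩ := pareto_spec (fun y => A.g y) (fun y => roundUp (A.r y)) (List.finRange k)
  have hr : ∀ y, ((roundUp (A.r y) : ℚ) : ℝ) = round8 (A.toReal.r y) := fun y =>
    roundUp_eq (Rat.cast_pos.1 (hA.r_pos y))
  refine isNormalization_ofTypes hA (h1.imp fun h => ?_) fun y => ?_
  · simp only [← hr]
    exact ⟨Rat.cast_lt.2 h.1, Rat.cast_lt.2 h.2⟩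
  · obtain ⟨z, hz, hz1, hz2⟩ := h3 y (List.mem_finRange y)
    refine ⟨z, hz, Rat.cast_le.2 hz1, ?_⟩
    rw [← hr, ← hr]
    exact Rat.cast_le.2 hz2

lemma represents_keptTypes (hA : A.toReal.Valid) :
    Represents (A.toReal.ofTypes (keptTypes A)) (jobVal A)
      fun z => kindVal A ((keptTypes A).get z) where
  s _ := rfl
  arr _ := rfl
  dep _ := rfl
  g _ := rfl
  r _ := roundUp_eq (Rat.cast_pos.1 (hA.r_pos _))
  num _ _ h := Fin.rev_injective (Fin.ext (Nat.cast_injective h))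

lemma exists_run_eq (hA : A.toReal.Valid) : ∃ (m : ℕ) (I : Inst ℝ n m) (e : Fin m → Fin k)
    (σ : Sched n m), A.toReal.IsNormalization I e ∧ I.IsOffline σ ∧ I.DualColoringBound σ ∧
      run A.encode = encodeSched (liftSched e σ) := by
  have hN := isNormalization_keptTypes hA
  have hI := hN.standard
  choose ty hty using fun j => exists_mem_K hI.toValid j
  refine ⟨_, _, _, layered (A.toReal.ofTypes (keptTypes A)) (fun j => (Fin.rev j : ℕ)) ty, hN,
    isOffline_layered hI hty (fun i j h => Fin.rev_injective (Fin.ext h))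
      (fun j => (Fin.rev j).2), dualColoringBound_layered hI hty, ?_⟩
  unfold run
  rw [types_encode, enum_encode, List.map_map]
  unfold encodeSched
  rw [List.ofFn_eq_map]
  refine List.map_congr_left fun j _ => ?_
  have := (represents_keptTypes hA).assign_eq hI (hasEvents_encode A)
    (num := fun j => (Fin.rev j : ℕ)) (fun _ => rfl) hty j
  rw [sorted_univ] at this
  exact this

/-- The overhead for pairs and list entries is absorbed by the factor 2, since every number has bit
length at least 1; the `3` is for the two lists and the outer pair. -/
lemma size_encode_le (A : Inst ℚ n k) : inputTy.size A.encode ≤ 2 * A.bitSize + 3 := by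
  have h1 : ∀ q : ℚ, 1 ≤ numSize q := fun q => (one_le_sz q).trans (sz_le_numSize q)
  have h0 : inputTy.size A.encode =
      (List.map (fun y : ℚ × ℚ => sz y.1 + sz y.2 + 1 + 1) A.encode.1).sum + 1 +
        ((List.map (fun j : ℚ × ℚ × ℚ => sz j.1 + (sz j.2.1 + sz j.2.2 + 1) + 1 + 1)
          A.encode.2).sum + 1) + 1 := rfl
  rw [h0]
  unfold Inst.encode Inst.bitSize
  simp only [List.map_ofFn, List.sum_ofFn, Function.comp_apply]
  have h2 : ∑ z, (sz (A.g z) + sz (A.r z) + 1 + 1) ≤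
      2 * ∑ z, (numSize (A.g z) + numSize (A.r z)) := by
    rw [Finset.mul_sum]
    refine Finset.sum_le_sum fun z _ => ?_
    have := sz_le_numSize (A.g z)
    have := sz_le_numSize (A.r z)
    have := h1 (A.g z)
    have := h1 (A.r z)
    omega
  have h3 : ∑ j, (sz (A.s j) + (sz (A.arr j) + sz (A.dep j) + 1) + 1 + 1) ≤
      2 * ∑ j, (numSize (A.s j) + numSize (A.arr j) + numSize (A.dep j)) := by
    rw [Finset.mul_sum]
    refine Finset.sum_le_sum fun j _ => ?_
    have := sz_le_numSize (A.s j)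
    have := sz_le_numSize (A.arr j)
    have := sz_le_numSize (A.dep j)
    have := h1 (A.s j)
    have := h1 (A.arr j)
    have := h1 (A.dep j)
    omega
  omega

end Alg

/-- A standard instance is its own normalization, so the schedule found through the normalization is
a schedule of the algorithm for the instance itself. -/
lemma Inst.IsNormalization.offline_of_standard {n m k : ℕ} {A : Inst ℝ n k} {I : Inst ℝ n m}
    {e : Fin m → Fin k} (hA : A.Standard) (h : A.IsNormalization I e) {σ : Sched n m}
    (hσ : I.IsOffline σ) (hb : I.DualColoringBound σ) :
    A.IsOffline (liftSched e σ) ∧ A.DualColoringBound (liftSched e σ) := by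
  obtain ⟨rfl, he⟩ := h.eq_of_standard hA
  have he' : e = id := funext he
  subst he'
  have hAI : I = A := by
    have h1 := funext h.g_eq
    have h2 : I.r = A.r := funext fun z => by
      rw [h.r_eq]
      obtain ⟨i, hi⟩ := hA.r_pow z
      change round8 (A.r z) = A.r z
      rw [hi, round8_zpow]
    have h3 := h.s_eq
    have h4 := h.arr_eq
    have h5 := h.dep_eq
    cases I
    cases A
    simp_all
  subst hAI
  exact ⟨hσ, hb⟩

end BSHM

theorem mainTheorem1 :
    -- real instances with normalised machine types
    (∀ (n m : ℕ) (I : BSHM.Inst ℝ n m), I.Standard →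
      (∀ t : ℝ, I.neededRate t ≤ 45 * I.optOneShot (I.activeIn Finset.univ t)) ∧
      (∃ σ : BSHM.Inst.Sched n m, I.IsOffline σ ∧ I.DualColoringBound σ) ∧
      MeasureTheory.IntegrableOn (fun t => I.neededRate t) (I.span Finset.univ) ∧
      MeasureTheory.IntegrableOn (fun t => I.optOneShot (I.activeIn Finset.univ t))
        (I.span Finset.univ) ∧
      (∀ σ : BSHM.Inst.Sched n m, I.IsOffline σ → I.DualColoringBound σ →
        I.cost σ ≤ ∫ t in I.span Finset.univ, 4 * I.neededRate t) ∧
      (∫ t in I.span Finset.univ, 4 * I.neededRate t) ≤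
        180 * ∫ t in I.span Finset.univ, I.optOneShot (I.activeIn Finset.univ t) ∧
      (∫ t in I.span Finset.univ, I.optOneShot (I.activeIn Finset.univ t)) ≤ I.opt ∧
      (∀ σ : BSHM.Inst.Sched n m, I.IsOffline σ → I.DualColoringBound σ →
        I.cost σ ≤ 180 * I.opt)) ∧
    -- real instances with arbitrary machine types
    (∀ (n k : ℕ) (A : BSHM.Inst ℝ n k), A.Valid →
      (∃ (m : ℕ) (I : BSHM.Inst ℝ n m) (e : Fin m → Fin k), A.IsNormalization I e) ∧
      (∀ (m : ℕ) (I : BSHM.Inst ℝ n m) (e : Fin m → Fin k), A.IsNormalization I e →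
        ∀ σ : BSHM.Inst.Sched n m, I.IsOffline σ → I.DualColoringBound σ →
          A.Feasible (BSHM.Inst.liftSched e σ) ∧
          A.cost (BSHM.Inst.liftSched e σ) ≤ 1440 * A.opt)) ∧
    -- the algorithm runs in polynomial time on rational instances
    (∃ (P : BSHM.Prog) (p : Polynomial ℕ),
      ∀ (n k : ℕ) (A : BSHM.Inst ℚ n k), A.toReal.Valid →
        P.steps A ≤ p.eval A.bitSize ∧
        (A.toReal.Standard → ∃ σ : BSHM.Inst.Sched n k,
          P.output A = BSHM.encodeSched σ ∧ A.toReal.IsOffline σ ∧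
          A.toReal.DualColoringBound σ ∧ A.toReal.cost σ ≤ 180 * A.toReal.opt) ∧
        (∃ (m : ℕ) (I : BSHM.Inst ℝ n m) (e : Fin m → Fin k) (σ : BSHM.Inst.Sched n m),
          A.toReal.IsNormalization I e ∧ I.IsOffline σ ∧ I.DualColoringBound σ ∧
          P.output A = BSHM.encodeSched (BSHM.Inst.liftSched e σ) ∧
          A.toReal.cost (BSHM.Inst.liftSched e σ) ≤ 1440 * A.toReal.opt)) := by
  refine ⟨fun n m I hI => ?_, fun n k A hA => ⟨BSHM.Inst.exists_normalization hA, ?_⟩, ?_⟩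
  · exact ⟨BSHM.Inst.neededRate_le hI, BSHM.Inst.exists_offline hI,
      BSHM.Inst.integrableOn_neededRate I, BSHM.Inst.integrableOn_optOneShot I,
      fun σ _ hσ => BSHM.Inst.cost_le_integral hI.toValid hσ, BSHM.Inst.integral_neededRate_le hI,
      BSHM.Inst.integral_optOneShot_le_opt hI.toValid,
      fun σ _ hσ => BSHM.Inst.cost_le_opt hI hσ⟩
  · exact fun m I e h σ h1 h2 => ⟨h.feasible_lift hA h1.1, h.lift_bound hA h2⟩
  · obtain ⟨P, p, hP⟩ := BSHM.Alg.exists_prog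
    refine ⟨P, p.comp (2 * Polynomial.X + 3), fun n k A hA => ?_⟩
    obtain ⟨m, I, e, σ, h, h1, h2, hrun⟩ := BSHM.Alg.exists_run_eq hA
    have hout : P.output A = BSHM.encodeSched (BSHM.Inst.liftSched e σ) :=
      (hP A.encode).1.trans hrun
    refine ⟨?_, fun hS => ?_, m, I, e, σ, h, h1, h2, hout, h.lift_bound hA h2⟩
    · refine (hP A.encode).2.trans ((BSHM.eval_mono p (BSHM.Alg.size_encode_le A)).trans ?_)
      simp
    · obtain ⟨h3, h4⟩ := h.offline_of_standard hS h1 h2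
      exact ⟨_, hout, h3, h4, BSHM.Inst.cost_le_opt hS h4⟩
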